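/- A hypergraph $(H=(V,E),w)$ consists of a finite vertex set $V$, a set $E$ of subsets of $V$ (the hyperedges) and positive integer weights $w:E\to\mathbb Z_{+}$. For $X\subseteq V$ let $b_{(H,w)}(X)$ be the total weight of the hyperedges $e$ with $e\cap X\neq\emptyset$, and $d_{(H,w)}(X)$ the total weight of the hyperedges $e$ with $e\cap X\ne\emptyset$ and $e\setminus X\neq\emptyset$. A set function $p:2^V\to\mathbb Z$ is symmetric if $p(X)=p(V\setminus X)$ for all $X\subseteq V$, and skew-supermodular if for all $X,Y\subseteq V$ at least one of $p(X)+p(Y)\le p(X\cap Y)+p(X\cup Y)$ and $p(X)+p(Y)\le p(X\setminus Y)+p(Y\setminus X)$ holds. A hypergraph $(G,c)$ on $V$ is obtained from $(H,w)$ by merging hyperedges if the multi-hypergraph $G_c$ with $c(e)$ copies of each hyperedge $e$ arises from the multi-hypergraph $H_w$ by repeatedly replacing two disjoint hyperedges of the current multi-hypergraph (one copy of each) by their union. The maximization oracle of $p$ takes a hypergraph $(G_0,c_0)$ on the vertex set $V$ and disjoint sets $S_0,T_0\subseteq V$, and returns a pair $(Z,p(Z))$ where $Z$ maximizes $p(Z)-d_{(G_0,c_0)}(Z)$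 over all $Z$ with $S_0\subseteq Z\subseteq V\setminus T_0$. **Theorem.** Let $(H=(V,E),w:E\to\mathbb Z_+)$ be a hypergraph and $p:2^V\to\mathbb Z$ a symmetric skew-supermodular function such that $b_{(H,w)}(X)\ge p(X)$ for every $X\subseteq V$. Then there is a hypergraph $(H^*=(V,E^*),w^*:E^*\to\mathbb Z_+)$ such that 1. $d_{(H^*,w^*)}(X)\ge p(X)$ for every $X\subseteq V$, 2. $(H^*,w^*)$ is obtained by merging hyperedges of $(H,w)$, and 3. $|E^*|-|E|=O(|V|)$. Furthermore, there is one algorithm that, for every such $(H,w)$ with $V\neq\emptyset$ and every such $p$, given $(H,w)$ as input and $p$ only through its maximization oracle (any oracle that answers correctly), runs in $O(|V|^3(|V|+|E|)^2)$ time, makes $O(|V|^3(|V|+|E|))$ oracle queries, and returns a hypergraph $(H^*,w^*)$ with properties 1, 2 and 3. The time includes the construction of the hypergraphs used in the queries, and each of these hypergraphs, whose vertex set is $V$, has $O(|V|+|E|)$ hyperedges. All implied constants are absolute. Here the algorithm is a fixed program for a random access machine with integer variables and two-index integer arrays, whose only arithmetic operations are addition, subtraction and comparison of integers; each operation, memory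 access, test and oracle call costs one unit of time. In the input, in each query and in the output, a hypergraph is given by the number of hyperedges, the list of the $0/1$ incidence vectors of its hyperedges (each listed once) and the list of their weights. -/

import Mathlib

/-! ## Weighted hypergraphs and set functions -/

/-- A hypergraph `(H = (V, E), w : E → ℤ₊)` with positive integer weights on the vertex set `V`.
It is given by the function that sends every `e ⊆ V` to `w e` if `e ∈ E` and to `0` otherwise;
so `E` is the support of this function. -/
abbrev WHypergraph (V : Type*) := Finset V →₀ ℕ

namespace WHypergraph

variable {V : Type*}

/-- The set `E` of hyperedges. -/
def edges (H : WHypergraph V) : Finset (Finset V) := H.support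

/-- The multi-hypergraph `H_w`, which contains `w e` copies of every hyperedge `e`. -/
noncomputable def multi (H : WHypergraph V) : Multiset (Finset V) := Finsupp.toMultiset H

/-- The cut function: the total weight of the hyperedges that meet both `X` and its complement. -/
def cut [DecidableEq V] (H : WHypergraph V) (X : Finset V) : ℕ :=
  ∑ e ∈ H.edges with (e ∩ X).Nonempty ∧ (e \ X).Nonempty, H e

/-- The coverage function: the total weight of the hyperedges that meet `X`. -/
def coverage [DecidableEq V] (H : WHypergraph V) (X : Finset V) : ℕ :=
  ∑ e ∈ H.edges with (e ∩ X).Nonempty, H e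

/-- `H` weakly covers the set function `p`. -/
def WeaklyCovers [DecidableEq V] (H : WHypergraph V) (p : Finset V → ℤ) : Prop :=
  ∀ X : Finset V, p X ≤ (H.coverage X : ℤ)

/-- `H` strongly covers the set function `p`. -/
def StronglyCovers [DecidableEq V] (H : WHypergraph V) (p : Finset V → ℤ) : Prop :=
  ∀ X : Finset V, p X ≤ (H.cut X : ℤ)

/-- One merging operation in a multi-hypergraph: two disjoint hyperedges (one copy of each) are
replaced by their union. -/
inductive MergeStep [DecidableEq V] : Multiset (Finset V) → Multiset (Finset V) → Prop
  | merge (e f : Finset V) (s : Multiset (Finset V)) (h : Disjoint e f) :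
      MergeStep (e ::ₘ f ::ₘ s) ((e ∪ f) ::ₘ s)

/-- `G` is obtained from `H` by merging hyperedges: the multi-hypergraph of `G` arises from that of
`H` by repeatedly merging two disjoint hyperedges of the current multi-hypergraph. -/
def ObtainedByMerging [DecidableEq V] (H G : WHypergraph V) : Prop :=
  Relation.ReflTransGen MergeStep H.multi G.multi

end WHypergraph

/-- `p X = p (V - X)` for every `X ⊆ V`. -/
def SymmetricSetFunction {V : Type*} [Fintype V] [DecidableEq V] (p : Finset V → ℤ) : Prop :=
  ∀ X : Finset V, p X = p Xᶜ

/-- For all `X, Y ⊆ V` at least one of the two supermodular inequalities holds. -/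
def SkewSupermodular {V : Type*} [DecidableEq V] (p : Finset V → ℤ) : Prop :=
  ∀ X Y : Finset V,
    p X + p Y ≤ p (X ∩ Y) + p (X ∪ Y) ∨ p X + p Y ≤ p (X \ Y) + p (Y \ X)

/-! ## The maximization oracle -/

/-- The input `((G₀, c₀), S₀, T₀)` of the oracle; the hypergraph has vertex set `V`. -/
structure MaxQuery (V : Type*) where
  graph : WHypergraph V
  S : Finset V
  T : Finset V

/-- `O` is an oracle that, for disjoint `S₀` and `T₀`, returns a pair `(Z, p Z)` where `Z` maximizes
`p Z - d Z` over all `Z` with `S₀ ⊆ Z ⊆ V - T₀`, where `d` is the cut function of `(G₀, c₀)`. -/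
def IsMaxOracle {V : Type*} [Fintype V] [DecidableEq V] (p : Finset V → ℤ)
    (O : MaxQuery V → Finset V × ℤ) : Prop :=
  ∀ q : MaxQuery V, Disjoint q.S q.T →
    (q.S ⊆ (O q).1 ∧ (O q).1 ⊆ q.Tᶜ) ∧
    (∀ X : Finset V, q.S ⊆ X → X ⊆ q.Tᶜ →
      p X - (q.graph.cut X : ℤ) ≤ p (O q).1 - (q.graph.cut (O q).1 : ℤ)) ∧
    (O q).2 = p (O q).1

/-! ## Random access machines with an oracle

A program works on integer variables and on integer arrays with two indices. Its only arithmetic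
operations are addition, subtraction and comparison. Every operation, memory access, test and
oracle call takes one unit of time. -/

namespace RAM

/-- The memory: variable `x` holds `var x`, and the cell `(i, j)` of array `a` holds `arr a i j`. -/
@[ext]
structure Memory where
  var : ℕ → ℤ
  arr : ℕ → ℤ → ℤ → ℤ

/-- Arithmetic expressions. -/
inductive Expr
  | const (c : ℤ)
  | var (x : ℕ)
  | get (a : ℕ) (i j : Expr)
  | add (s t : Expr)
  | sub (s t : Expr)

namespace Expr

def eval (σ : Memory) : Expr → ℤ
  | const c => c
  | var x => σ.var x
  | get a i j => σ.arr a (i.eval σ) (j.eval σ)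
  | add s t => s.eval σ + t.eval σ
  | sub s t => s.eval σ - t.eval σ

/-- The time to evaluate an expression: the number of its nodes. -/
def cost : Expr → ℕ
  | const _ => 1
  | var _ => 1
  | get _ i j => i.cost + j.cost + 1
  | add s t => s.cost + t.cost + 1
  | sub s t => s.cost + t.cost + 1

end Expr

/-- Tests. -/
inductive Test
  | le (s t : Expr)
  | eq (s t : Expr)
  | not (b : Test)
  | and (b c : Test)

namespace Test

def Holds (σ : Memory) : Test → Prop
  | le s t => s.eval σ ≤ t.eval σ
  | eq s t => s.eval σ = t.eval σ
  | not b => ¬ b.Holds σ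
  | and b c => b.Holds σ ∧ c.Holds σ

/-- The time to evaluate a test: the number of its nodes. -/
def cost : Test → ℕ
  | le s t => s.cost + t.cost + 1
  | eq s t => s.cost + t.cost + 1
  | not b => b.cost + 1
  | and b c => b.cost + c.cost + 1

end Test

/-- Programs. The instruction `query k G c S T Z z` calls the oracle. It reads the number of
hyperedges from variable `k`, the hyperedges and their weights from arrays `G` and `c`, and the sets
`S₀` and `T₀` from arrays `S` and `T`; it writes the returned set to array `Z` and the returned
value to variable `z`. -/
inductive Prog
  | skip
  | assign (x : ℕ) (t : Expr)
  | store (a : ℕ) (i j t : Expr)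
  | query (k G c S T Z z : ℕ)
  | seq (P Q : Prog)
  | ite (b : Test) (P Q : Prog)
  | loop (b : Test) (P : Prog)

namespace Memory

def setVar (σ : Memory) (x : ℕ) (t : ℤ) : Memory where
  var := Function.update σ.var x t
  arr := σ.arr

def setCell (σ : Memory) (a : ℕ) (i j t : ℤ) : Memory where
  var := σ.var
  arr := fun a' i' j' => if a' = a ∧ i' = i ∧ j' = j then t else σ.arr a' i' j'

/-- Row `i` of array `a` is the 0/1 incidence vector of the set `X` of vertices. -/
def RowIs {n : ℕ} (σ : Memory) (a : ℕ) (i : ℤ) (X : Finset (Fin n)) : Prop :=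
  ∀ v : Fin n, σ.arr a i (v : ℕ) = if v ∈ X then 1 else 0

/-- Overwrites the first `n` entries of row `0` of array `a` by the incidence vector of `X`. -/
def setRow {n : ℕ} (σ : Memory) (a : ℕ) (X : Finset (Fin n)) : Memory where
  var := σ.var
  arr := fun a' i j =>
    if a' = a ∧ i = 0 ∧ 0 ≤ j ∧ j < n then
      if ∃ v ∈ X, ((v : ℕ) : ℤ) = j then 1 else 0
    else σ.arr a' i j

/-- The hypergraph `H` is stored in variable `k` and arrays `G` and `c`: variable `k` holds the
number `m` of hyperedges, the rows `0, …, m - 1` of `G` are the incidence vectors of the hyperedges,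
each listed once, and `c` holds their weights. -/
def Stores {n : ℕ} (σ : Memory) (k G c : ℕ) (H : WHypergraph (Fin n)) : Prop :=
  ∃ e : Fin H.edges.card ≃ H.edges,
    σ.var k = (H.edges.card : ℤ) ∧
    ∀ i : Fin H.edges.card,
      σ.RowIs G (i : ℕ) (e i : Finset (Fin n)) ∧
      σ.arr c (i : ℕ) 0 = (H (e i : Finset (Fin n)) : ℤ)

/-- The initial memory for the input hypergraph `H` on the vertices `0, …, n - 1`: variable `0`
holds `n`, the hypergraph is stored in variable `1` and arrays `0` and `1`, and all other variables
and arrays are zero. -/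
structure IsInput {n : ℕ} (σ : Memory) (H : WHypergraph (Fin n)) : Prop where
  numVertices : σ.var 0 = (n : ℤ)
  stores : σ.Stores 1 0 1 H
  var_zero : ∀ x : ℕ, 2 ≤ x → σ.var x = 0
  arr_zero : ∀ (a : ℕ) (i j : ℤ), 2 ≤ a → σ.arr a i j = 0

/-- The output hypergraph is stored in variable `1` and arrays `0` and `1`. -/
def IsOutput {n : ℕ} (σ : Memory) (H : WHypergraph (Fin n)) : Prop :=
  σ.Stores 1 0 1 H

end Memory

/-- `Exec O P σ τ t qs`: with oracle `O`, the program `P` started in memory `σ` halts in memory `τ`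
after `t` units of time, and `qs` is the list of the queries that it makes. An oracle call is
possible only if the designated part of the memory stores a hypergraph and two disjoint sets. -/
inductive Exec {n : ℕ} (O : MaxQuery (Fin n) → Finset (Fin n) × ℤ) :
    Prog → Memory → Memory → ℕ → List (MaxQuery (Fin n)) → Prop
  | skip (σ : Memory) : Exec O Prog.skip σ σ 1 []
  | assign (x : ℕ) (t : Expr) (σ : Memory) :
      Exec O (Prog.assign x t) σ (σ.setVar x (t.eval σ)) (t.cost + 1) []
  | store (a : ℕ) (i j t : Expr) (σ : Memory) :
      Exec O (Prog.store a i j t) σ (σ.setCell a (i.eval σ) (j.eval σ) (t.eval σ))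
        (i.cost + j.cost + t.cost + 1) []
  | query (k G c S T Z z : ℕ) (σ : Memory) (q : MaxQuery (Fin n))
      (hgraph : σ.Stores k G c q.graph) (hS : σ.RowIs S 0 q.S) (hT : σ.RowIs T 0 q.T)
      (hST : Disjoint q.S q.T) :
      Exec O (Prog.query k G c S T Z z) σ ((σ.setRow Z (O q).1).setVar z (O q).2) 1 [q]
  | seq {P Q : Prog} {σ τ ρ : Memory} {t₁ t₂ : ℕ} {q₁ q₂ : List (MaxQuery (Fin n))}
      (h₁ : Exec O P σ τ t₁ q₁) (h₂ : Exec O Q τ ρ t₂ q₂) :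
      Exec O (Prog.seq P Q) σ ρ (t₁ + t₂) (q₁ ++ q₂)
  | ite_true {b : Test} {P Q : Prog} {σ τ : Memory} {t : ℕ} {qs : List (MaxQuery (Fin n))}
      (hb : b.Holds σ) (h : Exec O P σ τ t qs) :
      Exec O (Prog.ite b P Q) σ τ (b.cost + 1 + t) qs
  | ite_false {b : Test} {P Q : Prog} {σ τ : Memory} {t : ℕ} {qs : List (MaxQuery (Fin n))}
      (hb : ¬ b.Holds σ) (h : Exec O Q σ τ t qs) :
      Exec O (Prog.ite b P Q) σ τ (b.cost + 1 + t) qs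
  | loop_stop {b : Test} {P : Prog} {σ : Memory} (hb : ¬ b.Holds σ) :
      Exec O (Prog.loop b P) σ σ (b.cost + 1) []
  | loop_step {b : Test} {P : Prog} {σ τ ρ : Memory} {t₁ t₂ : ℕ}
      {q₁ q₂ : List (MaxQuery (Fin n))}
      (hb : b.Holds σ) (h₁ : Exec O P σ τ t₁ q₁) (h₂ : Exec O (Prog.loop b P) τ ρ t₂ q₂) :
      Exec O (Prog.loop b P) σ ρ (b.cost + 1 + t₁ + t₂) (q₁ ++ q₂)

end RAM

/-!
# Covering symmetric skew-supermodular functions by merging hyperedges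

Call a set `X` tight if the coverage of `X` equals `p X`. Two disjoint nonempty hyperedges `e` and
`f` can be merged without destroying the weak cover unless a tight set meets both of them, since
merging `α` copies lowers the coverage of a set by `α` if the set meets both `e` and `f`, and
changes no other coverage (`coverage_mergeSlots`). If no two hyperedges can be merged, then weak
cover implies strong cover (`stronglyCovers_of_stuck`): among the sets that maximize `p X - d X > 0`
take a minimal `X` and a maximal `Z ⊇ X`, a hyperedge inside `X` and one outside `Z`, and uncross
`Z` with a tight set `Y` that meets both hyperedges, and then `X` with `Z \ Y`. So it suffices to
merge as long as possible; what has to be controlled is the number of distinct hyperedges.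

For this, each step merges the largest possible number of copies of `e` and `f`. Consider the rank
of the incidence vectors of the tight sets over the current hyperedges, where the entry of a tight
set at a hyperedge says whether they meet. Tight sets can be uncrossed, and then the vectors add up,
so these vectors are spanned by those of a laminar family, and the rank is at most `2|V|`
(`tightRank_le`). If both `e` and `f` survive a step, then there is one hyperedge more, but the step
was stopped by a new tight set that meets both, whose vector is independent of the old ones: for the
old tight sets the columns of `e` and `f` add up to the column of `e ∪ f`. In the other cases the
number of hyperedges minus the rank does not increase either. Hence at most `2|V|` hyperedges are
added (`Good.merge`), and a similar potential bounds the number of steps by `O(|V| (|V| + |E|))`.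

The algorithm runs through the pairs of slots that hold the hyperedges. To find the number of copies
for a pair, it starts with the smaller of the two weights and goes through the vertices `t`. If the
vertex `t` is added to all hyperedges, then the cut function agrees with the coverage on the sets
that avoid `t` (`cut_addVertex`), so that one query with `T₀ = {t}` finds the largest violation
among these sets, by which the number of copies is lowered (`lower_copies_of_max`). The set of all
vertices is never violated, because `p V = p ∅ ≤ 0`. If a tight set has stopped the step, then a
pair of vertices of `e` and `f` in this set is marked. Sets that are tight remain tight, so the
pairs of hyperedges that contain a marked pair need not be considered again, and every merging step
lowers the potential or marks a new pair (`runs_mergePair`). A pair of slots that cannot be merged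
at some time cannot be merged later, also after one of its hyperedges has grown; so one run through
the pairs, in which each pair costs `O(|V|²)` time unless it is merged, is enough (`runs_mainLoop`).

When slots are turned into a hypergraph, equal hyperedges have to be identified. A hyperedge is
found by the number whose binary digits form its incidence vector: an array that is addressed by
these numbers holds the positions of the hyperedges (`Table`).

The variables of the program are: `0` the number of vertices; `1` the number of hyperedges of the
stored hypergraph; `2` the number of slots; `3` and `4` the current pair of slots; `5` the current
vertex; `6`, `7` and `16` counters; `8` and `9` a code and its position; `10` the value returned by
the oracle; `11` and `12` the coverage of the returned set and whether a slot meets this set; `13`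
and `14` the pair of vertices to be marked; `15` the result of the test of a pair; `17` whether a
tight set has stopped the current step. The arrays are: `0` and `1` the hyperedges and weights of
the stored hypergraph; `2` and `3` those of the slots; `4` the positions of the codes; `5` the codes
of the hyperedges; `6` and `7` the sets `S₀` and `T₀` of a query; `8` the set returned by the
oracle; `9` the marks.
-/

namespace WHypergraph

section

variable {V : Type*} [DecidableEq V]

/-! ### Coverage and cut functions -/

/-- `1` if the hyperedge `e` meets `X`, and `0` otherwise. -/
def hits (e X : Finset V) : ℕ := if (e ∩ X).Nonempty then 1 else 0

/-- `1` if the hyperedge `e` meets both `X` and its complement, and `0` otherwise. -/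
def crosses (e X : Finset V) : ℕ := if (e ∩ X).Nonempty ∧ (e \ X).Nonempty then 1 else 0

lemma hits_eq_one {e X : Finset V} : hits e X = 1 ↔ ∃ v ∈ e, v ∈ X := by
  unfold hits
  split_ifs with h
  · simpa [Finset.Nonempty] using h
  · simpa [Finset.Nonempty] using h

lemma hits_le_one (e X : Finset V) : hits e X ≤ 1 := by
  unfold hits; split_ifs <;> simp

lemma hits_inter_add_hits_union_le (e X Y : Finset V) :
    hits e (X ∩ Y) + hits e (X ∪ Y) ≤ hits e X + hits e Y := by
  unfold hits; simp only [Finset.Nonempty, Finset.mem_inter, Finset.mem_union]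
  split_ifs <;> first | omega | (exfalso; grind)

lemma hits_sdiff_add_hits_sdiff_le (e X Y : Finset V) :
    hits e (X \ Y) + hits e (Y \ X) ≤ hits e X + hits e Y := by
  unfold hits; simp only [Finset.Nonempty, Finset.mem_inter, Finset.mem_sdiff]
  split_ifs <;> first | omega | (exfalso; grind)

lemma hits_inter_add_crosses_union_le (e X Y : Finset V) :
    hits e (X ∩ Y) + crosses e (X ∪ Y) ≤ crosses e X + hits e Y := by
  unfold hits crosses
  simp only [Finset.Nonempty, Finset.mem_inter, Finset.mem_sdiff, Finset.mem_union]
  split_ifs <;> first | omega | (exfalso; grind)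

lemma crosses_sdiff_add_hits_sdiff_le (e X Y : Finset V) :
    crosses e (X \ Y) + hits e (Y \ X) ≤ crosses e X + hits e Y := by
  unfold hits crosses
  simp only [Finset.Nonempty, Finset.mem_inter, Finset.mem_sdiff]
  split_ifs <;> first | omega | (exfalso; grind)

lemma crosses_inter_add_crosses_union_le (e X Y : Finset V) :
    crosses e (X ∩ Y) + crosses e (X ∪ Y) ≤ crosses e X + crosses e Y := by
  unfold crosses
  simp only [Finset.Nonempty, Finset.mem_inter, Finset.mem_sdiff, Finset.mem_union]
  split_ifs <;> first | omega | (exfalso; grind)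

lemma crosses_sdiff_add_crosses_sdiff_le (e X Y : Finset V) :
    crosses e (X \ Y) + crosses e (Y \ X) ≤ crosses e X + crosses e Y := by
  unfold crosses
  simp only [Finset.Nonempty, Finset.mem_inter, Finset.mem_sdiff]
  split_ifs <;> first | omega | (exfalso; grind)

lemma hits_union_add_mul (e f X : Finset V) :
    hits (e ∪ f) X + hits e X * hits f X = hits e X + hits f X := by
  have h : ((e ∪ f) ∩ X).Nonempty ↔ (e ∩ X).Nonempty ∨ (f ∩ X).Nonempty := by
    rw [Finset.union_inter_distrib_right, Finset.union_nonempty]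
  unfold hits
  split_ifs <;> first | rfl | (exfalso; tauto)

lemma hits_union_of_not_both {e f X : Finset V} (h : ¬ (hits e X = 1 ∧ hits f X = 1)) :
    hits (e ∪ f) X = hits e X + hits f X := by
  rw [← hits_union_add_mul, Nat.left_eq_add, mul_eq_zero]
  have := hits_le_one e X
  have := hits_le_one f X
  omega

lemma coverage_eq_finsuppSum (H : WHypergraph V) (X : Finset V) :
    H.coverage X = H.sum fun e w => w * hits e X := by
  simp [coverage, Finsupp.sum, hits, Finset.sum_filter, edges]

lemma cut_eq_finsuppSum (H : WHypergraph V) (X : Finset V) :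
    H.cut X = H.sum fun e w => w * crosses e X := by
  simp [cut, Finsupp.sum, crosses, Finset.sum_filter, edges]

lemma coverage_add (H G : WHypergraph V) (X : Finset V) :
    (H + G).coverage X = H.coverage X + G.coverage X := by
  simp only [coverage_eq_finsuppSum]
  exact Finsupp.sum_add_index' (by simp) (by intros; ring)

lemma coverage_single (e : Finset V) (w : ℕ) (X : Finset V) :
    coverage (Finsupp.single e w) X = w * hits e X := by
  rw [coverage_eq_finsuppSum, Finsupp.sum_single_index]; simp

lemma cut_add (H G : WHypergraph V) (X : Finset V) :
    (H + G).cut X = H.cut X + G.cut X := by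
  simp only [cut_eq_finsuppSum]
  exact Finsupp.sum_add_index' (by simp) (by intros; ring)

lemma cut_single (e : Finset V) (w : ℕ) (X : Finset V) :
    cut (Finsupp.single e w) X = w * crosses e X := by
  rw [cut_eq_finsuppSum, Finsupp.sum_single_index]; simp

lemma coverage_empty_set (H : WHypergraph V) : H.coverage ∅ = 0 := by
  simp [coverage]

lemma cut_compl [Fintype V] (H : WHypergraph V) (X : Finset V) : H.cut Xᶜ = H.cut X := by
  simp only [cut_eq_finsuppSum]
  refine Finsupp.sum_congr fun e _ => ?_
  have : crosses e Xᶜ = crosses e X := by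
    unfold crosses
    simp only [Finset.Nonempty, Finset.mem_inter, Finset.mem_sdiff, Finset.mem_compl]
    split_ifs <;> first | omega | (exfalso; grind)
  rw [this]

lemma coverage_inter_add_coverage_union_le (H : WHypergraph V) (X Y : Finset V) :
    H.coverage (X ∩ Y) + H.coverage (X ∪ Y) ≤ H.coverage X + H.coverage Y := by
  simp only [coverage_eq_finsuppSum, Finsupp.sum, ← Finset.sum_add_distrib, ← mul_add]
  exact Finset.sum_le_sum fun e _ => Nat.mul_le_mul_left _ (hits_inter_add_hits_union_le e X Y)

lemma coverage_sdiff_add_coverage_sdiff_le (H : WHypergraph V) (X Y : Finset V) :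
    H.coverage (X \ Y) + H.coverage (Y \ X) ≤ H.coverage X + H.coverage Y := by
  simp only [coverage_eq_finsuppSum, Finsupp.sum, ← Finset.sum_add_distrib, ← mul_add]
  exact Finset.sum_le_sum fun e _ => Nat.mul_le_mul_left _ (hits_sdiff_add_hits_sdiff_le e X Y)

lemma coverage_inter_add_cut_union_le (H : WHypergraph V) (X Y : Finset V) :
    H.coverage (X ∩ Y) + H.cut (X ∪ Y) ≤ H.cut X + H.coverage Y := by
  simp only [coverage_eq_finsuppSum, cut_eq_finsuppSum, Finsupp.sum, ← Finset.sum_add_distrib,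
    ← mul_add]
  exact Finset.sum_le_sum fun e _ => Nat.mul_le_mul_left _ (hits_inter_add_crosses_union_le e X Y)

lemma cut_sdiff_add_coverage_sdiff_le (H : WHypergraph V) (X Y : Finset V) :
    H.cut (X \ Y) + H.coverage (Y \ X) ≤ H.cut X + H.coverage Y := by
  simp only [coverage_eq_finsuppSum, cut_eq_finsuppSum, Finsupp.sum, ← Finset.sum_add_distrib,
    ← mul_add]
  exact Finset.sum_le_sum fun e _ => Nat.mul_le_mul_left _ (crosses_sdiff_add_hits_sdiff_le e X Y)

lemma cut_inter_add_cut_union_le (H : WHypergraph V) (X Y : Finset V) :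
    H.cut (X ∩ Y) + H.cut (X ∪ Y) ≤ H.cut X + H.cut Y := by
  simp only [cut_eq_finsuppSum, Finsupp.sum, ← Finset.sum_add_distrib, ← mul_add]
  exact Finset.sum_le_sum fun e _ =>
    Nat.mul_le_mul_left _ (crosses_inter_add_crosses_union_le e X Y)

lemma cut_sdiff_add_cut_sdiff_le (H : WHypergraph V) (X Y : Finset V) :
    H.cut (X \ Y) + H.cut (Y \ X) ≤ H.cut X + H.cut Y := by
  simp only [cut_eq_finsuppSum, Finsupp.sum, ← Finset.sum_add_distrib, ← mul_add]
  exact Finset.sum_le_sum fun e _ =>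
    Nat.mul_le_mul_left _ (crosses_sdiff_add_crosses_sdiff_le e X Y)

/-- A nonempty hyperedge inside `X ∩ Y` makes `cut_sdiff_add_coverage_sdiff_le` strict. -/
lemma cut_sdiff_add_coverage_sdiff_lt {H : WHypergraph V} {X Y e : Finset V} (he : e ∈ H.edges)
    (hne : e.Nonempty) (heX : e ⊆ X) (heY : e ⊆ Y) :
    H.cut (X \ Y) + H.coverage (Y \ X) < H.cut X + H.coverage Y := by
  simp only [coverage_eq_finsuppSum, cut_eq_finsuppSum, Finsupp.sum, ← Finset.sum_add_distrib,
    ← mul_add]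
  refine Finset.sum_lt_sum (fun e _ => Nat.mul_le_mul_left _
    (crosses_sdiff_add_hits_sdiff_le e X Y)) ⟨e, he, ?_⟩
  have h0 : 0 < H e := Nat.pos_of_ne_zero (by simpa [edges] using he)
  refine Nat.mul_lt_mul_of_pos_left ?_ h0
  obtain ⟨v, hv⟩ := hne
  unfold hits crosses
  simp only [Finset.Nonempty, Finset.mem_inter, Finset.mem_sdiff]
  split_ifs <;> first | omega | (exfalso; grind)

/-- If the coverage of `X` exceeds its cut value, then some nonempty hyperedge lies inside `X`. -/
lemma exists_edge_subset_of_cut_lt_coverage {H : WHypergraph V} {X : Finset V}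
    (h : H.cut X < H.coverage X) : ∃ e ∈ H.edges, e.Nonempty ∧ e ⊆ X := by
  by_contra! hc
  refine absurd h (not_lt.2 ?_)
  simp only [coverage_eq_finsuppSum, cut_eq_finsuppSum, Finsupp.sum]
  refine Finset.sum_le_sum fun e he => Nat.mul_le_mul_left _ ?_
  have := hc e he
  unfold hits crosses
  simp only [Finset.Nonempty, Finset.mem_inter, Finset.mem_sdiff]
  split_ifs <;> first | omega | (exfalso; grind)

/-! ### Tight sets -/

/-- `X` is tight if the coverage of `X` equals its requirement `p X`. -/
def Tight (H : WHypergraph V) (p : Finset V → ℤ) (X : Finset V) : Prop :=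
  p X = (H.coverage X : ℤ)

/-- The hyperedges `e` and `f` cannot be merged: if they are nonempty and disjoint, then a tight set
meets both. -/
def Stuck (H : WHypergraph V) (p : Finset V → ℤ) (e f : Finset V) : Prop :=
  e.Nonempty → f.Nonempty → Disjoint e f →
    ∃ Y, H.Tight p Y ∧ (e ∩ Y).Nonempty ∧ (f ∩ Y).Nonempty

lemma Stuck.symm {H : WHypergraph V} {p : Finset V → ℤ} {e f : Finset V} (h : H.Stuck p e f) :
    H.Stuck p f e := fun hf he hd =>
  let ⟨Y, hY, h1, h2⟩ := h he hf hd.symm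
  ⟨Y, hY, h2, h1⟩

/-- Hyperedges that cannot be merged stay so when they grow and when more sets become tight. -/
lemma Stuck.mono {p : Finset V → ℤ} {H G : WHypergraph V} {e f e' f' : Finset V}
    (h : H.Stuck p e f) (hT : ∀ Y, H.Tight p Y → G.Tight p Y) (he : e' = e ∨ e.Nonempty ∧ e ⊆ e')
    (hf : f' = f ∨ f.Nonempty ∧ f ⊆ f') : G.Stuck p e' f' := by
  intro hene hfne hdisj
  have he1 : e.Nonempty ∧ e ⊆ e' := he.elim (fun h => ⟨h ▸ hene, h ▸ subset_rfl⟩) id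
  have hf1 : f.Nonempty ∧ f ⊆ f' := hf.elim (fun h => ⟨h ▸ hfne, h ▸ subset_rfl⟩) id
  obtain ⟨Y, hY, h1, h2⟩ := h he1.1 hf1.1 (Finset.disjoint_of_subset_left he1.2
    (Finset.disjoint_of_subset_right hf1.2 hdisj))
  exact ⟨Y, hT Y hY, h1.mono (Finset.inter_subset_inter_right he1.2),
    h2.mono (Finset.inter_subset_inter_right hf1.2)⟩

/-- If no two hyperedges can be merged, then weak cover implies strong cover. With `k > 0` the
largest value of `p X - d X`, a minimal set `X` and a maximal set `Z ⊇ X` that attain `k` are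
uncrossed by means of a tight set that meets a hyperedge inside `X` and a hyperedge outside `Z`. -/
theorem stronglyCovers_of_stuck [Fintype V] {H : WHypergraph V} {p : Finset V → ℤ}
    (hsymm : SymmetricSetFunction p) (hskew : SkewSupermodular p) (hweak : H.WeaklyCovers p)
    (hstuck : ∀ e ∈ H.edges, ∀ f ∈ H.edges, e ≠ f → H.Stuck p e f) : H.StronglyCovers p := by
  by_contra hnot
  obtain ⟨X₀, hX₀⟩ : ∃ X, (H.cut X : ℤ) < p X := by
    simpa [StronglyCovers] using hnot
  obtain ⟨M, -, hM⟩ := Finset.exists_max_image Finset.univ (fun X => p X - (H.cut X : ℤ))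
    ⟨X₀, Finset.mem_univ _⟩
  replace hM : ∀ X, p X - (H.cut X : ℤ) ≤ p M - (H.cut M : ℤ) := fun X => hM X (Finset.mem_univ _)
  set k : ℤ := p M - (H.cut M : ℤ) with hk
  have hkpos : 0 < k := by have := hM X₀; omega
  let F : Finset (Finset V) := Finset.univ.filter fun X => p X - (H.cut X : ℤ) = k
  have memF : ∀ X, X ∈ F ↔ p X - (H.cut X : ℤ) = k := fun X => by simp [F]
  obtain ⟨X, hXM, hXmin⟩ := F.exists_le_minimal ((memF M).2 rfl)
  obtain ⟨Z, hXZ, hZmax⟩ := F.exists_le_maximal hXmin.1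
  have hXF := (memF X).1 hXmin.1
  have hZF := (memF Z).1 hZmax.1
  have noSmaller : ∀ X' ∈ F, X' ⊆ X → X ⊆ X' := fun X' h1 h2 => hXmin.2 h1 h2
  have noLarger : ∀ Z' ∈ F, Z ⊆ Z' → Z' ⊆ Z := fun Z' h1 h2 => hZmax.2 h1 h2
  obtain ⟨e, he, hene, heX⟩ : ∃ e ∈ H.edges, e.Nonempty ∧ e ⊆ X :=
    exists_edge_subset_of_cut_lt_coverage (by have := hweak X; omega)
  obtain ⟨f, hf, hfne, hfZ⟩ : ∃ f ∈ H.edges, f.Nonempty ∧ f ⊆ Zᶜ :=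
    exists_edge_subset_of_cut_lt_coverage (by
      have := hweak Zᶜ; rw [← hsymm Z] at this; rw [cut_compl]; omega)
  have hdisj : Disjoint e f := by
    rw [Finset.disjoint_left]; intro v hv hv'
    exact (Finset.mem_compl.1 (hfZ hv')) (hXZ (heX hv))
  have hef : e ≠ f := by
    rintro rfl; exact hene.ne_empty (by simpa using hdisj)
  obtain ⟨Y, hY, heY, hfY⟩ := hstuck e he f hf hef hene hfne hdisj
  unfold Tight at hY
  obtain ⟨u, hu⟩ := heY
  obtain ⟨x, hx⟩ := hfY
  rw [Finset.mem_inter] at hu hx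
  have huX := heX hu.1
  have hxZ := Finset.mem_compl.1 (hfZ hx.1)
  have hXY : X \ Y ∉ F := fun h => by
    have := noSmaller _ h Finset.sdiff_subset huX
    simp [hu.2] at this
  -- uncrossing the maximal set `Z` with the tight set `Y`
  have hZY : Z \ Y ∈ F ∧ H.cut (Z \ Y) + H.coverage (Y \ Z) = H.cut Z + H.coverage Y := by
    rcases hskew Z Y with h | h
    · exfalso
      have h1 := coverage_inter_add_cut_union_le H Z Y
      have h2 := hweak (Z ∩ Y)
      have h3 := hM (Z ∪ Y)
      have : Z ∪ Y ∈ F := (memF _).2 (by omega)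
      exact hxZ (noLarger _ this Finset.subset_union_left (Finset.mem_union_right _ hx.2))
    · have h1 := cut_sdiff_add_coverage_sdiff_le H Z Y
      have h2 := hweak (Y \ Z)
      have h3 := hM (Z \ Y)
      exact ⟨(memF _).2 (by omega), by omega⟩
  have hZYF := (memF _).1 hZY.1
  -- uncrossing the minimal set `X` with `Z \ Y`
  have hXsub : X ⊆ Y := by
    have e1 : X ∩ (Z \ Y) = X \ Y := by
      ext v; simp only [Finset.mem_inter, Finset.mem_sdiff]
      exact ⟨fun h => ⟨h.1, h.2.2⟩, fun h => ⟨h.1, hXZ h.1, h.2⟩⟩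
    have e2 : X \ (Z \ Y) = X ∩ Y := by
      ext v; simp only [Finset.mem_inter, Finset.mem_sdiff]
      exact ⟨fun h => ⟨h.1, by_contra fun h' => h.2 ⟨hXZ h.1, h'⟩⟩,
        fun h => ⟨h.1, fun h' => h'.2 h.2⟩⟩
    rcases hskew X (Z \ Y) with h | h
    · exfalso
      have h1 := cut_inter_add_cut_union_le H X (Z \ Y)
      have h2 := hM (X ∩ (Z \ Y))
      have h3 := hM (X ∪ (Z \ Y))
      rw [e1] at h h1 h2
      exact hXY ((memF _).2 (by omega))
    · have h1 := cut_sdiff_add_cut_sdiff_le H X (Z \ Y)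
      have h2 := hM (X \ (Z \ Y))
      have h3 := hM ((Z \ Y) \ X)
      rw [e2] at h h1 h2
      exact fun v hv => (Finset.mem_inter.1
        (noSmaller _ ((memF _).2 (by omega)) Finset.inter_subset_left hv)).2
  exact (cut_sdiff_add_coverage_sdiff_lt he hene (heX.trans hXZ) (heX.trans hXsub)).ne hZY.2

/-- Tight sets can be uncrossed, and then every hyperedge meets the new sets as often as the old
ones. -/
lemma tight_inter_union_or_sdiff {H : WHypergraph V} {p : Finset V → ℤ}
    (hskew : SkewSupermodular p) (hweak : H.WeaklyCovers p) {X Y : Finset V}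
    (hX : H.Tight p X) (hY : H.Tight p Y) :
    (H.Tight p (X ∩ Y) ∧ H.Tight p (X ∪ Y) ∧
      ∀ e ∈ H.edges, hits e (X ∩ Y) + hits e (X ∪ Y) = hits e X + hits e Y) ∨
    (H.Tight p (X \ Y) ∧ H.Tight p (Y \ X) ∧
      ∀ e ∈ H.edges, hits e (X \ Y) + hits e (Y \ X) = hits e X + hits e Y) := by
  unfold Tight at *
  have key : ∀ A B : Finset V, H.coverage A + H.coverage B = H.coverage X + H.coverage Y →
      (∀ e, hits e A + hits e B ≤ hits e X + hits e Y) →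
      ∀ e ∈ H.edges, hits e A + hits e B = hits e X + hits e Y := by
    intro A B hAB hle e he
    simp only [coverage_eq_finsuppSum, Finsupp.sum, ← Finset.sum_add_distrib, ← mul_add] at hAB
    have := (Finset.sum_eq_sum_iff_of_le
      (fun e _ => Nat.mul_le_mul_left (H e) (hle e))).1 hAB e he
    exact Nat.eq_of_mul_eq_mul_left (Nat.pos_of_ne_zero (by simpa [edges] using he)) this
  rcases hskew X Y with h | h
  · left
    have h1 := hweak (X ∩ Y)
    have h2 := hweak (X ∪ Y)
    have h3 := coverage_inter_add_coverage_union_le H X Y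
    exact ⟨by omega, by omega, key _ _ (by omega) fun e => hits_inter_add_hits_union_le e X Y⟩
  · right
    have h1 := hweak (X \ Y)
    have h2 := hweak (Y \ X)
    have h3 := coverage_sdiff_add_coverage_sdiff_le H X Y
    exact ⟨by omega, by omega, key _ _ (by omega) fun e => hits_sdiff_add_hits_sdiff_le e X Y⟩

/-! ### Laminar families -/

/-- `X` and `Y` cross if they meet and neither contains the other. -/
def Cross (X Y : Finset V) : Prop :=
  (X ∩ Y).Nonempty ∧ (X \ Y).Nonempty ∧ (Y \ X).Nonempty

/-- A laminar family of nonempty subsets of `U` has at most `2|U|` members. Deleting a vertex `v`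
from all members destroys at most `{v}` and identifies at most one pair of members. -/
theorem card_le_of_laminar (U : Finset V) : ∀ L : Finset (Finset V),
    (∀ X ∈ L, X.Nonempty ∧ X ⊆ U) → (∀ X ∈ L, ∀ Y ∈ L, ¬ Cross X Y) → L.card ≤ 2 * U.card := by
  induction U using Finset.induction_on with
  | empty =>
    intro L h _
    have : L = ∅ := Finset.eq_empty_of_forall_notMem fun X hX =>
      (h X hX).1.ne_empty (Finset.subset_empty.1 (h X hX).2)
    simp [this]
  | insert v U hv ih =>
    intro L h hlam
    let L' := (L.image fun X => X.erase v).erase ∅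
    let D := L.filter fun X => v ∈ X ∧ X.erase v ∈ L
    have hL' : L'.card ≤ 2 * U.card := by
      refine ih L' (fun X hX => ?_) fun X hX Y hY => ?_
      · obtain ⟨h0, hX⟩ := Finset.mem_erase.1 hX
        obtain ⟨A, hA, rfl⟩ := Finset.mem_image.1 hX
        refine ⟨Finset.nonempty_iff_ne_empty.2 h0, fun w hw => ?_⟩
        have := (h A hA).2 (Finset.mem_of_mem_erase hw)
        exact (Finset.mem_insert.1 this).resolve_left (Finset.ne_of_mem_erase hw)
      · obtain ⟨-, hX⟩ := Finset.mem_erase.1 hX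
        obtain ⟨A, hA, rfl⟩ := Finset.mem_image.1 hX
        obtain ⟨-, hY⟩ := Finset.mem_erase.1 hY
        obtain ⟨B, hB, rfl⟩ := Finset.mem_image.1 hY
        intro hc
        apply hlam A hA B hB
        simp only [Cross, Finset.Nonempty, Finset.mem_inter, Finset.mem_sdiff,
          Finset.mem_erase] at hc ⊢
        grind
    have hD : D.card ≤ 1 := by
      refine Finset.card_le_one.2 fun A hA B hB => ?_
      simp only [D, Finset.mem_filter] at hA hB
      by_contra hne
      have h1 := hlam A hA.1 B hB.1
      have h2 := hlam A hA.1 _ hB.2.2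
      have h3 := hlam B hB.1 _ hA.2.2
      obtain ⟨a, ha⟩ := (h _ hA.2.2).1
      obtain ⟨b, hb⟩ := (h _ hB.2.2).1
      simp only [Cross, Finset.Nonempty, Finset.mem_inter, Finset.mem_sdiff,
          Finset.mem_erase] at h1 h2 h3 ha hb
      apply hne
      ext w
      grind
    have hinj : (L \ (D ∪ {{v}})).card ≤ L'.card := by
      refine Finset.card_le_card_of_injOn (fun X => X.erase v) (fun X hX => ?_)
        fun X hX Y hY hXY => ?_
      · simp only [Finset.coe_sdiff, Set.mem_sdiff, Finset.mem_coe, Finset.mem_union,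
          Finset.mem_singleton, not_or] at hX
        simp only [L', Finset.coe_erase, Set.mem_sdiff, Finset.mem_coe, Finset.mem_image,
          Set.mem_singleton_iff]
        refine ⟨⟨X, hX.1, rfl⟩, fun h0 => ?_⟩
        rcases (Finset.erase_eq_empty_iff X v).1 h0 with h0 | h0
        · exact (h X hX.1).1.ne_empty h0
        · exact hX.2.2 h0
      · simp only [Finset.coe_sdiff, Set.mem_sdiff, Finset.mem_coe, Finset.mem_union,
          Finset.mem_singleton, not_or, D, Finset.mem_filter, not_and] at hX hY
        simp only at hXY
        by_cases hvX : v ∈ X <;> by_cases hvY : v ∈ Y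
        · rw [← Finset.insert_erase hvX, ← Finset.insert_erase hvY, hXY]
        · rw [Finset.erase_eq_of_notMem hvY] at hXY
          exact absurd (hXY ▸ hY.1) (hX.2.1 hX.1 hvX)
        · rw [Finset.erase_eq_of_notMem hvX] at hXY
          exact absurd (hXY ▸ hX.1) (hY.2.1 hY.1 hvY)
        · rwa [Finset.erase_eq_of_notMem hvX, Finset.erase_eq_of_notMem hvY] at hXY
    have h1 := Finset.card_le_card_sdiff_add_card (s := L) (t := D ∪ {{v}})
    have h2 := Finset.card_union_le D {{v}}
    rw [Finset.card_singleton] at h2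
    rw [Finset.card_insert_of_notMem hv]
    omega

/-! ### The rank of the tight sets -/

/-- The incidence vector of the hyperedges in `S` that meet `X`. -/
def hitVec (S : Finset (Finset V)) (X : Finset V) : Finset V → ℚ :=
  fun e => if e ∈ S then (hits e X : ℚ) else 0

/-- The rank of the incidence vectors of the sets in `T` over the hyperedges in `S`. -/
noncomputable def hitRank (S : Finset (Finset V)) (T : Set (Finset V)) : ℕ :=
  Module.finrank ℚ (Submodule.span ℚ (hitVec S '' T))

/-- The rank of the incidence vectors of the tight sets of `H` over the hyperedges of `H`. -/
noncomputable def tightRank (H : WHypergraph V) (p : Finset V → ℤ) : ℕ :=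
  hitRank H.edges {X | H.Tight p X}

/-- Uncrossing puts the incidence vectors of all tight sets into the span of a laminar family. -/
theorem tightRank_le [Fintype V] {H : WHypergraph V} {p : Finset V → ℤ}
    (hskew : SkewSupermodular p) (hweak : H.WeaklyCovers p) :
    H.tightRank p ≤ 2 * Fintype.card V := by
  classical
  let good : Finset (Finset V) → Prop := fun L =>
    (∀ X ∈ L, X.Nonempty ∧ H.Tight p X) ∧ ∀ X ∈ L, ∀ Y ∈ L, ¬ Cross X Y
  obtain ⟨L, hL, hmax⟩ := Finset.exists_max_image (Finset.univ.filter good) Finset.card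
    ⟨∅, by simp [good]⟩
  replace hL : good L := (Finset.mem_filter.1 hL).2
  let W := Submodule.span ℚ (hitVec H.edges '' (L : Set (Finset V)))
  have memW : ∀ X ∈ L, hitVec H.edges X ∈ W := fun X hX =>
    Submodule.subset_span ⟨X, hX, rfl⟩
  let cr : Finset V → ℕ := fun X => (L.filter fun Z => Cross Z X).card
  have main : ∀ m : ℕ, ∀ X, H.Tight p X → cr X = m → hitVec H.edges X ∈ W := by
    intro m
    induction m using Nat.strong_induction_on with
    | _ m ih =>
    intro X hX hm
    by_contra hXW
    have hXL : X ∉ L := fun h => hXW (memW X h)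
    have hXne : X.Nonempty := by
      rw [Finset.nonempty_iff_ne_empty]
      rintro rfl
      apply hXW
      have : hitVec H.edges (∅ : Finset V) = 0 := by
        ext e; simp [hitVec, hits]
      rw [this]; exact W.zero_mem
    by_cases h0 : ∃ Y ∈ L, Cross Y X
    · obtain ⟨Y, hYL, hYX⟩ := h0
      have less : ∀ A : Finset V, ¬ Cross Y A → (∀ Z ∈ L, Cross Z A → Cross Z X) → cr A < m := by
        intro A hYA hA
        rw [← hm]
        refine Finset.card_lt_card (Finset.ssubset_iff_of_subset ?_ |>.2
          ⟨Y, by simp [hYL, hYX], by simp [hYA]⟩)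
        intro Z hZ
        rw [Finset.mem_filter] at hZ ⊢
        exact ⟨hZ.1, hA Z hZ.1 hZ.2⟩
      have comb : ∀ A B : Finset V, H.Tight p A → H.Tight p B → cr A < m → cr B < m →
          (∀ e ∈ H.edges, hits e A + hits e B = hits e X + hits e Y) → False := by
        intro A B hA hB hA' hB' hAB
        have e : hitVec H.edges X = hitVec H.edges A + hitVec H.edges B - hitVec H.edges Y := by
          ext e
          simp only [hitVec, Pi.add_apply, Pi.sub_apply]
          split_ifs with he
          · have : ((hits e A + hits e B : ℕ) : ℚ) = (hits e X + hits e Y : ℕ) := by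
              rw [hAB e he]
            push_cast at this
            linarith
          · simp
        rw [e] at hXW
        exact hXW (W.sub_mem (W.add_mem (ih _ hA' A hA rfl) (ih _ hB' B hB rfl)) (memW Y hYL))
      have hlam := fun Z (hZ : Z ∈ L) => hL.2 Z hZ Y hYL
      rcases tight_inter_union_or_sdiff hskew hweak hX (hL.1 Y hYL).2 with
        ⟨h1, h2, h3⟩ | ⟨h1, h2, h3⟩
      · refine comb _ _ h1 h2 (less _ ?_ fun Z hZ hc => ?_) (less _ ?_ fun Z hZ hc => ?_) h3
        · rintro ⟨-, -, h⟩; simp only [Finset.Nonempty, Finset.mem_inter, Finset.mem_sdiff] at h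
          grind
        · have := hlam Z hZ
          simp only [Cross, Finset.Nonempty, Finset.mem_inter, Finset.mem_sdiff] at hc this ⊢
          grind
        · rintro ⟨-, h, -⟩
          simp only [Finset.Nonempty, Finset.mem_union, Finset.mem_sdiff] at h
          grind
        · have := hlam Z hZ
          simp only [Cross, Finset.Nonempty, Finset.mem_inter, Finset.mem_sdiff,
            Finset.mem_union] at hc this hYX ⊢
          grind
      · refine comb _ _ h1 h2 (less _ ?_ fun Z hZ hc => ?_) (less _ ?_ fun Z hZ hc => ?_) h3
        · rintro ⟨h, -, -⟩
          simp only [Finset.Nonempty, Finset.mem_inter, Finset.mem_sdiff] at h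
          grind
        · have := hlam Z hZ
          simp only [Cross, Finset.Nonempty, Finset.mem_inter, Finset.mem_sdiff] at hc this hYX ⊢
          grind
        · rintro ⟨-, -, h⟩
          simp only [Finset.Nonempty, Finset.mem_sdiff] at h
          grind
        · have := hlam Z hZ
          simp only [Cross, Finset.Nonempty, Finset.mem_inter, Finset.mem_sdiff] at hc this hYX ⊢
          grind
    · push Not at h0
      have symm : ∀ A B : Finset V, Cross A B → Cross B A := fun A B h =>
        ⟨by rw [Finset.inter_comm]; exact h.1, h.2.2, h.2.1⟩
      have hgood : good (insert X L) := by
        refine ⟨fun A hA => ?_, fun A hA B hB => ?_⟩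
        · rcases Finset.mem_insert.1 hA with rfl | hA
          · exact ⟨hXne, hX⟩
          · exact hL.1 A hA
        · rcases Finset.mem_insert.1 hA with rfl | hA' <;>
          rcases Finset.mem_insert.1 hB with rfl | hB'
          · rintro ⟨-, h, -⟩; simp at h
          · exact fun h => h0 B hB' (symm _ _ h)
          · exact h0 A hA'
          · exact hL.2 A hA' B hB'
      have := hmax _ (Finset.mem_filter.2 ⟨Finset.mem_univ _, hgood⟩)
      rw [Finset.card_insert_of_notMem hXL] at this
      omega
  have hspan : Submodule.span ℚ (hitVec H.edges '' {X | H.Tight p X}) ≤ W := by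
    rw [Submodule.span_le]
    rintro _ ⟨X, hX, rfl⟩
    exact main _ X hX rfl
  calc H.tightRank p ≤ Module.finrank ℚ W := Submodule.finrank_mono hspan
    _ ≤ (L.image (hitVec H.edges)).card := by
        have := finrank_span_finset_le_card (R := ℚ) (L.image (hitVec H.edges))
        rwa [Finset.coe_image] at this
    _ ≤ L.card := Finset.card_image_le
    _ ≤ 2 * Fintype.card V := by
        rw [← Finset.card_univ]
        exact card_le_of_laminar _ L (fun X hX => ⟨(hL.1 X hX).1, Finset.subset_univ X⟩) hL.2

lemma hits_union_cast {T : Set (Finset V)} {e f : Finset V}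
    (h : ∀ X ∈ T, ¬ (hits e X = 1 ∧ hits f X = 1)) {X : Finset V} (hX : X ∈ T) :
    (hits (e ∪ f) X : ℚ) = hits e X + hits f X := by
  rw [hits_union_of_not_both (h X hX), Nat.cast_add]

section RankChange

variable [Fintype V] {S S' : Finset (Finset V)} {T T' : Set (Finset V)} {e f : Finset V}

lemma hitRank_le_of_linearMap (φ : (Finset V → ℚ) →ₗ[ℚ] (Finset V → ℚ)) (hT : T ⊆ T')
    (h : ∀ X ∈ T, φ (hitVec S' X) = hitVec S X) : hitRank S T ≤ hitRank S' T' := by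
  have : Submodule.span ℚ (hitVec S '' T) ≤ (Submodule.span ℚ (hitVec S' '' T')).map φ := by
    rw [Submodule.span_le]
    rintro _ ⟨X, hX, rfl⟩
    exact ⟨_, Submodule.subset_span ⟨X, hT hX, rfl⟩, h X hX⟩
  exact (Submodule.finrank_mono this).trans (Submodule.finrank_map_le _ _)

/-- If only `e` disappears, its column is the difference of the columns of `e ∪ f` and `f`. -/
lemma hitRank_le_of_merge_left (hT : T ⊆ T') (hS : S.erase e ⊆ S') (hf : f ∈ S')
    (hef : e ∪ f ∈ S') (h : ∀ X ∈ T, ¬ (hits e X = 1 ∧ hits f X = 1)) :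
    hitRank S T ≤ hitRank S' T' := by
  refine hitRank_le_of_linearMap
    { toFun := fun g x => if x ∈ S then (if x = e then g (e ∪ f) - g f else g x) else 0
      map_add' := fun g g' => by ext x; simp only [Pi.add_apply]; split_ifs <;> ring
      map_smul' := fun c g => by
        ext x; simp only [Pi.smul_apply, smul_eq_mul, RingHom.id_apply]; split_ifs <;> ring }
    hT fun X hX => ?_
  ext x
  simp only [LinearMap.coe_mk, AddHom.coe_mk, hitVec]
  by_cases hx : x ∈ S
  · by_cases hxe : x = e
    · subst hxe
      simp [hx, hf, hef, hits_union_cast h hX]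
    · simp [hx, hxe, hS (Finset.mem_erase.2 ⟨hxe, hx⟩)]
  · simp [hx]

/-- If `e` and `f` disappear, the rank drops by at most one. -/
lemma hitRank_le_of_merge_both (hT : T ⊆ T') (hS : (S.erase e).erase f ⊆ S')
    (hne : e ≠ f) (hef : e ∪ f ∈ S') (h : ∀ X ∈ T, ¬ (hits e X = 1 ∧ hits f X = 1)) :
    hitRank S T ≤ hitRank S' T' + 1 := by
  let φ : (Finset V → ℚ) →ₗ[ℚ] (Finset V → ℚ) :=
    { toFun := fun g x => if x ∈ S then
        (if x = e then 0 else if x = f then g (e ∪ f) else g x) else 0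
      map_add' := fun g g' => by ext x; simp only [Pi.add_apply]; split_ifs <;> ring
      map_smul' := fun c g => by
        ext x; simp only [Pi.smul_apply, smul_eq_mul, RingHom.id_apply]; split_ifs <;> ring }
  let d : Finset V → ℚ := fun x =>
    if x ∈ S then (if x = e then 1 else if x = f then -1 else 0) else 0
  have hle : Submodule.span ℚ (hitVec S '' T) ≤
      (Submodule.span ℚ (hitVec S' '' T')).map φ ⊔ Submodule.span ℚ {d} := by
    rw [Submodule.span_le]
    rintro _ ⟨X, hX, rfl⟩
    have : hitVec S X = φ (hitVec S' X) + (hits e X : ℚ) • d := by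
      ext x
      simp only [φ, d, LinearMap.coe_mk, AddHom.coe_mk, hitVec, Pi.add_apply, Pi.smul_apply,
        smul_eq_mul]
      by_cases hx : x ∈ S
      · by_cases hxe : x = e
        · subst hxe; simp [hx]
        · by_cases hxf : x = f
          · subst hxf; simp [hx, hxe, hef, hits_union_cast h hX]
          · simp [hx, hxe, hxf, hS (Finset.mem_erase.2 ⟨hxf, Finset.mem_erase.2 ⟨hxe, hx⟩⟩)]
      · simp [hx]
    rw [this]
    exact Submodule.add_mem_sup ⟨_, Submodule.subset_span ⟨X, hT hX, rfl⟩, rfl⟩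
      (Submodule.smul_mem _ _ (Submodule.mem_span_singleton_self d))
  have h1 := (Submodule.finrank_mono hle).trans (Submodule.finrank_add_le_finrank_add_finrank _ _)
  have h2 := Submodule.finrank_map_le φ (Submodule.span ℚ (hitVec S' '' T'))
  have h3 := finrank_span_le_card (R := ℚ) ({d} : Set (Finset V → ℚ))
  simp only [Set.toFinset_singleton, Finset.card_singleton] at h3
  unfold hitRank
  omega

/-- If `e` and `f` survive, then a new tight set that meets both is independent of the old ones,
for which the columns of `e` and `f` add up to that of `e ∪ f`. -/
lemma hitRank_lt_of_new {Z : Finset V} (hT : T ⊆ T') (hS : S ⊆ S') (he : e ∈ S') (hf : f ∈ S')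
    (hef : e ∪ f ∈ S') (h : ∀ X ∈ T, ¬ (hits e X = 1 ∧ hits f X = 1)) (hZ : Z ∈ T')
    (hZe : hits e Z = 1) (hZf : hits f Z = 1) : hitRank S T + 1 ≤ hitRank S' T' := by
  have h1 : hitRank S T ≤ hitRank S' T := by
    refine hitRank_le_of_linearMap
      { toFun := fun g x => if x ∈ S then g x else 0
        map_add' := fun g g' => by ext x; simp only [Pi.add_apply]; split_ifs <;> ring
        map_smul' := fun c g => by
          ext x; simp only [Pi.smul_apply, smul_eq_mul, RingHom.id_apply]; split_ifs <;> ring }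
      subset_rfl fun X hX => ?_
    ext x
    simp only [LinearMap.coe_mk, AddHom.coe_mk, hitVec]
    by_cases hx : x ∈ S
    · simp [hx, hS hx]
    · simp [hx]
  let ℓ : (Finset V → ℚ) →ₗ[ℚ] ℚ :=
    { toFun := fun g => g (e ∪ f) - g e - g f
      map_add' := fun g g' => by simp only [Pi.add_apply]; ring
      map_smul' := fun c g => by
        simp only [Pi.smul_apply, smul_eq_mul, RingHom.id_apply]; ring }
  have hker : Submodule.span ℚ (hitVec S' '' T) ≤ LinearMap.ker ℓ := by
    rw [Submodule.span_le]
    rintro _ ⟨X, hX, rfl⟩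
    simp [ℓ, hitVec, he, hf, hef, hits_union_cast h hX]
  have hlt : Submodule.span ℚ (hitVec S' '' T) < Submodule.span ℚ (hitVec S' '' T') := by
    refine lt_of_le_of_ne (Submodule.span_mono (Set.image_mono hT)) fun heq => ?_
    have hmem : hitVec S' Z ∈ Submodule.span ℚ (hitVec S' '' T) :=
      heq ▸ Submodule.subset_span ⟨Z, hZ, rfl⟩
    have h0 := hker hmem
    have h2 := hits_union_add_mul e f Z
    rw [hZe, hZf] at h2
    have h3 : hits (e ∪ f) Z = 1 := by omega
    simp [ℓ, hitVec, he, hf, hef, hZe, hZf, h3] at h0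
  have := Submodule.finrank_lt_finrank_of_lt hlt
  unfold hitRank at *
  omega

end RankChange

end

section

variable {V : Type*}

/-! ### Slots -/

/-- The hypergraph given by a multiset of slots, each of which holds a hyperedge and a weight. The
same hyperedge may occur in several slots; its weights add up. -/
noncomputable def ofSlots (s : Multiset (Finset V × ℕ)) : WHypergraph V :=
  (s.map fun x => Finsupp.single x.1 x.2).sum

lemma ofSlots_cons (x : Finset V × ℕ) (s : Multiset (Finset V × ℕ)) :
    ofSlots (x ::ₘ s) = Finsupp.single x.1 x.2 + ofSlots s := by
  simp [ofSlots]

lemma ofSlots_multi_cons (x : Finset V × ℕ) (s : Multiset (Finset V × ℕ)) :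
    (ofSlots (x ::ₘ s)).multi = x.2 • {x.1} + (ofSlots s).multi := by
  simp [ofSlots_cons, multi, Finsupp.toMultiset_single]

/-- The slots with positive weight. -/
def liveSlots (s : Multiset (Finset V × ℕ)) : Multiset (Finset V × ℕ) := s.filter fun x => 0 < x.2

lemma liveSlots_cons_of_pos {x : Finset V × ℕ} (h : 0 < x.2) (s : Multiset (Finset V × ℕ)) :
    liveSlots (x ::ₘ s) = x ::ₘ liveSlots s :=
  Multiset.filter_cons_of_pos (p := fun x : Finset V × ℕ => 0 < x.2) _ h

lemma liveSlots_cons_of_eq_zero {x : Finset V × ℕ} (h : x.2 = 0)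
    (s : Multiset (Finset V × ℕ)) : liveSlots (x ::ₘ s) = liveSlots s :=
  Multiset.filter_cons_of_neg (p := fun x : Finset V × ℕ => 0 < x.2) _ (by omega)

lemma ofSlots_liveSlots (s : Multiset (Finset V × ℕ)) : ofSlots (liveSlots s) = ofSlots s := by
  induction s using Multiset.induction_on with
  | empty => rfl
  | cons x s ih =>
    rcases Nat.eq_zero_or_pos x.2 with h | h
    · rw [liveSlots_cons_of_eq_zero h, ofSlots_cons, ih, h]
      simp
    · rw [liveSlots_cons_of_pos h, ofSlots_cons, ofSlots_cons, ih]

/-- The slots that hold the hyperedges of `H`, each once. -/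
def slots (H : WHypergraph V) : Multiset (Finset V × ℕ) := H.edges.val.map fun e => (e, H e)

lemma ofSlots_slots (H : WHypergraph V) : ofSlots H.slots = H := by
  rw [ofSlots, slots, Multiset.map_map]
  exact Finsupp.sum_single H

variable [DecidableEq V]

lemma coverage_ofSlots_cons (x : Finset V × ℕ) (s : Multiset (Finset V × ℕ)) (X : Finset V) :
    (ofSlots (x ::ₘ s)).coverage X = x.2 * hits x.1 X + (ofSlots s).coverage X := by
  rw [ofSlots_cons, coverage_add, coverage_single]

lemma cut_ofSlots_cons (x : Finset V × ℕ) (s : Multiset (Finset V × ℕ)) (X : Finset V) :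
    (ofSlots (x ::ₘ s)).cut X = x.2 * crosses x.1 X + (ofSlots s).cut X := by
  rw [ofSlots_cons, cut_add, cut_single]

lemma mem_edges_ofSlots {s : Multiset (Finset V × ℕ)} {e : Finset V} :
    e ∈ (ofSlots s).edges ↔ ∃ x ∈ s, x.1 = e ∧ 0 < x.2 := by
  induction s using Multiset.induction_on with
  | empty => simp [ofSlots, edges]
  | cons x s ih =>
    simp only [edges, Finsupp.mem_support_iff, ← Nat.pos_iff_ne_zero] at ih ⊢
    rw [ofSlots_cons, Finsupp.add_apply, add_pos_iff, ih, Finsupp.single_apply]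
    constructor
    · rintro (h | ⟨y, hy, h⟩)
      · split_ifs at h with hx
        exacts [⟨x, Multiset.mem_cons_self x s, hx, h⟩, absurd h (lt_irrefl 0)]
      · exact ⟨y, Multiset.mem_cons_of_mem hy, h⟩
    · rintro ⟨y, hy, h⟩
      rcases Multiset.mem_cons.1 hy with rfl | hy
      · left; rw [if_pos h.1]; exact h.2
      · exact Or.inr ⟨y, hy, h⟩

lemma card_edges_ofSlots_le (s : Multiset (Finset V × ℕ)) :
    (ofSlots s).edges.card ≤ Multiset.card s := by
  calc (ofSlots s).edges.card ≤ (s.map Prod.fst).toFinset.card := by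
        refine Finset.card_le_card fun e he => ?_
        obtain ⟨x, hx, rfl, -⟩ := mem_edges_ofSlots.1 he
        exact Multiset.mem_toFinset.2 (Multiset.mem_map_of_mem _ hx)
    _ ≤ _ := (Multiset.toFinset_card_le _).trans (Multiset.card_map _ _).le

/-! ### Merging copies of two hyperedges -/

/-- The slots after `α` copies of `e` and `f` have been merged; `e` and `f` are held by two slots of
weights `a` and `b`, and `r` are the other slots. Slots of weight `0` are kept. -/
def mergeSlots (e f : Finset V) (a b α : ℕ) (r : Multiset (Finset V × ℕ)) :
    Multiset (Finset V × ℕ) :=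
  (e, a - α) ::ₘ (f, b - α) ::ₘ (e ∪ f, α) ::ₘ r

variable {e f : Finset V} {a b α : ℕ} {r : Multiset (Finset V × ℕ)}

lemma coverage_mergeSlots (ha : α ≤ a) (hb : α ≤ b) (X : Finset V) :
    (ofSlots (mergeSlots e f a b α r)).coverage X + α * (hits e X * hits f X) =
      (ofSlots ((e, a) ::ₘ (f, b) ::ₘ r)).coverage X := by
  obtain ⟨a, rfl⟩ := Nat.exists_eq_add_of_le ha
  obtain ⟨b, rfl⟩ := Nat.exists_eq_add_of_le hb
  have := hits_union_add_mul e f X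
  simp only [mergeSlots, coverage_ofSlots_cons, Nat.add_sub_cancel_left]
  linear_combination α * this

lemma reflTransGen_mergeStep (h : Disjoint e f) (α : ℕ) (s : Multiset (Finset V)) :
    Relation.ReflTransGen MergeStep (α • {e} + (α • {f} + s)) (α • {e ∪ f} + s) := by
  induction α generalizing s with
  | zero => simpa using Relation.ReflTransGen.refl
  | succ α ih =>
    have h1 : (α + 1) • ({e} : Multiset (Finset V)) + ((α + 1) • {f} + s) =
        e ::ₘ f ::ₘ (α • {e} + (α • {f} + s)) := by
      simp only [succ_nsmul, ← Multiset.singleton_add]; abel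
    have h2 : (α + 1) • ({e ∪ f} : Multiset (Finset V)) + s =
        α • {e ∪ f} + ((e ∪ f) ::ₘ s) := by
      simp only [succ_nsmul, ← Multiset.singleton_add]; abel
    have h3 : (e ∪ f) ::ₘ (α • {e} + (α • {f} + s)) =
        α • {e} + (α • {f} + ((e ∪ f) ::ₘ s)) := by
      simp only [← Multiset.singleton_add]; abel
    rw [h1, h2]
    refine (Relation.ReflTransGen.single (MergeStep.merge e f _ h)).trans ?_
    rw [h3]
    exact ih _

lemma obtainedByMerging_mergeSlots (h : Disjoint e f) (ha : α ≤ a) (hb : α ≤ b) :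
    (ofSlots ((e, a) ::ₘ (f, b) ::ₘ r)).ObtainedByMerging (ofSlots (mergeSlots e f a b α r)) := by
  obtain ⟨a, rfl⟩ := Nat.exists_eq_add_of_le ha
  obtain ⟨b, rfl⟩ := Nat.exists_eq_add_of_le hb
  unfold ObtainedByMerging
  have := reflTransGen_mergeStep h α (a • {e} + (b • {f} + (ofSlots r).multi))
  simp only [mergeSlots, ofSlots_multi_cons, Nat.add_sub_cancel_left, add_nsmul]
  convert this using 1 <;> abel

/-- The invariant of a sequence of maximal merging steps that starts from `H₀`. -/
structure Good (H₀ : WHypergraph V) (p : Finset V → ℤ) (s : Multiset (Finset V × ℕ)) : Prop where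
  pos : ∀ x ∈ s, 0 < x.2
  weak : (ofSlots s).WeaklyCovers p
  merged : H₀.ObtainedByMerging (ofSlots s)
  card_le : Multiset.card s ≤ H₀.edges.card + (ofSlots s).tightRank p

/-- A potential that bounds the number of maximal merging steps. -/
noncomputable def potential [Fintype V] (p : Finset V → ℤ) (s : Multiset (Finset V × ℕ)) : ℕ :=
  (s.map fun x => Fintype.card V + 1 - x.1.card).sum +
    Fintype.card V * (2 * Fintype.card V - (ofSlots s).tightRank p)

lemma Tight.mono {H G : WHypergraph V} {p : Finset V → ℤ} {X : Finset V} (h : H.Tight p X)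
    (hG : G.WeaklyCovers p) (hle : G.coverage X ≤ H.coverage X) : G.Tight p X := by
  have := hG X
  unfold Tight at *
  omega

lemma hits_eq_one_iff_nonempty {e X : Finset V} : hits e X = 1 ↔ (e ∩ X).Nonempty := by
  unfold hits; split_ifs <;> simp_all

lemma good_slots {H : WHypergraph V} {p : Finset V → ℤ}
    (hweak : H.WeaklyCovers p) : Good H p H.slots where
  pos x hx := by
    obtain ⟨e, he, rfl⟩ := Multiset.mem_map.1 hx
    exact Nat.pos_of_ne_zero (by simpa [edges] using he)
  weak := by rwa [ofSlots_slots]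
  merged := by rw [ofSlots_slots]; exact Relation.ReflTransGen.refl
  card_le := by simp [slots]

variable [Fintype V] {H₀ : WHypergraph V} {p : Finset V → ℤ}

/-- A merging step is maximal if `e` or `f` is used up or a new tight set meets both. Such a step
does not increase the number of slots minus the rank of the tight sets: if both `e` and `f` survive,
then there is one slot more, and the new tight set increases the rank; the rank drops only if both
are used up, and then it drops by one and so does the number of slots. -/
theorem Good.merge (hskew : SkewSupermodular p) (hg : Good H₀ p ((e, a) ::ₘ (f, b) ::ₘ r))
    (hdisj : Disjoint e f) (he : e.Nonempty) (hf : f.Nonempty) (hα : 0 < α) (ha : α ≤ a)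
    (hb : α ≤ b) (hweak : (ofSlots (mergeSlots e f a b α r)).WeaklyCovers p)
    (hmax : α = a ∨ α = b ∨
      ∃ Z, (ofSlots (mergeSlots e f a b α r)).Tight p Z ∧ hits e Z = 1 ∧ hits f Z = 1) :
    Good H₀ p (liveSlots (mergeSlots e f a b α r)) ∧
      potential p (liveSlots (mergeSlots e f a b α r)) < potential p ((e, a) ::ₘ (f, b) ::ₘ r) := by
  set s := (e, a) ::ₘ (f, b) ::ₘ r with hs
  set s' := mergeSlots e f a b α r with hs'
  have hr : ∀ x ∈ r, 0 < x.2 := fun x hx =>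
    hg.pos x (Multiset.mem_cons_of_mem (Multiset.mem_cons_of_mem hx))
  have hcov : ∀ X, (ofSlots s').coverage X + α * (hits e X * hits f X) = (ofSlots s).coverage X :=
    coverage_mergeSlots ha hb
  have hT : {X | (ofSlots s).Tight p X} ⊆ {X | (ofSlots s').Tight p X} := fun X hX =>
    hX.mono hweak (by have := hcov X; omega)
  have hnot : ∀ X ∈ {X | (ofSlots s).Tight p X}, ¬ (hits e X = 1 ∧ hits f X = 1) := by
    rintro X hX ⟨h1, h2⟩
    have h3 := hcov X
    have h4 := hweak X
    rw [h1, h2] at h3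
    simp only [Tight, Set.mem_ofPred_eq] at hX
    omega
  have hne : e ≠ f := by
    rintro rfl; exact he.ne_empty (by simpa using hdisj)
  have memS : ∀ x, x ∈ (ofSlots s).edges ↔ x = e ∨ x = f ∨ ∃ y ∈ r, y.1 = x ∧ 0 < y.2 := by
    intro x
    rw [mem_edges_ofSlots, hs]
    simp only [Multiset.mem_cons, exists_eq_or_imp]
    have : 0 < a := by omega
    have : 0 < b := by omega
    grind
  have memS' : ∀ x, x ∈ (ofSlots s').edges ↔ (x = e ∧ α < a) ∨ (x = f ∧ α < b) ∨ x = e ∪ f ∨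
      ∃ y ∈ r, y.1 = x ∧ 0 < y.2 := by
    intro x
    rw [mem_edges_ofSlots, hs', mergeSlots]
    simp only [Multiset.mem_cons, exists_eq_or_imp, Nat.sub_pos_iff_lt]
    grind
  have hef : e ∪ f ∈ (ofSlots s').edges := (memS' _).2 (by simp)
  have hlive : liveSlots r = r := Multiset.filter_eq_self.2 hr
  have hcard : (e ∪ f).card = e.card + f.card := Finset.card_union_of_disjoint hdisj
  have hcardle := Finset.card_le_univ (e ∪ f)
  have hepos := he.card_pos
  have hfpos := hf.card_pos
  have hrk' : (ofSlots s').tightRank p ≤ _ := tightRank_le hskew hweak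
  have hc := hg.card_le
  have key : Multiset.card (liveSlots s') ≤ H₀.edges.card + (ofSlots s').tightRank p ∧
      potential p (liveSlots s') < potential p s := by
    unfold potential
    rw [ofSlots_liveSlots]
    set n := Fintype.card V
    set ρ := (ofSlots s).tightRank p with hρ
    set ρ' := (ofSlots s').tightRank p with hρ'
    rw [hs] at hc
    simp only [Multiset.card_cons] at hc
    by_cases h1 : α = a <;> by_cases h2 : α = b
    · have hL : liveSlots s' = (e ∪ f, α) ::ₘ r := by
        rw [hs', mergeSlots, liveSlots_cons_of_eq_zero (by simp; omega),
          liveSlots_cons_of_eq_zero (by simp; omega), liveSlots_cons_of_pos hα, hlive]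
      have hrank : ρ ≤ ρ' + 1 := hitRank_le_of_merge_both hT (fun x hx => by
        rw [Finset.mem_erase, Finset.mem_erase, memS] at hx
        rw [memS']; grind) hne hef hnot
      have hmul : n * (2 * n - ρ') ≤ n * (2 * n - ρ) + n := by
        rw [← Nat.mul_succ]; exact Nat.mul_le_mul_left _ (by omega)
      rw [hL, hs]
      simp only [Multiset.card_cons, Multiset.map_cons, Multiset.sum_cons]
      constructor <;> omega
    · have hL : liveSlots s' = (f, b - α) ::ₘ (e ∪ f, α) ::ₘ r := by
        rw [hs', mergeSlots, liveSlots_cons_of_eq_zero (by simp; omega),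
          liveSlots_cons_of_pos (by simp; omega), liveSlots_cons_of_pos hα, hlive]
      have hrank : ρ ≤ ρ' := hitRank_le_of_merge_left hT (fun x hx => by
        rw [Finset.mem_erase, memS] at hx
        rw [memS']; grind) ((memS' _).2 (Or.inr (Or.inl ⟨rfl, by omega⟩))) hef hnot
      have hmul : n * (2 * n - ρ') ≤ n * (2 * n - ρ) :=
        Nat.mul_le_mul_left _ (by omega)
      rw [hL, hs]
      simp only [Multiset.card_cons, Multiset.map_cons, Multiset.sum_cons]
      constructor <;> omega
    · have hL : liveSlots s' = (e, a - α) ::ₘ (e ∪ f, α) ::ₘ r := by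
        rw [hs', mergeSlots, liveSlots_cons_of_pos (by simp; omega),
          liveSlots_cons_of_eq_zero (by simp; omega), liveSlots_cons_of_pos hα, hlive]
      have hrank : ρ ≤ ρ' := hitRank_le_of_merge_left (e := f) (f := e) hT (fun x hx => by
        rw [Finset.mem_erase, memS] at hx
        rw [memS']; grind) ((memS' _).2 (Or.inl ⟨rfl, by omega⟩)) (by rwa [Finset.union_comm])
        (fun X hX h => hnot X hX h.symm)
      have hmul : n * (2 * n - ρ') ≤ n * (2 * n - ρ) :=
        Nat.mul_le_mul_left _ (by omega)
      rw [hL, hs]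
      simp only [Multiset.card_cons, Multiset.map_cons, Multiset.sum_cons]
      constructor <;> omega
    · have hL : liveSlots s' = (e, a - α) ::ₘ (f, b - α) ::ₘ (e ∪ f, α) ::ₘ r := by
        rw [hs', mergeSlots, liveSlots_cons_of_pos (by simp; omega),
          liveSlots_cons_of_pos (by simp; omega), liveSlots_cons_of_pos hα, hlive]
      obtain ⟨Z, hZ, hZe, hZf⟩ := (hmax.resolve_left h1).resolve_left h2
      have hrank : ρ + 1 ≤ ρ' := hitRank_lt_of_new hT (fun x hx => by
        rw [memS] at hx
        rw [memS']; grind) ((memS' _).2 (Or.inl ⟨rfl, by omega⟩))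
        ((memS' _).2 (Or.inr (Or.inl ⟨rfl, by omega⟩))) hef hnot hZ hZe hZf
      have hmul : n * (2 * n - ρ') + n ≤ n * (2 * n - ρ) := by
        rw [← Nat.mul_succ]; exact Nat.mul_le_mul_left _ (by omega)
      rw [hL, hs]
      simp only [Multiset.card_cons, Multiset.map_cons, Multiset.sum_cons]
      constructor <;> omega
  refine ⟨⟨fun x hx => (Multiset.mem_filter.1 hx).2, ?_, ?_, ?_⟩, key.2⟩
  · rwa [ofSlots_liveSlots]
  · rw [ofSlots_liveSlots]
    exact hg.merged.trans (obtainedByMerging_mergeSlots hdisj ha hb)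
  · rw [ofSlots_liveSlots]; exact key.1

/-! ### Existence of a strong cover -/

lemma Good.card_edges_le {s : Multiset (Finset V × ℕ)} (hskew : SkewSupermodular p)
    (hg : Good H₀ p s) : Multiset.card s ≤ H₀.edges.card + 2 * Fintype.card V :=
  hg.card_le.trans (Nat.add_le_add_left (tightRank_le hskew hg.weak) _)

/-- If no tight set meets both `e` and `f`, then a maximal merging step exists. -/
lemma Good.exists_merge (hg : Good H₀ p ((e, a) ::ₘ (f, b) ::ₘ r))
    (hnot : ¬ ∃ Y, (ofSlots ((e, a) ::ₘ (f, b) ::ₘ r)).Tight p Y ∧ (e ∩ Y).Nonempty ∧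
      (f ∩ Y).Nonempty) :
    ∃ α, 0 < α ∧ α ≤ a ∧ α ≤ b ∧ (ofSlots (mergeSlots e f a b α r)).WeaklyCovers p ∧
      (α = a ∨ α = b ∨
        ∃ Z, (ofSlots (mergeSlots e f a b α r)).Tight p Z ∧ hits e Z = 1 ∧ hits f Z = 1) := by
  classical
  let P : ℕ → Prop := fun α => (ofSlots (mergeSlots e f a b α r)).WeaklyCovers p
  have hcov := fun α (h : α ≤ min a b) => coverage_mergeSlots (e := e) (f := f) (r := r)
    (h.trans (min_le_left a b)) (h.trans (min_le_right a b))
  have hfail : ∀ α, α + 1 ≤ min a b → P α → ¬ P (α + 1) →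
      ∃ Z, (ofSlots (mergeSlots e f a b α r)).Tight p Z ∧ hits e Z = 1 ∧ hits f Z = 1 := by
    intro α hα h1 h2
    obtain ⟨Z, hZ⟩ := not_forall.1 h2
    have h3 := h1 Z
    have h4 := hcov α (by omega) Z
    have h5 := hcov (α + 1) hα Z
    have h6 := hits_le_one e Z
    have h7 := hits_le_one f Z
    interval_cases h8 : hits e Z <;> interval_cases h9 : hits f Z <;>
      first
      | exact ⟨Z, by unfold Tight; omega, h8, h9⟩
      | omega
  have h0 : P 0 := fun X => by
    have h1 := hcov 0 (Nat.zero_le _) X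
    have h2 := hg.weak X
    omega
  have hab : 1 ≤ min a b := by
    have h1 := hg.pos (e, a) (by simp)
    have h2 := hg.pos (f, b) (by simp)
    simp only at h1 h2
    omega
  have hP1 : P 1 := by
    by_contra h1
    obtain ⟨Z, hZ, hZe, hZf⟩ := hfail 0 hab h0 h1
    refine hnot ⟨Z, ?_, hits_eq_one_iff_nonempty.1 hZe, hits_eq_one_iff_nonempty.1 hZf⟩
    have := hcov 0 (Nat.zero_le _) Z
    unfold Tight at *
    omega
  have hspec := Nat.findGreatest_spec (P := P) hab hP1
  have hle := Nat.findGreatest_le (P := P) (min a b)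
  have hge := Nat.le_findGreatest (P := P) hab hP1
  refine ⟨Nat.findGreatest P (min a b), hge, by omega, by omega, hspec, ?_⟩
  by_cases hlt : Nat.findGreatest P (min a b) < min a b
  · exact Or.inr (Or.inr (hfail _ hlt hspec
      (Nat.findGreatest_is_greatest (Nat.lt_succ_self _) hlt)))
  · omega

theorem Good.exists_stronglyCovers (hsymm : SymmetricSetFunction p) (hskew : SkewSupermodular p)
    (m : ℕ) : ∀ s : Multiset (Finset V × ℕ), Good H₀ p s → potential p s = m →
      ∃ s', Good H₀ p s' ∧ (ofSlots s').StronglyCovers p := by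
  induction m using Nat.strong_induction_on with
  | _ m ih =>
  intro s hg hm
  by_cases hst : ∀ e ∈ (ofSlots s).edges, ∀ f ∈ (ofSlots s).edges, e ≠ f → (ofSlots s).Stuck p e f
  · exact ⟨s, hg, stronglyCovers_of_stuck hsymm hskew hg.weak hst⟩
  · unfold Stuck at hst
    push Not at hst
    obtain ⟨e, he, f, hf, hne, hene, hfne, hdisj, hnot⟩ := hst
    obtain ⟨⟨e, a⟩, hea, rfl, -⟩ := mem_edges_ofSlots.1 he
    obtain ⟨⟨f, b⟩, hfb, rfl, -⟩ := mem_edges_ofSlots.1 hf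
    obtain ⟨s, rfl⟩ := Multiset.exists_cons_of_mem hea
    have hfb' := (Multiset.mem_cons.1 hfb).resolve_left fun h => hne (congrArg Prod.fst h).symm
    obtain ⟨r, rfl⟩ := Multiset.exists_cons_of_mem hfb'
    obtain ⟨α, hα, ha, hb, hweak, hmax⟩ := hg.exists_merge (by push Not; exact hnot)
    obtain ⟨hg', hlt⟩ := hg.merge hskew hdisj hene hfne hα ha hb hweak hmax
    exact ih _ (hm ▸ hlt) _ hg' rfl

/-- Every weak cover can be merged into a strong cover with at most `2|V|` additional hyperedges. -/
theorem exists_merged_stronglyCovers {H : WHypergraph V} (hsymm : SymmetricSetFunction p)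
    (hskew : SkewSupermodular p) (hweak : H.WeaklyCovers p) :
    ∃ Hs : WHypergraph V, Hs.StronglyCovers p ∧ H.ObtainedByMerging Hs ∧
      Hs.edges.card ≤ H.edges.card + 2 * Fintype.card V := by
  obtain ⟨s, hg, hs⟩ := Good.exists_stronglyCovers hsymm hskew _ _ (good_slots hweak) rfl
  exact ⟨ofSlots s, hs, hg.merged, (card_edges_ofSlots_le s).trans (hg.card_edges_le hskew)⟩

end

end WHypergraph

namespace RAM

/-! ### Reasoning about programs -/

namespace Memory

@[simp] lemma setVar_var (σ : Memory) (x : ℕ) (t : ℤ) (y : ℕ) :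
    (σ.setVar x t).var y = if y = x then t else σ.var y := by
  simp [setVar, Function.update_apply]

@[simp] lemma setVar_arr (σ : Memory) (x : ℕ) (t : ℤ) : (σ.setVar x t).arr = σ.arr := rfl

@[simp] lemma setCell_var (σ : Memory) (a : ℕ) (i j t : ℤ) : (σ.setCell a i j t).var = σ.var := rfl

@[simp] lemma setCell_arr (σ : Memory) (a : ℕ) (i j t : ℤ) (a' : ℕ) (i' j' : ℤ) :
    (σ.setCell a i j t).arr a' i' j' = if a' = a ∧ i' = i ∧ j' = j then t else σ.arr a' i' j' := rfl

@[simp] lemma setRow_var {n : ℕ} (σ : Memory) (a : ℕ) (X : Finset (Fin n)) :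
    (σ.setRow a X).var = σ.var := rfl

end Memory

namespace Prog

/-- Whether some instruction of the program writes to the variable `x`. -/
def writesVar : Prog → ℕ → Bool
  | skip, _ => false
  | assign y _, x => x == y
  | store _ _ _ _, _ => false
  | query _ _ _ _ _ _ z, x => x == z
  | seq P Q, x => P.writesVar x || Q.writesVar x
  | ite _ P Q, x => P.writesVar x || Q.writesVar x
  | loop _ P, x => P.writesVar x

/-- Whether some instruction of the program writes to the array `a`. -/
def writesArr : Prog → ℕ → Bool
  | skip, _ => false
  | assign _ _, _ => false
  | store b _ _ _, a => a == b
  | query _ _ _ _ _ Z _, a => a == Z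
  | seq P Q, a => P.writesArr a || Q.writesArr a
  | ite _ P Q, a => P.writesArr a || Q.writesArr a
  | loop _ P, a => P.writesArr a

/-- `σ` and `τ` differ only in variables and arrays to which `P` writes. -/
def Frame (P : Prog) (σ τ : Memory) : Prop :=
  (∀ x, P.writesVar x = false → τ.var x = σ.var x) ∧ ∀ a, P.writesArr a = false → τ.arr a = σ.arr a

lemma Frame.refl (P : Prog) (σ : Memory) : P.Frame σ σ := ⟨fun _ _ => rfl, fun _ _ => rfl⟩

lemma Frame.trans {P : Prog} {σ τ ρ : Memory} (h : P.Frame σ τ) (h' : P.Frame τ ρ) : P.Frame σ ρ :=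
  ⟨fun x hx => (h'.1 x hx).trans (h.1 x hx), fun a ha => (h'.2 a ha).trans (h.2 a ha)⟩

lemma Frame.mono {P Q : Prog} {σ τ : Memory} (h : P.Frame σ τ)
    (hv : ∀ x, Q.writesVar x = false → P.writesVar x = false)
    (ha : ∀ a, Q.writesArr a = false → P.writesArr a = false) : Q.Frame σ τ :=
  ⟨fun x hx => h.1 x (hv x hx), fun a h' => h.2 a (ha a h')⟩

/-- Executes `P` for `x = 0, …, y - 1`, where `y` is the value of a variable that `P` leaves
unchanged. -/
def forLoop (x y : ℕ) (P : Prog) : Prog :=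
  seq (assign x (Expr.const 0)) (loop (Test.not (Test.le (Expr.var y) (Expr.var x)))
    (seq P (assign x (Expr.add (Expr.var x) (Expr.const 1)))))

end Prog

variable {n : ℕ} {O : MaxQuery (Fin n) → Finset (Fin n) × ℤ} {K : ℕ}

lemma Exec.frame {P : Prog} {σ τ : Memory} {t : ℕ} {qs : List (MaxQuery (Fin n))}
    (h : Exec O P σ τ t qs) : P.Frame σ τ := by
  induction h with
  | skip σ => exact Prog.Frame.refl _ _
  | assign x t σ =>
    refine ⟨fun y hy => ?_, fun _ _ => rfl⟩
    simp only [Prog.writesVar, beq_eq_false_iff_ne] at hy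
    simp [hy]
  | store a i j t σ =>
    refine ⟨fun _ _ => rfl, fun b hb => ?_⟩
    simp only [Prog.writesArr, beq_eq_false_iff_ne] at hb
    ext; simp [hb]
  | query k G c S T Z z σ q =>
    constructor
    · intro y hy
      simp only [Prog.writesVar, beq_eq_false_iff_ne] at hy
      simp [hy]
    · intro b hb
      simp only [Prog.writesArr, beq_eq_false_iff_ne] at hb
      ext; simp [Memory.setRow, hb]
  | seq h₁ h₂ ih₁ ih₂ =>
    exact (ih₁.mono (by simp [Prog.writesVar]; tauto) (by simp [Prog.writesArr]; tauto)).trans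
      (ih₂.mono (by simp [Prog.writesVar]) (by simp [Prog.writesArr]))
  | ite_true hb h ih =>
    exact ih.mono (by simp [Prog.writesVar]; tauto) (by simp [Prog.writesArr]; tauto)
  | ite_false hb h ih =>
    exact ih.mono (by simp [Prog.writesVar]) (by simp [Prog.writesArr])
  | loop_stop => exact Prog.Frame.refl _ _
  | loop_step hb h₁ h₂ ih₁ ih₂ =>
    exact (ih₁.mono (by simp [Prog.writesVar]) (by simp [Prog.writesArr])).trans ih₂

/-- Started in memory `σ`, the program `P` halts within time `T` after at most `Q` queries, all of
them with at most `K` hyperedges, in a memory that satisfies `Φ`. -/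
def Runs (O : MaxQuery (Fin n) → Finset (Fin n) × ℤ) (K : ℕ) (P : Prog) (σ : Memory) (T Q : ℕ)
    (Φ : Memory → Prop) : Prop :=
  ∃ (τ : Memory) (t : ℕ) (qs : List (MaxQuery (Fin n))), Exec O P σ τ t qs ∧ t ≤ T ∧
    qs.length ≤ Q ∧ (∀ q ∈ qs, q.graph.edges.card ≤ K) ∧ Φ τ

namespace Runs

variable {P P' : Prog} {σ : Memory} {T T' Q Q' : ℕ} {Φ Ψ : Memory → Prop}

lemma mono (h : Runs O K P σ T Q Φ) (hT : T ≤ T') (hQ : Q ≤ Q') (hΦ : ∀ τ, Φ τ → Ψ τ) :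
    Runs O K P σ T' Q' Ψ := by
  obtain ⟨τ, t, qs, h₁, h₂, h₃, h₄, h₅⟩ := h
  exact ⟨τ, t, qs, h₁, h₂.trans hT, h₃.trans hQ, h₄, hΦ τ h₅⟩

lemma le (h : Runs O K P σ T Q Φ) (hT : T ≤ T') (hQ : Q ≤ Q') : Runs O K P σ T' Q' Φ :=
  h.mono hT hQ fun _ => id

lemma frame (h : Runs O K P σ T Q Φ) : Runs O K P σ T Q fun τ => P.Frame σ τ ∧ Φ τ := by
  obtain ⟨τ, t, qs, h₁, h₂, h₃, h₄, h₅⟩ := h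
  exact ⟨τ, t, qs, h₁, h₂, h₃, h₄, h₁.frame, h₅⟩

lemma skip (h : Φ σ) (hT : 1 ≤ T) : Runs O K Prog.skip σ T Q Φ :=
  ⟨σ, 1, [], Exec.skip σ, hT, Nat.zero_le _, by simp, h⟩

lemma assign {x : ℕ} {t : Expr} (h : Φ (σ.setVar x (t.eval σ))) (hT : t.cost + 1 ≤ T) :
    Runs O K (Prog.assign x t) σ T Q Φ :=
  ⟨_, _, [], Exec.assign x t σ, hT, Nat.zero_le _, by simp, h⟩

lemma store {a : ℕ} {i j t : Expr} (h : Φ (σ.setCell a (i.eval σ) (j.eval σ) (t.eval σ)))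
    (hT : i.cost + j.cost + t.cost + 1 ≤ T) : Runs O K (Prog.store a i j t) σ T Q Φ :=
  ⟨_, _, [], Exec.store a i j t σ, hT, Nat.zero_le _, by simp, h⟩

lemma query {k G c S R Z z : ℕ} (q : MaxQuery (Fin n)) (hgraph : σ.Stores k G c q.graph)
    (hS : σ.RowIs S 0 q.S) (hT : σ.RowIs R 0 q.T) (hST : Disjoint q.S q.T)
    (hK : q.graph.edges.card ≤ K) (h : Φ ((σ.setRow Z (O q).1).setVar z (O q).2)) :
    Runs O K (Prog.query k G c S R Z z) σ 1 1 Φ :=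
  ⟨_, _, [q], Exec.query k G c S R Z z σ q hgraph hS hT hST, le_rfl, le_rfl, by simpa using hK, h⟩

lemma seq {T₁ Q₁ : ℕ} (h : Runs O K P σ T₁ Q₁ Φ)
    (h' : ∀ τ, Φ τ → Runs O K P' τ (T - T₁) (Q - Q₁) Ψ) (hT : T₁ ≤ T) (hQ : Q₁ ≤ Q) :
    Runs O K (Prog.seq P P') σ T Q Ψ := by
  obtain ⟨τ, t, qs, h₁, h₂, h₃, h₄, h₅⟩ := h
  obtain ⟨ρ, t', qs', h₁', h₂', h₃', h₄', h₅'⟩ := h' τ h₅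
  refine ⟨ρ, _, _, Exec.seq h₁ h₁', by omega, by simp; omega, ?_, h₅'⟩
  intro q hq
  rcases List.mem_append.1 hq with hq | hq
  exacts [h₄ q hq, h₄' q hq]

lemma assign_seq {x : ℕ} {t : Expr}
    (h : Runs O K P (σ.setVar x (t.eval σ)) (T - (t.cost + 1)) Q Φ) (hT : t.cost + 1 ≤ T) :
    Runs O K (Prog.seq (Prog.assign x t) P) σ T Q Φ :=
  (Runs.assign (Φ := (· = σ.setVar x (t.eval σ))) rfl le_rfl).seq
    (fun _ hτ => hτ ▸ h) hT (Nat.zero_le _)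

lemma store_seq {a : ℕ} {i j t : Expr}
    (h : Runs O K P (σ.setCell a (i.eval σ) (j.eval σ) (t.eval σ))
      (T - (i.cost + j.cost + t.cost + 1)) Q Φ) (hT : i.cost + j.cost + t.cost + 1 ≤ T) :
    Runs O K (Prog.seq (Prog.store a i j t) P) σ T Q Φ :=
  (Runs.store (Φ := (· = σ.setCell a (i.eval σ) (j.eval σ) (t.eval σ))) rfl le_rfl).seq
    (fun _ hτ => hτ ▸ h) hT (Nat.zero_le _)

lemma ite {b : Test} (h : b.Holds σ → Runs O K P σ (T - (b.cost + 1)) Q Φ)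
    (h' : ¬ b.Holds σ → Runs O K P' σ (T - (b.cost + 1)) Q Φ) (hT : b.cost + 1 ≤ T) :
    Runs O K (Prog.ite b P P') σ T Q Φ := by
  by_cases hb : b.Holds σ
  · obtain ⟨τ, t, qs, h₁, h₂, h₃, h₄, h₅⟩ := h hb
    exact ⟨τ, _, qs, Exec.ite_true hb h₁, by omega, h₃, h₄, h₅⟩
  · obtain ⟨τ, t, qs, h₁, h₂, h₃, h₄, h₅⟩ := h' hb
    exact ⟨τ, _, qs, Exec.ite_false hb h₁, by omega, h₃, h₄, h₅⟩

/-- The rule for loops. `I T Q σ` says that the invariant holds in `σ` and that time `T` and `Q`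
queries suffice for the remaining iterations. -/
lemma loop {b : Test} (I : ℕ → ℕ → Memory → Prop)
    (hexit : ∀ T Q σ, I T Q σ → ¬ b.Holds σ → Φ σ ∧ b.cost + 1 ≤ T)
    (hstep : ∀ T Q σ, I T Q σ → b.Holds σ → ∃ t q T' Q', t + T' + (b.cost + 1) ≤ T ∧ q + Q' ≤ Q ∧
      Runs O K P σ t q (I T' Q')) :
    ∀ T Q σ, I T Q σ → Runs O K (Prog.loop b P) σ T Q Φ := by
  intro T
  induction T using Nat.strong_induction_on with
  | _ T ih =>
  intro Q σ hI
  by_cases hb : b.Holds σ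
  · obtain ⟨t, q, T', Q', hT, hQ, τ, t₁, qs, h₁, h₂, h₃, h₄, h₅⟩ := hstep T Q σ hI hb
    obtain ⟨ρ, t₂, qs', h₁', h₂', h₃', h₄', h₅'⟩ := ih T' (by omega) Q' τ h₅
    refine ⟨ρ, _, _, Exec.loop_step hb h₁ h₁', by omega, by simp; omega, ?_, h₅'⟩
    intro q hq
    rcases List.mem_append.1 hq with hq | hq
    exacts [h₄ q hq, h₄' q hq]
  · obtain ⟨h, h'⟩ := hexit T Q σ hI hb
    exact ⟨σ, _, [], Exec.loop_stop hb, h', Nat.zero_le _, by simp, h⟩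

/-- The rule for `Prog.forLoop`: `I i` holds before the iteration `x = i`. -/
lemma forLoop {x y N : ℕ} (I : ℕ → Memory → Prop) (hx : P.writesVar x = false)
    (hy : (Prog.forLoop x y P).writesVar y = false) (hN : σ.var y = N) (h0 : I 0 (σ.setVar x 0))
    (hstep : ∀ i < N, ∀ τ, (Prog.forLoop x y P).Frame σ τ → τ.var x = i → I i τ →
      Runs O K P τ T Q fun ρ => I (i + 1) (ρ.setVar x (i + 1))) :
    Runs O K (Prog.forLoop x y P) σ (N * (T + 9) + 7) (N * Q) (I N) := by
  have hy' : P.writesVar y = false ∧ y ≠ x := by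
    simp only [Prog.forLoop, Prog.writesVar, Bool.or_eq_false_iff, beq_eq_false_iff_ne] at hy
    exact ⟨hy.2.1, hy.1⟩
  have fr : ∀ z t τ, (Prog.forLoop x y P).Frame σ τ → z = x →
      (Prog.forLoop x y P).Frame σ (τ.setVar z t) := by
    rintro z t τ h rfl
    refine ⟨fun w hw => ?_, h.2⟩
    have : w ≠ z := by
      simp only [Prog.forLoop, Prog.writesVar, Bool.or_eq_false_iff, beq_eq_false_iff_ne] at hw
      exact hw.1
    simp [this, h.1 w hw]
  have main : ∀ m i, i + m = N → ∀ τ, (Prog.forLoop x y P).Frame σ τ → τ.var x = i → I i τ →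
      Runs O K (Prog.loop (Test.not (Test.le (Expr.var y) (Expr.var x)))
        (Prog.seq P (Prog.assign x (Expr.add (Expr.var x) (Expr.const 1))))) τ (m * (T + 9) + 5)
        (m * Q) (I N) := by
    intro m
    induction m with
    | zero =>
      intro i hi τ hf hτ hI
      obtain rfl : i = N := by omega
      refine ⟨τ, _, [], Exec.loop_stop ?_, by simp [Test.cost, Expr.cost],
        Nat.zero_le _, by simp, hI⟩
      have := hf.1 y hy
      simp only [Test.Holds, Expr.eval]
      omega
    | succ m ih =>
      intro i hi τ hf hτ hI
      obtain ⟨ρ, t, qs, h₁, h₂, h₃, h₄, h₅⟩ := hstep i (by omega) τ hf hτ hI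
      have hρx : ρ.var x = i := (h₁.frame.1 x hx).trans hτ
      have hexec : Exec O (Prog.assign x (Expr.add (Expr.var x) (Expr.const 1))) ρ
          (ρ.setVar x (i + 1)) ((Expr.add (Expr.var x) (Expr.const 1)).cost + 1) [] := by
        have := Exec.assign (O := O) x (Expr.add (Expr.var x) (Expr.const 1)) ρ
        simp only [Expr.eval, hρx] at this
        exact this
      obtain ⟨π, t', qs', h₁', h₂', h₃', h₄', h₅'⟩ := ih (i + 1) (by omega) (ρ.setVar x (i + 1))
        (fr x _ ρ (hf.trans (h₁.frame.mono (fun z hz => by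
            simp only [Prog.forLoop, Prog.writesVar, Bool.or_eq_false_iff] at hz; exact hz.2.1)
          (fun a ha => by
            simp only [Prog.forLoop, Prog.writesArr, Bool.or_eq_false_iff] at ha
            exact ha.2.1))) rfl)
        (by simp) h₅
      refine ⟨π, _, _, Exec.loop_step ?_ (Exec.seq h₁ hexec) h₁', ?_, ?_, ?_, h₅'⟩
      · have := hf.1 y hy
        simp only [Test.Holds, Expr.eval]
        omega
      · simp only [Test.cost, Expr.cost]; rw [Nat.succ_mul]; omega
      · simp only [List.append_nil, List.length_append]; rw [Nat.succ_mul]; omega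
      · intro q hq
        simp only [List.append_nil, List.mem_append] at hq
        exact hq.elim (h₄ q) (h₄' q)
  refine Runs.assign_seq ?_ (by simp [Expr.cost])
  exact (main N 0 (by simp) _ (fr x 0 σ (Prog.Frame.refl _ _) rfl) (by simp)
    (by simpa [Expr.eval] using h0)).le (by simp [Expr.cost]) le_rfl

end Runs

open WHypergraph

attribute [local simp] Expr.eval Expr.cost Test.Holds Test.cost

variable {p : Finset (Fin n) → ℤ}

/-! ### Storing slots in the memory -/

/-- The first `N` slots are stored in the rows of array `2` and in array `3`, and variable `2` holds
their number. Slot `x` holds the hyperedge `E x` with weight `W x`. -/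
structure HasSlots (σ : Memory) (E : ℕ → Finset (Fin n)) (W : ℕ → ℕ) (N : ℕ) : Prop where
  count : σ.var 2 = N
  row : ∀ x < N, σ.RowIs 2 x (E x)
  weight : ∀ x < N, σ.arr 3 x 0 = W x

/-- The multiset of the first `N` slots. -/
def slotsOf (E : ℕ → Finset (Fin n)) (W : ℕ → ℕ) (N : ℕ) : Multiset (Finset (Fin n) × ℕ) :=
  (Multiset.range N).map fun x => (E x, W x)

lemma slotsOf_succ (E : ℕ → Finset (Fin n)) (W : ℕ → ℕ) (N : ℕ) :
    slotsOf E W (N + 1) = (E N, W N) ::ₘ slotsOf E W N := by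
  simp [slotsOf, Multiset.range_succ]

lemma slotsOf_eq_cons {E : ℕ → Finset (Fin n)} {W : ℕ → ℕ} {N a : ℕ} (ha : a < N) :
    slotsOf E W N = (E a, W a) ::ₘ ((Multiset.range N).erase a).map fun x => (E x, W x) := by
  rw [slotsOf, ← Multiset.cons_erase (Multiset.mem_range.2 ha), Multiset.map_cons,
    Multiset.erase_cons_head]

lemma slotsOf_eq_cons_cons {E : ℕ → Finset (Fin n)} {W : ℕ → ℕ} {N a b : ℕ} (ha : a < N)
    (hb : b < N) (hab : a ≠ b) :
    slotsOf E W N = (E a, W a) ::ₘ (E b, W b) ::ₘ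
      (((Multiset.range N).erase a).erase b).map fun x => (E x, W x) := by
  have hmem : b ∈ (Multiset.range N).erase a :=
    (Multiset.mem_erase_of_ne hab.symm).2 (Multiset.mem_range.2 hb)
  rw [slotsOf_eq_cons ha, ← Multiset.cons_erase hmem, Multiset.map_cons, Multiset.erase_cons_head]

/-- Overwriting slot `a` by the last slot deletes slot `a`. -/
lemma slotsOf_move {E : ℕ → Finset (Fin n)} {W : ℕ → ℕ} {N a : ℕ} (ha : a ≤ N) :
    slotsOf E W (N + 1) = (E a, W a) ::ₘ
      slotsOf (Function.update E a (E N)) (Function.update W a (W N)) N := by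
  rw [slotsOf_succ]
  rcases ha.lt_or_eq with ha | rfl
  · rw [slotsOf_eq_cons ha, slotsOf_eq_cons (E := Function.update E a (E N)) ha]
    simp only [Function.update_self]
    rw [Multiset.cons_swap]
    congr 2
    refine Multiset.map_congr rfl fun x hx => ?_
    have : x ≠ a := by
      rintro rfl
      exact (Multiset.nodup_range N).notMem_erase hx
    simp [this]
  · simp

lemma HasSlots.of_frame {σ τ : Memory} {E : ℕ → Finset (Fin n)} {W : ℕ → ℕ} {N : ℕ} {P : Prog}
    (h : HasSlots σ E W N) (hf : P.Frame σ τ) (h2 : P.writesVar 2 = false)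
    (h2' : P.writesArr 2 = false) (h3 : P.writesArr 3 = false) : HasSlots τ E W N where
  count := (hf.1 2 h2).trans h.count
  row x hx v := by rw [hf.2 2 h2']; exact h.row x hx v
  weight x hx := by rw [hf.2 3 h3]; exact h.weight x hx

/-! ### Moving and deleting slots -/

/-- Copies the slot whose number is in variable `2` to the slot whose number is in variable `x`. -/
def moveSlot (x : ℕ) : Prog :=
  .seq
    (.forLoop 7 0 (.store 2 (.var x) (.var 7) (.get 2 (.var 2) (.var 7))))
    (.store 3 (.var x) (.const 0) (.get 3 (.var 2) (.const 0)))

/-- Deletes the slot whose number is in variable `x` if its weight is zero. -/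
def removeSlot (x : ℕ) : Prog :=
  .ite (.eq (.get 3 (.var x) (.const 0)) (.const 0))
    (.seq (.assign 2 (.sub (.var 2) (.const 1))) (moveSlot x))
    .skip

lemma runs_moveSlot {σ : Memory} {x : ℕ} (hx : x ≠ 7) (hn : σ.var 0 = n) :
    Runs O K (moveSlot x) σ (n * 15 + 13) 0 fun τ =>
      (∀ v : Fin n, τ.arr 2 (σ.var x) (v : ℕ) = σ.arr 2 (σ.var 2) (v : ℕ)) ∧
      (∀ i j, i ≠ σ.var x → τ.arr 2 i j = σ.arr 2 i j) ∧
      (∀ i, τ.arr 3 i 0 = if i = σ.var x then σ.arr 3 (σ.var 2) 0 else σ.arr 3 i 0) := by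
  refine Runs.seq (Runs.forLoop (N := n) (T := 6) (Q := 0)
    (fun v τ => ∀ i j, τ.arr 2 i j =
      if i = σ.var x ∧ 0 ≤ j ∧ j < v then σ.arr 2 (σ.var 2) j else σ.arr 2 i j)
    rfl rfl hn ?_ ?_).frame ?_ (by omega) (by simp)
  · intro i j
    rw [if_neg (by omega)]; rfl
  · intro v hv τ hf hτ hI
    refine Runs.store ?_ (by simp)
    intro i j
    have hx' : τ.var x = σ.var x := hf.1 x (by simpa [Prog.forLoop, Prog.writesVar] using hx)
    have h2 : τ.var 2 = σ.var 2 := hf.1 2 rfl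
    simp only [Memory.setVar_arr, Memory.setCell_arr, Expr.eval, hτ, hx', h2, hI]
    push_cast
    grind
  · rintro τ ⟨hf, hI⟩
    refine Runs.store ?_ (by simp)
    have hx' : τ.var x = σ.var x := hf.1 x (by simpa [Prog.forLoop, Prog.writesVar] using hx)
    have h2 : τ.var 2 = σ.var 2 := hf.1 2 rfl
    have h3 : τ.arr 3 = σ.arr 3 := hf.2 3 rfl
    refine ⟨fun v => ?_, fun i j hij => ?_, fun i => ?_⟩
    · simp [hI]
    · simp [hI, hij]
    · simp [hx', h2, h3]

lemma runs_removeSlot {σ : Memory} {x : ℕ} (hx : x ≠ 7) (hx2 : x ≠ 2) (hn : σ.var 0 = n)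
    {E : ℕ → Finset (Fin n)} {W : ℕ → ℕ} {N a : ℕ} (hs : HasSlots σ E W (N + 1)) (ha : a ≤ N)
    (hxa : σ.var x = a) :
    Runs O K (removeSlot x) σ (n * 15 + 25) 0 fun τ =>
      (W a = 0 → HasSlots τ (Function.update E a (E N)) (Function.update W a (W N)) N) ∧
      (W a ≠ 0 → HasSlots τ E W (N + 1)) := by
  have hW := hs.weight a (by omega)
  refine Runs.ite (fun hb => ?_) (fun hb => ?_) (by simp)
  · simp only [Test.Holds, Expr.eval, hxa, hW] at hb
    refine Runs.assign_seq ?_ (by simp)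
    refine (runs_moveSlot hx (by simpa using hn)).frame.mono (by simp) le_rfl ?_
    rintro τ ⟨hf, h1, h2, h3⟩
    have hN : σ.var 2 - 1 = N := by rw [hs.count]; push_cast; ring
    simp only [Expr.eval, Memory.setVar_var, if_neg hx2, Memory.setVar_arr, if_true, hN, hxa]
      at h1 h2 h3
    refine ⟨fun _ => ⟨?_, fun y hy v => ?_, fun y hy => ?_⟩,
      fun h => absurd (by exact_mod_cast hb) h⟩
    · rw [hf.1 2 rfl]; simp [hN]
    · by_cases hya : y = a
      · subst hya
        rw [h1, Function.update_self]
        exact hs.row N (by omega) v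
      · rw [h2 _ _ (by exact_mod_cast hya), Function.update_of_ne hya]
        exact hs.row y (by omega) v
    · rw [h3]
      by_cases hya : y = a
      · subst hya
        rw [if_pos rfl, Function.update_self]
        exact hs.weight N (by omega)
      · rw [if_neg (by exact_mod_cast hya), Function.update_of_ne hya]
        exact hs.weight y (by omega)
  · simp only [Test.Holds, Expr.eval, hxa, hW] at hb
    exact Runs.skip ⟨fun h => absurd (by exact_mod_cast h) hb, fun _ => hs⟩ (by simp)

/-! ### Reading the input -/

/-- Copies the input hypergraph to the slots. -/
def copyInput : Prog :=
  .seq (.assign 2 (.var 1))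
    (.forLoop 6 1 (.seq
      (.forLoop 7 0 (.store 2 (.var 6) (.var 7) (.get 0 (.var 6) (.var 7))))
      (.store 3 (.var 6) (.const 0) (.get 1 (.var 6) (.const 0)))))

lemma runs_copyInput {σ : Memory} (hn : σ.var 0 = n) {E : ℕ → Finset (Fin n)} {W : ℕ → ℕ} {N : ℕ}
    (hN : σ.var 1 = N) (hrow : ∀ x < N, σ.RowIs 0 x (E x)) (hwt : ∀ x < N, σ.arr 1 x 0 = W x) :
    Runs O K copyInput σ (N * (n * 15 + 22) + 9) 0 fun τ => HasSlots τ E W N := by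
  refine Runs.assign_seq ?_ (by simp)
  refine (Runs.forLoop (N := N) (T := n * 15 + 13) (Q := 0)
    (fun x τ => (∀ y < x, τ.RowIs 2 y (E y)) ∧ ∀ y < x, τ.arr 3 y 0 = W y)
    rfl rfl (by simp [hN]) (by simp) ?_).frame.mono (by simp) (by simp) ?_
  · rintro x hx τ hf hτ ⟨h1, h2⟩
    have e0 : τ.var 0 = n := (hf.1 0 rfl).trans (by simp [hn])
    have a0 : τ.arr 0 = σ.arr 0 := hf.2 0 rfl
    have a1 : τ.arr 1 = σ.arr 1 := hf.2 1 rfl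
    refine Runs.seq (Runs.forLoop (N := n) (T := 6) (Q := 0)
      (fun v ρ => ∀ i j, ρ.arr 2 i j =
        if i = x ∧ 0 ≤ j ∧ j < v then σ.arr 0 x j else τ.arr 2 i j)
      rfl rfl e0 ?_ ?_).frame ?_ (by omega) (by simp)
    · intro i j
      rw [if_neg (by omega)]; rfl
    · intro v hv ρ hf' hρ hI
      refine Runs.store ?_ (by simp)
      intro i j
      have h6 : ρ.var 6 = x := (hf'.1 6 rfl).trans hτ
      have h0 : ρ.arr 0 = σ.arr 0 := (hf'.2 0 rfl).trans a0
      simp only [Memory.setVar_arr, Memory.setCell_arr, Expr.eval, hρ, h6, h0, hI]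
      push_cast
      grind
    · rintro ρ ⟨hf', hI⟩
      refine Runs.store ?_ (by simp)
      have h6 : ρ.var 6 = x := (hf'.1 6 rfl).trans hτ
      have h3 : ρ.arr 3 = τ.arr 3 := hf'.2 3 rfl
      have h1' : ρ.arr 1 = σ.arr 1 := (hf'.2 1 rfl).trans a1
      refine ⟨fun y hy v => ?_, fun y hy => ?_⟩
      · simp only [Memory.setVar_arr, Memory.setCell_arr, hI]
        by_cases hyx : y = x
        · subst hyx; simpa using hrow y hx v
        · simpa [hyx] using h1 y (by omega) v
      · simp only [Memory.setVar_arr, Memory.setCell_arr, Expr.eval, h6, h3, h1']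
        by_cases hyx : y = x
        · subst hyx; simpa using hwt y hx
        · simpa [hyx] using h2 y (by omega)
  · rintro τ ⟨hf, h1, h2⟩
    exact ⟨(hf.1 2 rfl).trans (by simp [hN]), h1, h2⟩

/-! ### Building a hypergraph from the slots -/

/-- The set `X` together with the vertex of number `t`, if there is one. -/
def addVertex (t : ℕ) (X : Finset (Fin n)) : Finset (Fin n) :=
  X ∪ Finset.univ.filter fun v : Fin n => (v : ℕ) = t

lemma mem_addVertex {t : ℕ} {X : Finset (Fin n)} {v : Fin n} :
    v ∈ addVertex t X ↔ v ∈ X ∨ (v : ℕ) = t := by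
  simp [addVertex]

lemma addVertex_self (X : Finset (Fin n)) : addVertex n X = X := by
  ext v; simp [mem_addVertex, v.isLt.ne]

/-- The bit of the set `X` at position `v`. -/
def bit (X : Finset (Fin n)) (v : ℕ) : ℤ := if ∃ w ∈ X, (w : ℕ) = v then 1 else 0

lemma bit_coe (X : Finset (Fin n)) (v : Fin n) : bit X v = if v ∈ X then 1 else 0 := by
  simp [bit, ← Fin.ext_iff]

/-- The number whose binary digits are the first `k` bits of `X`. -/
def partialCode (X : Finset (Fin n)) : ℕ → ℤ
  | 0 => 0
  | k + 1 => partialCode X k + partialCode X k + bit X k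

/-- The number whose binary digits are the incidence vector of `X`. -/
def code (X : Finset (Fin n)) : ℤ := partialCode X n

lemma code_injective : Function.Injective (code : Finset (Fin n) → ℤ) := by
  intro X Y h
  have main : ∀ k, partialCode X k = partialCode Y k → ∀ v < k, bit X v = bit Y v := by
    intro k
    induction k with
    | zero => intro _ v hv; omega
    | succ k ih =>
      intro h v hv
      have hX : bit X k = 0 ∨ bit X k = 1 := by unfold bit; split_ifs <;> simp
      have hY : bit Y k = 0 ∨ bit Y k = 1 := by unfold bit; split_ifs <;> simp
      simp only [partialCode] at h
      rcases Nat.lt_succ_iff_lt_or_eq.1 hv with hv | rfl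
      · exact ih (by omega) v hv
      · omega
  ext v
  have := main n h v v.isLt
  rw [bit_coe, bit_coe] at this
  split_ifs at this <;> simp_all

/-- Writes the hyperedge of the slot whose number is in variable `6`, together with the vertex in
variable `5`, to row `var 1` of array `0`, and its code to variable `8`. -/
def writeRow : Prog :=
  .seq (.assign 8 (.const 0))
    (.forLoop 7 0 (.seq
      (.ite (.eq (.var 7) (.var 5))
        (.store 0 (.var 1) (.var 7) (.const 1))
        (.store 0 (.var 1) (.var 7) (.get 2 (.var 6) (.var 7))))
      (.assign 8 (.add (.add (.var 8) (.var 8)) (.get 0 (.var 1) (.var 7))))))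

lemma runs_writeRow {σ : Memory} (hn : σ.var 0 = n) {t k : ℕ} (ht : σ.var 5 = t) (hk : σ.var 1 = k)
    {X : Finset (Fin n)} (hX : σ.RowIs 2 (σ.var 6) X) :
    Runs O K writeRow σ (n * 27 + 9) 0 fun τ =>
      τ.RowIs 0 k (addVertex t X) ∧ (∀ i j, i ≠ (k : ℤ) → τ.arr 0 i j = σ.arr 0 i j) ∧
      τ.var 8 = code (addVertex t X) := by
  refine Runs.assign_seq ?_ (by simp)
  refine (Runs.forLoop (N := n) (T := 18) (Q := 0)
    (fun v τ => (∀ w : Fin n, (w : ℕ) < v → τ.arr 0 k (w : ℕ) = bit (addVertex t X) w) ∧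
      (∀ i j, i ≠ (k : ℤ) → τ.arr 0 i j = σ.arr 0 i j) ∧ τ.var 8 = partialCode (addVertex t X) v)
    rfl rfl (by simpa using hn) (by simp [partialCode]) ?_).mono (by simp) (by simp) ?_
  · rintro v hv τ hf hτ ⟨h1, h2, h3⟩
    have e5 : τ.var 5 = t := (hf.1 5 rfl).trans (by simp [ht])
    have e1 : τ.var 1 = k := (hf.1 1 rfl).trans (by simp [hk])
    have e6 : τ.var 6 = σ.var 6 := (hf.1 6 rfl).trans (by simp)
    have a2 : τ.arr 2 = σ.arr 2 := hf.2 2 rfl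
    refine Runs.seq (T₁ := 10) (Q₁ := 0)
      (Φ := fun ρ => ρ = τ.setCell 0 k v (bit (addVertex t X) v)) ?_ ?_ (by simp) (by simp)
    · have hbit : bit (addVertex t X) v = if v = t then 1 else σ.arr 2 (σ.var 6) v := by
        have := hX ⟨v, hv⟩
        rw [show bit (addVertex t X) v = _ from bit_coe (addVertex t X) ⟨v, hv⟩]
        simp only [mem_addVertex] at this ⊢
        grind
      refine Runs.ite (fun hb => ?_) (fun hb => ?_) (by simp)
      · refine Runs.store ?_ (by simp)
        simp only [Test.Holds, Expr.eval, hτ, e5, Nat.cast_inj] at hb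
        subst hb; simp [e1, hτ, hbit]
      · refine Runs.store ?_ (by simp)
        simp only [Test.Holds, Expr.eval, hτ, e5, Nat.cast_inj] at hb
        simp [e1, e6, a2, hτ, hbit, hb]
    · rintro _ rfl
      refine Runs.assign ?_ (by simp)
      refine ⟨fun w hw => ?_, fun i j hi => ?_, ?_⟩
      · simp only [Memory.setVar_arr, Memory.setCell_arr]
        by_cases hwv : (w : ℕ) = v
        · simp [hwv]
        · rw [if_neg (by omega)]
          exact h1 w (by omega)
      · simp [hi, h2]
      · simp [partialCode, h3, e1, hτ]
  · rintro τ ⟨h1, h2, h3⟩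
    exact ⟨fun v => (h1 v v.isLt).trans (bit_coe _ _), h2, h3⟩

/-- The hypergraph `G` is stored in variable `1` and arrays `0` and `1`, and `R q` is the hyperedge
in row `q`. Array `5` holds the codes of the hyperedges, and array `4` holds their positions at the
addresses given by the codes; the other cells of these arrays may hold anything. -/
structure Table (σ : Memory) (G : WHypergraph (Fin n)) (k : ℕ) (R : ℕ → Finset (Fin n)) :
    Prop where
  count : σ.var 1 = k
  row : ∀ q < k, σ.RowIs 0 q (R q)
  code : ∀ q < k, σ.arr 5 q 0 = code (R q)
  pos : ∀ q < k, σ.arr 4 (RAM.code (R q)) 0 = q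
  weight : ∀ q < k, σ.arr 1 q 0 = G (R q)
  ne_zero : ∀ q < k, G (R q) ≠ 0
  surj : ∀ e, G e ≠ 0 → ∃ q < k, R q = e

lemma Table.stores {σ : Memory} {G : WHypergraph (Fin n)} {k : ℕ} {R : ℕ → Finset (Fin n)}
    (h : Table σ G k R) : σ.Stores 1 0 1 G := by
  have hinj : Set.InjOn R (Finset.range k) := by
    intro q hq q' hq' hqq
    have h1 := h.pos q (by simpa using hq)
    have h2 := h.pos q' (by simpa using hq')
    rw [hqq, h2] at h1
    exact_mod_cast h1.symm
  have himage : (Finset.range k).image R = G.edges := by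
    ext e
    simp only [Finset.mem_image, Finset.mem_range, edges, Finsupp.mem_support_iff]
    exact ⟨fun ⟨q, hq, he⟩ => he ▸ h.ne_zero q hq, h.surj e⟩
  have hcard : G.edges.card = k := by
    rw [← himage, Finset.card_image_of_injOn hinj, Finset.card_range]
  have hlt : ∀ i : Fin G.edges.card, (i : ℕ) < k := fun i => i.isLt.trans_eq hcard
  have hmem : ∀ i : Fin G.edges.card, R i ∈ G.edges := fun i =>
    himage.subset (Finset.mem_image_of_mem R (Finset.mem_range.2 (hlt i)))
  let g : Fin G.edges.card → G.edges := fun i => ⟨R i, hmem i⟩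
  have hg : Function.Bijective g := by
    rw [Fintype.bijective_iff_injective_and_card]
    refine ⟨fun i j hij => Fin.ext (hinj ?_ ?_ (congrArg Subtype.val hij)), by simp⟩
    · simpa using hlt i
    · simpa using hlt j
  refine ⟨Equiv.ofBijective g hg, by rw [h.count, hcard], fun i => ⟨?_, ?_⟩⟩
  · exact h.row i (hlt i)
  · exact h.weight i (hlt i)

/-- Adds the slot whose number is in variable `6`, together with the vertex in variable `5`, to the
hypergraph in variable `1` and arrays `0` and `1`. If the hyperedge occurs in the hypergraph
already, then it is found by its code, and its weight is increased. -/
def insertSlot : Prog :=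
  .ite (.eq (.get 3 (.var 6) (.const 0)) (.const 0)) .skip
    (.seq writeRow (.seq (.assign 9 (.get 4 (.var 8) (.const 0)))
      (.ite (.and (.le (.const 0) (.var 9)) (.and (.not (.le (.var 1) (.var 9)))
          (.eq (.get 5 (.var 9) (.const 0)) (.var 8))))
        (.store 1 (.var 9) (.const 0)
          (.add (.get 1 (.var 9) (.const 0)) (.get 3 (.var 6) (.const 0))))
        (.seq (.store 4 (.var 8) (.const 0) (.var 1))
          (.seq (.store 5 (.var 1) (.const 0) (.var 8))
            (.seq (.store 1 (.var 1) (.const 0) (.get 3 (.var 6) (.const 0)))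
              (.assign 1 (.add (.var 1) (.const 1)))))))))

lemma runs_insertSlot {σ : Memory} (hn : σ.var 0 = n) {t x w : ℕ} (ht : σ.var 5 = t)
    (hx : σ.var 6 = x) {X : Finset (Fin n)} (hX : σ.RowIs 2 x X) (hw : σ.arr 3 x 0 = w)
    {G : WHypergraph (Fin n)} {k : ℕ} {R : ℕ → Finset (Fin n)} (hG : Table σ G k R) :
    Runs O K insertSlot σ (n * 27 + 52) 0 fun τ =>
      ∃ k' R', Table τ (Finsupp.single (addVertex t X) w + G) k' R' := by
  refine Runs.ite (fun hb => ?_) (fun hb => ?_) (by simp)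
  · refine Runs.skip ?_ (by simp)
    simp only [Test.Holds, Expr.eval, hx, hw, Nat.cast_eq_zero] at hb
    exact ⟨k, R, by simpa [hb] using hG⟩
  · simp only [Test.Holds, Expr.eval, hx, hw, Nat.cast_eq_zero] at hb
    set A := addVertex t X with hA
    refine Runs.seq (runs_writeRow hn ht hG.count (by rw [hx]; exact hX)).frame ?_ (by simp)
      (by simp)
    rintro τ ⟨hf, h1, h2, h3⟩
    rw [← hA] at h1 h3
    have e1 : τ.var 1 = k := (hf.1 1 rfl).trans hG.count
    have e6 : τ.var 6 = x := (hf.1 6 rfl).trans hx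
    have a1 : τ.arr 1 = σ.arr 1 := hf.2 1 rfl
    have a3 : τ.arr 3 = σ.arr 3 := hf.2 3 rfl
    have a4 : τ.arr 4 = σ.arr 4 := hf.2 4 rfl
    have a5 : τ.arr 5 = σ.arr 5 := hf.2 5 rfl
    have hrow : ∀ q < k, τ.RowIs 0 q (R q) := fun q hq v => by
      rw [h2 _ _ (by omega)]; exact hG.row q hq v
    have hval : ∀ B, (Finsupp.single A w + G) B = (if A = B then w else 0) + G B := fun B => by
      rw [Finsupp.add_apply, Finsupp.single_apply]
    refine Runs.assign_seq ?_ (by simp)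
    refine Runs.ite (fun hpos => ?_) (fun hpos => ?_) (by simp)
    · simp only [Test.Holds, Expr.eval, Memory.setVar_var, Memory.setVar_arr, h3, a4, a5, e1,
        if_true, Nat.reduceEqDiff, if_false] at hpos
      obtain ⟨q, hq⟩ := Int.eq_ofNat_of_zero_le hpos.1
      rw [hq] at hpos
      have hqk : q < k := by have := hpos.2.1; omega
      have hRq : R q = A := code_injective ((hG.code q hqk).symm.trans hpos.2.2)
      refine Runs.store ?_ (by simp)
      simp only [Expr.eval, Memory.setVar_var, Memory.setVar_arr, if_true, Nat.reduceEqDiff,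
        if_false, h3, a4, hq, e6, a1, a3, hw, hG.weight q hqk]
      refine ⟨k, R, ?_, fun q' hq' v => ?_, fun q' hq' => ?_, fun q' hq' => ?_, fun q' hq' => ?_,
        fun q' hq' => ?_, fun e he => ?_⟩
      · simp [e1]
      · simpa using hrow q' hq' v
      · simpa [a5] using hG.code q' hq'
      · simpa [a4] using hG.pos q' hq'
      · rw [hval]
        by_cases hqq : q' = q
        · subst hqq
          simp [hRq]; ring
        · have hne : A ≠ R q' := by
            intro h
            have p1 := hG.pos q hqk
            rw [hRq, h, hG.pos q' hq'] at p1
            exact hqq (by exact_mod_cast p1)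
          simpa [hqq, hne, a1] using hG.weight q' hq'
      · rw [hval]; have := hG.ne_zero q' hq'; omega
      · rw [hval] at he
        by_cases hAe : A = e
        · exact ⟨q, hqk, hRq.trans hAe⟩
        · exact hG.surj e (by simpa [hAe] using he)
    · have hnew : ∀ q < k, R q ≠ A := by
        intro q hq h
        apply hpos
        have p1 := hG.pos q hq
        have p2 := hG.code q hq
        rw [h] at p1 p2
        simp only [Test.Holds, Expr.eval, Memory.setVar_var, Memory.setVar_arr, h3, a4, a5, e1,
          if_true, Nat.reduceEqDiff, if_false, p1, p2]
        exact ⟨by omega, by omega, trivial⟩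
      have hG0 : G A = 0 := by
        by_contra h
        obtain ⟨q, hq, h⟩ := hG.surj A h
        exact hnew q hq h
      refine Runs.store_seq ?_ (by simp)
      refine Runs.store_seq ?_ (by simp)
      refine Runs.store_seq ?_ (by simp)
      refine Runs.assign ?_ (by simp)
      have hcode : ∀ q < k, code (R q) ≠ code A := fun q hq h => hnew q hq (code_injective h)
      refine ⟨k + 1, fun q => if q = k then A else R q, ?_, fun q hq v => ?_, fun q hq => ?_,
        fun q hq => ?_, fun q hq => ?_, fun q hq => ?_, fun e he => ?_⟩
      · simp [e1]
      · rcases Nat.lt_succ_iff_lt_or_eq.1 hq with hq | rfl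
        · simpa [hq.ne] using hrow q hq v
        · simpa using h1 v
      · rcases Nat.lt_succ_iff_lt_or_eq.1 hq with hq | rfl
        · simpa [hq.ne, e1, a5] using hG.code q hq
        · simp [e1, h3]
      · rcases Nat.lt_succ_iff_lt_or_eq.1 hq with hq | rfl
        · simpa [hq.ne, e1, h3, hcode q hq, a4] using hG.pos q hq
        · simp [e1, h3]
      · rcases Nat.lt_succ_iff_lt_or_eq.1 hq with hq | rfl
        · simpa [hval, (hnew q hq).symm, hq.ne, e1, a1] using hG.weight q hq
        · simp [hval, hG0, e1, e6, a3, hw]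
      · rcases Nat.lt_succ_iff_lt_or_eq.1 hq with hq | rfl
        · rw [hval]; have := hG.ne_zero q hq; simp only [hq.ne, if_false]; omega
        · simp [hval, hb]
      · rw [hval] at he
        by_cases hAe : A = e
        · exact ⟨k, by omega, by simpa using hAe⟩
        · obtain ⟨q, hq, h⟩ := hG.surj e (by simpa [hAe] using he)
          exact ⟨q, by omega, by simp [hq.ne, h]⟩

/-- Stores the hypergraph given by the slots, with the vertex in variable `5` added to every
hyperedge, in variable `1` and arrays `0` and `1`. -/
def buildGraph : Prog := .seq (.assign 1 (.const 0)) (.forLoop 6 2 insertSlot)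

lemma runs_buildGraph {σ : Memory} (hn : σ.var 0 = n) {t : ℕ} (ht : σ.var 5 = t)
    {E : ℕ → Finset (Fin n)} {W : ℕ → ℕ} {N : ℕ} (hs : HasSlots σ E W N) :
    Runs O K buildGraph σ (N * (n * 27 + 61) + 9) 0 fun τ =>
      τ.Stores 1 0 1 (ofSlots (slotsOf (fun x => addVertex t (E x)) W N)) := by
  refine Runs.assign_seq ?_ (by simp)
  refine (Runs.forLoop (N := N) (T := n * 27 + 52) (Q := 0)
    (fun x τ => ∃ k R, Table τ (ofSlots (slotsOf (fun x => addVertex t (E x)) W x)) k R)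
    rfl rfl (by simpa using hs.count) ?_ ?_).mono (by simp) (by simp) ?_
  · refine ⟨0, fun _ => ∅, by simp, ?_, ?_, ?_, ?_, ?_, ?_⟩ <;> simp [slotsOf, ofSlots]
  · rintro x hx τ hf hτ ⟨k, R, hT⟩
    have hs' : HasSlots τ E W N :=
      HasSlots.of_frame (σ := σ.setVar 1 (Expr.eval σ (.const 0)))
        ⟨by simpa using hs.count, hs.row, hs.weight⟩ hf rfl rfl rfl
    refine (runs_insertSlot ((hf.1 0 rfl).trans (by simpa using hn))
      ((hf.1 5 rfl).trans (by simpa using ht)) hτ (hs'.row x hx) (hs'.weight x hx) hT).mono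
      le_rfl le_rfl ?_
    rintro ρ ⟨k', R', hT'⟩
    refine ⟨k', R', ?_⟩
    rw [slotsOf_succ, ofSlots_cons]
    exact ⟨by simpa using hT'.count, hT'.row, hT'.code, hT'.pos, hT'.weight, hT'.ne_zero,
      hT'.surj⟩
  · rintro τ ⟨k, R, hT⟩
    exact hT.stores

/-! ### Maximizing the violation over the sets that avoid a vertex -/

/-- Once the vertex `t` is added to all hyperedges, a hyperedge crosses a set `X` that avoids `t` if
and only if it met `X` before. -/
lemma cut_addVertex {E : ℕ → Finset (Fin n)} {W : ℕ → ℕ} {N : ℕ} {t : Fin n} {X : Finset (Fin n)}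
    (ht : t ∉ X) :
    (ofSlots (slotsOf (fun x => addVertex t (E x)) W N)).cut X =
      (ofSlots (slotsOf E W N)).coverage X := by
  induction N with
  | zero => simp [slotsOf, ofSlots, cut, coverage, edges]
  | succ N ih =>
    have : crosses (addVertex t (E N)) X = hits (E N) X := by
      unfold crosses hits
      simp only [Finset.Nonempty, Finset.mem_inter, Finset.mem_sdiff, mem_addVertex]
      have hiff : ((∃ x, (x ∈ E N ∨ (x : ℕ) = t) ∧ x ∈ X) ∧
          ∃ x, (x ∈ E N ∨ (x : ℕ) = t) ∧ x ∉ X) ↔ ∃ x, x ∈ E N ∧ x ∈ X := by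
        constructor
        · rintro ⟨⟨x, hx | hx, hX⟩, -⟩
          · exact ⟨x, hx, hX⟩
          · exact absurd (Fin.ext hx ▸ hX) ht
        · rintro ⟨x, hx, hX⟩
          exact ⟨⟨x, Or.inl hx, hX⟩, t, Or.inr rfl, ht⟩
      exact if_congr hiff rfl rfl
    rw [slotsOf_succ, slotsOf_succ, cut_ofSlots_cons, coverage_ofSlots_cons, ih, this]

/-- Asks the oracle for a set `Z` of maximum violation among the sets that avoid the vertex in
variable `5`, and writes `Z` to array `8` and `p Z` to variable `10`. -/
def queryVertex : Prog :=
  .seq buildGraph (.seq (.store 7 (.const 0) (.var 5) (.const 1))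
    (.seq (.query 1 0 1 6 7 8 10) (.store 7 (.const 0) (.var 5) (.const 0))))

lemma runs_queryVertex (hO : IsMaxOracle p O) {σ : Memory} (hn : σ.var 0 = n) {t : Fin n}
    (ht : σ.var 5 = (t : ℕ)) {E : ℕ → Finset (Fin n)} {W : ℕ → ℕ} {N : ℕ} (hs : HasSlots σ E W N)
    (hK : N ≤ K) (h6 : σ.RowIs 6 0 (∅ : Finset (Fin n))) (h7 : σ.RowIs 7 0 (∅ : Finset (Fin n))) :
    Runs O K queryVertex σ (N * (n * 27 + 61) + 18) 1 fun τ =>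
      ∃ Z : Finset (Fin n), t ∉ Z ∧ τ.RowIs 8 0 Z ∧ τ.var 10 = p Z ∧
        (∀ X : Finset (Fin n), t ∉ X → p X - ((ofSlots (slotsOf E W N)).coverage X : ℤ) ≤
          p Z - ((ofSlots (slotsOf E W N)).coverage Z : ℤ)) ∧
        τ.RowIs 7 0 (∅ : Finset (Fin n)) := by
  refine Runs.seq (runs_buildGraph hn ht hs).frame ?_ (by simp) (by simp)
  rintro τ ⟨hf, hst⟩
  have e5 : τ.var 5 = (t : ℕ) := (hf.1 5 rfl).trans ht
  have a6 : τ.arr 6 = σ.arr 6 := hf.2 6 rfl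
  have a7 : τ.arr 7 = σ.arr 7 := hf.2 7 rfl
  refine Runs.store_seq ?_ (by simp)
  let q : MaxQuery (Fin n) := ⟨ofSlots (slotsOf (fun x => addVertex t (E x)) W N), ∅, {t}⟩
  obtain ⟨⟨-, hZT⟩, hmax, hval⟩ := hO q (by simp [q])
  refine Runs.seq (Runs.query (Φ := fun ρ => ρ =
    (((τ.setCell 7 0 (t : ℕ) 1).setRow 8 (O q).1).setVar 10 (O q).2)) q
    ?_ ?_ ?_ (by simp [q]) ?_ (by simp [e5])) ?_ (by simp) (by simp)
  · obtain ⟨e, h1, h2⟩ := hst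
    refine ⟨e, by simpa using h1, fun i => ⟨fun v => ?_, ?_⟩⟩
    · simpa using (h2 i).1 v
    · simpa using (h2 i).2
  · intro v
    have := h6 v
    simpa [a6, q] using this
  · intro v
    have := h7 v
    simp only [q, Memory.setCell_arr, Expr.eval, e5, a7, this, Finset.mem_singleton]
    by_cases hv : v = t
    · simp [hv]
    · simp [hv, ← Fin.ext_iff]
  · refine (card_edges_ofSlots_le _).trans (le_trans ?_ hK)
    simp [slotsOf]
  · rintro _ rfl
    refine Runs.store ?_ (by simp)
    have htZ : t ∉ (O q).1 := fun h => by
      have := hZT h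
      simp [q] at this
    refine ⟨(O q).1, htZ, fun v => ?_, ?_, fun X hX => ?_, fun v => ?_⟩
    · simp [Memory.setRow, ← Fin.ext_iff]
    · simp [hval]
    · have := hmax X (by simp [q]) (by
        intro v hv
        simp only [q, Finset.mem_compl, Finset.mem_singleton]
        rintro rfl; exact hX hv)
      simpa only [q, cut_addVertex hX, cut_addVertex htZ] using this
    · have := h7 v
      simp only [Memory.setCell_arr, Memory.setVar_arr, Memory.setRow, Expr.eval,
        Memory.setVar_var, Memory.setCell_var, e5, a7, this]
      simp

/-! ### Computing the coverage -/

/-- Writes the coverage of the set in array `8` to variable `11`. -/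
def evalCoverage : Prog :=
  .seq (.assign 11 (.const 0))
    (.forLoop 6 2 (.seq (.assign 12 (.const 0))
      (.seq
        (.forLoop 7 0 (.ite (.and (.eq (.get 2 (.var 6) (.var 7)) (.const 1))
            (.eq (.get 8 (.const 0) (.var 7)) (.const 1)))
          (.assign 12 (.const 1)) .skip))
        (.ite (.eq (.var 12) (.const 1))
          (.assign 11 (.add (.var 11) (.get 3 (.var 6) (.const 0)))) .skip))))

lemma runs_evalCoverage {σ : Memory} (hn : σ.var 0 = n) {E : ℕ → Finset (Fin n)} {W : ℕ → ℕ}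
    {N : ℕ} (hs : HasSlots σ E W N) {Z : Finset (Fin n)} (hZ : σ.RowIs 8 0 Z) :
    Runs O K evalCoverage σ (N * (n * 23 + 28) + 9) 0 fun τ =>
      τ.var 11 = ((ofSlots (slotsOf E W N)).coverage Z : ℤ) := by
  refine Runs.assign_seq ?_ (by simp)
  refine (Runs.forLoop (N := N) (T := n * 23 + 19) (Q := 0)
    (fun x τ => τ.var 11 = ((ofSlots (slotsOf E W x)).coverage Z : ℤ))
    rfl rfl (by simpa using hs.count) (by simp [slotsOf, ofSlots, coverage, edges]) ?_).le
    (by simp) (by simp)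
  intro x hx τ hf hτ hI
  have e0 : τ.var 0 = n := (hf.1 0 rfl).trans (by simpa using hn)
  have a2 : τ.arr 2 = σ.arr 2 := hf.2 2 rfl
  have a3 : τ.arr 3 = σ.arr 3 := hf.2 3 rfl
  have a8 : τ.arr 8 = σ.arr 8 := hf.2 8 rfl
  refine Runs.assign_seq ?_ (by simp)
  refine Runs.seq (Runs.forLoop (N := n) (T := 14) (Q := 0)
    (fun v ρ => ρ.var 12 = if ∃ w ∈ E x, w ∈ Z ∧ (w : ℕ) < v then 1 else 0)
    rfl rfl (by simpa using e0) (by simp) ?_).frame ?_ (by simp) (by simp)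
  · intro v hv ρ hf' hρ hI'
    have e6 : ρ.var 6 = x := (hf'.1 6 rfl).trans (by simpa using hτ)
    have b2 : ρ.arr 2 = σ.arr 2 := (hf'.2 2 rfl).trans a2
    have b8 : ρ.arr 8 = σ.arr 8 := (hf'.2 8 rfl).trans a8
    have r1 := hs.row x hx ⟨v, hv⟩
    have r2 := hZ ⟨v, hv⟩
    simp only at r1 r2
    have hstep : (∃ w ∈ E x, w ∈ Z ∧ (w : ℕ) < v + 1) ↔
        (⟨v, hv⟩ ∈ E x ∧ ⟨v, hv⟩ ∈ Z) ∨ ∃ w ∈ E x, w ∈ Z ∧ (w : ℕ) < v := by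
      constructor
      · rintro ⟨w, h1, h2, h3⟩
        rcases Nat.lt_succ_iff_lt_or_eq.1 h3 with h3 | h3
        · exact Or.inr ⟨w, h1, h2, h3⟩
        · have : w = ⟨v, hv⟩ := Fin.ext h3
          exact Or.inl (this ▸ ⟨h1, h2⟩)
      · rintro (⟨h1, h2⟩ | ⟨w, h1, h2, h3⟩)
        · exact ⟨_, h1, h2, Nat.lt_succ_self v⟩
        · exact ⟨w, h1, h2, by omega⟩
    have hHolds : (ρ.arr 2 (ρ.var 6) (ρ.var 7) = 1 ∧ ρ.arr 8 0 (ρ.var 7) = 1) ↔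
        (⟨v, hv⟩ ∈ E x ∧ ⟨v, hv⟩ ∈ Z) := by
      rw [e6, hρ, b2, b8, r1, r2]
      simp
    refine Runs.ite (fun hb => ?_) (fun hb => ?_) (by simp)
    · refine Runs.assign ?_ (by simp)
      rw [if_pos (hstep.2 (Or.inl (hHolds.1 hb)))]
      simp
    · refine Runs.skip ?_ (by simp)
      simp only [Memory.setVar_var, hstep]
      simp only [Test.Holds, Expr.eval, hHolds] at hb
      simpa [hb] using hI'
  · rintro ρ ⟨hf', hI'⟩
    have e6 : ρ.var 6 = x := (hf'.1 6 rfl).trans (by simpa using hτ)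
    have e11 : ρ.var 11 = τ.var 11 := (hf'.1 11 rfl).trans (by simp)
    have b3 : ρ.arr 3 = σ.arr 3 := (hf'.2 3 rfl).trans a3
    have w3 := hs.weight x hx
    have hiff : (∃ w ∈ E x, w ∈ Z ∧ (w : ℕ) < n) ↔ hits (E x) Z = 1 := by
      rw [hits_eq_one]; simp
    rw [if_congr hiff rfl rfl] at hI'
    have hcov : ((ofSlots (slotsOf E W (x + 1))).coverage Z : ℤ) =
        W x * hits (E x) Z + (ofSlots (slotsOf E W x)).coverage Z := by
      rw [slotsOf_succ, coverage_ofSlots_cons]; push_cast; ring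
    refine Runs.ite (fun hb => ?_) (fun hb => ?_) (by simp)
    · refine Runs.assign ?_ (by simp)
      simp only [Test.Holds, Expr.eval, hI'] at hb
      have h1 : hits (E x) Z = 1 := by by_contra h; simp [h] at hb
      simp [e11, hI, hcov, h1, e6, b3, w3, add_comm]
    · refine Runs.skip ?_ (by simp)
      simp only [Test.Holds, Expr.eval, hI'] at hb
      have h1 : hits (E x) Z = 0 := by
        have := hits_le_one (E x) Z
        by_contra h
        exact hb (by rw [if_pos (by omega)])
      simp [e11, hI, hcov, h1]

/-! ### Lowering the number of merged copies -/

/-- The hyperedges of the slots after slot `N` was set to the union of the slots `i` and `j`. -/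
def mergedE (E : ℕ → Finset (Fin n)) (i j N : ℕ) : ℕ → Finset (Fin n) :=
  Function.update E N (E i ∪ E j)

/-- The weights of the slots after `α` copies have been moved from slots `i` and `j` to slot `N`. -/
def mergedW (W : ℕ → ℕ) (i j N α : ℕ) : ℕ → ℕ := fun x =>
  if x = i then W i - α else if x = j then W j - α else if x = N then α else W x

/-- The slots other than `i` and `j`. -/
def otherSlots (E : ℕ → Finset (Fin n)) (W : ℕ → ℕ) (N i j : ℕ) : Multiset (Finset (Fin n) × ℕ) :=
  (((Multiset.range N).erase i).erase j).map fun x => (E x, W x)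

lemma slotsOf_eq_otherSlots {E : ℕ → Finset (Fin n)} {W : ℕ → ℕ} {N i j : ℕ} (hi : i < N)
    (hj : j < N) (hij : i ≠ j) :
    slotsOf E W N = (E i, W i) ::ₘ (E j, W j) ::ₘ otherSlots E W N i j :=
  slotsOf_eq_cons_cons hi hj hij

lemma slotsOf_merged {E : ℕ → Finset (Fin n)} {W : ℕ → ℕ} {N i j : ℕ} (hi : i < N) (hj : j < N)
    (hij : i ≠ j) (α : ℕ) :
    slotsOf (mergedE E i j N) (mergedW W i j N α) (N + 1) =
      mergeSlots (E i) (E j) (W i) (W j) α (otherSlots E W N i j) := by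
  have hcongr : otherSlots (mergedE E i j N) (mergedW W i j N α) N i j = otherSlots E W N i j := by
    refine Multiset.map_congr rfl fun x hx => ?_
    have hnd := (Multiset.nodup_range N).erase i
    have h1 : x ≠ j := by rintro rfl; exact hnd.notMem_erase hx
    have h2 : x ≠ i := by
      rintro rfl; exact (Multiset.nodup_range N).notMem_erase (Multiset.mem_of_mem_erase hx)
    have h3 : x ≠ N := by
      have := Multiset.mem_range.1 (Multiset.mem_of_mem_erase (Multiset.mem_of_mem_erase hx))
      omega
    simp [mergedE, mergedW, h1, h2, h3]
  rw [slotsOf_succ, slotsOf_eq_otherSlots hi hj hij, hcongr, mergeSlots]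
  have hiN : i ≠ N := hi.ne
  have hjN : j ≠ N := hj.ne
  simp only [mergedE, mergedW, Function.update_self, Function.update_of_ne hiN,
    Function.update_of_ne hjN, if_true, hij.symm, hiN.symm, hjN.symm, if_false]
  rw [Multiset.cons_swap, Multiset.cons_swap (E i ∪ E j, α)]

/-- Writes to variable `d` a vertex that belongs to the set in array `8` and to the hyperedge of the
slot whose number is in variable `r`. -/
def findCommon (r d : ℕ) : Prog :=
  .forLoop 7 0 (.ite (.and (.eq (.get 2 (.var r) (.var 7)) (.const 1))
      (.eq (.get 8 (.const 0) (.var 7)) (.const 1)))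
    (.assign d (.var 7)) .skip)

lemma runs_findCommon {r d : ℕ} (hr : r ≠ d ∧ r ≠ 7) (hd : d ≠ 0 ∧ d ≠ 7) {σ : Memory}
    (hn : σ.var 0 = n) {X Z : Finset (Fin n)} (hX : σ.RowIs 2 (σ.var r) X) (hZ : σ.RowIs 8 0 Z)
    (hne : (X ∩ Z).Nonempty) :
    Runs O K (findCommon r d) σ (n * 23 + 7) 0 fun τ => ∃ u ∈ X, u ∈ Z ∧ τ.var d = (u : ℕ) := by
  refine (Runs.forLoop (N := n) (T := 14) (Q := 0)
    (fun v τ => (∃ u ∈ X, u ∈ Z ∧ (u : ℕ) < v) → ∃ u ∈ X, u ∈ Z ∧ τ.var d = (u : ℕ))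
    (by simp [Prog.writesVar, hd.2.symm]) (by simp [Prog.forLoop, Prog.writesVar, hd.1.symm]) hn
    (by simp) ?_).mono (by simp) (by simp) ?_
  · intro v hv τ hf hτ hI
    have er : τ.var r = σ.var r := hf.1 r (by simp [Prog.forLoop, Prog.writesVar, hr])
    have a2 : τ.arr 2 = σ.arr 2 := hf.2 2 rfl
    have a8 : τ.arr 8 = σ.arr 8 := hf.2 8 rfl
    have hHolds : (τ.arr 2 (τ.var r) (τ.var 7) = 1 ∧ τ.arr 8 0 (τ.var 7) = 1) ↔
        (⟨v, hv⟩ ∈ X ∧ ⟨v, hv⟩ ∈ Z) := by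
      have r1 := hX ⟨v, hv⟩
      have r2 := hZ ⟨v, hv⟩
      simp only at r1 r2
      rw [er, hτ, a2, a8, r1, r2]
      simp
    refine Runs.ite (fun hb => ?_) (fun hb => ?_) (by simp)
    · refine Runs.assign ?_ (by simp)
      intro _
      exact ⟨⟨v, hv⟩, (hHolds.1 hb).1, (hHolds.1 hb).2, by simp [hd.2, hτ]⟩
    · refine Runs.skip ?_ (by simp)
      rintro ⟨u, hu, huZ, huv⟩
      rcases Nat.lt_succ_iff_lt_or_eq.1 huv with huv | huv
      · obtain ⟨u', h⟩ := hI ⟨u, hu, huZ, huv⟩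
        exact ⟨u', by simpa [hd.2] using h⟩
      · have : u = ⟨v, hv⟩ := Fin.ext huv
        exact absurd (hHolds.2 (this ▸ ⟨hu, huZ⟩)) hb
  · intro τ hI
    obtain ⟨u, hu⟩ := hne
    exact hI ⟨u, (Finset.mem_inter.1 hu).1, (Finset.mem_inter.1 hu).2, u.isLt⟩

/-- If the set in array `8` is violated, then the number of merged copies is lowered by the
violation `var 10 - var 11`, and variables `13` and `14` get a vertex of this set in slot `i` and in
slot `j`. Variable `17` records that this has happened. -/
def lowerCopies : Prog :=
  .ite (.le (.var 10) (.var 11)) .skip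
    (.seq (.store 3 (.var 3) (.const 0)
        (.add (.get 3 (.var 3) (.const 0)) (.sub (.var 10) (.var 11))))
      (.seq (.store 3 (.var 4) (.const 0)
          (.add (.get 3 (.var 4) (.const 0)) (.sub (.var 10) (.var 11))))
        (.seq (.store 3 (.sub (.var 2) (.const 1)) (.const 0)
            (.sub (.get 3 (.sub (.var 2) (.const 1)) (.const 0)) (.sub (.var 10) (.var 11))))
          (.seq (findCommon 3 13) (.seq (findCommon 4 14) (.assign 17 (.const 1)))))))

lemma runs_lowerCopies {σ : Memory} (hn : σ.var 0 = n) {E : ℕ → Finset (Fin n)} {W : ℕ → ℕ}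
    {N i j α : ℕ} (hi : i < N) (hj : j < N) (hij : i ≠ j) (hαi : α ≤ W i) (hαj : α ≤ W j)
    (h3 : σ.var 3 = i) (h4 : σ.var 4 = j)
    (hs : HasSlots σ (mergedE E i j N) (mergedW W i j N α) (N + 1)) {Z : Finset (Fin n)}
    (hZ : σ.RowIs 8 0 Z)
    (hviol : σ.var 11 < σ.var 10 →
      σ.var 10 - σ.var 11 ≤ α ∧ (E i ∩ Z).Nonempty ∧ (E j ∩ Z).Nonempty) :
    Runs O K lowerCopies σ (n * 46 + 60) 0 fun τ =>
      (σ.var 10 ≤ σ.var 11 → τ = σ) ∧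
      (σ.var 11 < σ.var 10 →
        HasSlots τ (mergedE E i j N) (mergedW W i j N (α - (σ.var 10 - σ.var 11).toNat)) (N + 1) ∧
        τ.var 17 = 1 ∧ (∃ u ∈ E i, u ∈ Z ∧ τ.var 13 = (u : ℕ)) ∧
        ∃ x ∈ E j, x ∈ Z ∧ τ.var 14 = (x : ℕ)) := by
  refine Runs.ite (fun hb => ?_) (fun hb => ?_) (by simp)
  · refine Runs.skip ?_ (by simp)
    simp only [Test.Holds, Expr.eval] at hb
    exact ⟨fun _ => rfl, fun h => absurd hb (not_le.2 h)⟩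
  · simp only [Test.Holds, Expr.eval, not_le] at hb
    obtain ⟨hβ, hneI, hneJ⟩ := hviol hb
    have h2 := hs.count
    have wi := hs.weight i (by omega)
    have wj := hs.weight j (by omega)
    have wN := hs.weight N (by omega)
    have hiN : i ≠ N := hi.ne
    have hjN : j ≠ N := hj.ne
    have hN1 : ((N + 1 : ℕ) : ℤ) - 1 = N := by push_cast; ring
    simp only [mergedW, if_true, hij.symm, hiN.symm, hjN.symm, if_false] at wi wj wN
    refine Runs.store_seq ?_ (by simp)
    refine Runs.store_seq ?_ (by simp)
    refine Runs.store_seq ?_ (by simp)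
    set ρ := Memory.setCell _ _ _ _ _ with hρ
    have ρv : ρ.var = σ.var := rfl
    have ρ2 : ρ.arr 2 = σ.arr 2 := by
      funext a b; simp [hρ]
    have ρ8 : ρ.arr 8 = σ.arr 8 := by
      funext a b; simp [hρ]
    have ρs : HasSlots ρ (mergedE E i j N)
        (mergedW W i j N (α - (σ.var 10 - σ.var 11).toNat)) (N + 1) := by
      refine ⟨h2, fun x hx v => ?_, fun x hx => ?_⟩
      · rw [ρ2]; exact hs.row x hx v
      · have hw := hs.weight x hx
        simp only [hρ, Memory.setCell_arr, Memory.setCell_var, Expr.eval, h2, h3, h4, hN1, wi, wj,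
          wN, mergedW, Nat.cast_inj] at hw ⊢
        by_cases hxi : x = i
        · subst hxi
          simp [hij, hiN]
          omega
        · by_cases hxj : x = j
          · subst hxj
            simp [hxi, hjN]
            omega
          · by_cases hxN : x = N
            · subst hxN
              simp [hxi, hxj]
              omega
            · simpa [hxi, hxj, hxN] using hw
    have hEi : mergedE E i j N i = E i := Function.update_of_ne hiN _ _
    have hEj : mergedE E i j N j = E j := Function.update_of_ne hjN _ _
    refine Runs.seq (runs_findCommon (by decide) (by decide) (by rw [ρv]; exact hn)
      (by rw [ρv, h3, ← hEi]; exact ρs.row i (by omega)) (fun v => by rw [ρ8]; exact hZ v)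
      hneI).frame ?_ (by simp; omega) (by simp)
    rintro τ ⟨hf, hu⟩
    have τs : HasSlots τ (mergedE E i j N)
        (mergedW W i j N (α - (σ.var 10 - σ.var 11).toNat)) (N + 1) := ρs.of_frame hf rfl rfl rfl
    refine Runs.seq (runs_findCommon (by decide) (by decide)
      ((hf.1 0 rfl).trans (by rw [ρv]; exact hn))
      (by rw [hf.1 4 rfl, ρv, h4, ← hEj]; exact τs.row j (by omega))
      (fun v => by rw [hf.2 8 rfl, ρ8]; exact hZ v) hneJ).frame ?_ (by simp; omega) (by simp)
    rintro π ⟨hf', hx⟩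
    have πs : HasSlots π (mergedE E i j N)
        (mergedW W i j N (α - (σ.var 10 - σ.var 11).toNat)) (N + 1) := τs.of_frame hf' rfl rfl rfl
    refine Runs.assign ?_ (by simp; omega)
    refine ⟨fun h => absurd hb (not_lt.2 h), fun _ => ⟨⟨by simpa using πs.count, πs.row, πs.weight⟩,
      by simp, ?_, ?_⟩⟩
    · obtain ⟨u, h1, h2, h3⟩ := hu
      exact ⟨u, h1, h2, by simpa [hf'.1 13 rfl] using h3⟩
    · simpa using hx

/-! ### The largest number of copies that can be merged -/

/-- A set of largest violation `β` among the sets that avoid `t` meets both `e` and `f`, and it is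
tight once the number of merged copies is lowered by `β`; no set that avoids `t` is violated then.
-/
lemma lower_copies_of_max {e f : Finset (Fin n)} {a b α : ℕ} {r : Multiset (Finset (Fin n) × ℕ)}
    (hweak : (ofSlots ((e, a) ::ₘ (f, b) ::ₘ r)).WeaklyCovers p) (ha : α ≤ a) (hb : α ≤ b)
    {t : Fin n} {Z : Finset (Fin n)}
    (hmax : ∀ X : Finset (Fin n), t ∉ X →
      p X - ((ofSlots (mergeSlots e f a b α r)).coverage X : ℤ) ≤
        p Z - ((ofSlots (mergeSlots e f a b α r)).coverage Z : ℤ)) {β : ℕ} (hβ : 0 < β)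
    (hval : p Z - ((ofSlots (mergeSlots e f a b α r)).coverage Z : ℤ) = β) :
    β ≤ α ∧ (e ∩ Z).Nonempty ∧ (f ∩ Z).Nonempty ∧
      (ofSlots (mergeSlots e f a b (α - β) r)).Tight p Z ∧
      (∀ X, t ∉ X → p X ≤ (ofSlots (mergeSlots e f a b (α - β) r)).coverage X) ∧
      ∀ X, p X ≤ (ofSlots (mergeSlots e f a b α r)).coverage X →
        p X ≤ (ofSlots (mergeSlots e f a b (α - β) r)).coverage X := by
  have hbool : ∀ X, hits e X * hits f X = 0 ∨
      (hits e X * hits f X = 1 ∧ hits e X = 1 ∧ hits f X = 1) := by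
    intro X
    have h1 := hits_le_one e X
    have h2 := hits_le_one f X
    interval_cases hits e X <;> interval_cases hits f X <;> simp
  have c1 := coverage_mergeSlots (e := e) (f := f) (r := r) ha hb
  have c2 := coverage_mergeSlots (e := e) (f := f) (r := r) ((Nat.sub_le α β).trans ha)
    ((Nat.sub_le α β).trans hb)
  have hZ : hits e Z * hits f Z = 1 ∧ hits e Z = 1 ∧ hits f Z = 1 := by
    refine (hbool Z).resolve_left fun h => ?_
    have h1 := c1 Z
    have h2 := hweak Z
    rw [h] at h1
    omega
  have hle : β ≤ α := by
    have h1 := c1 Z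
    have h2 := hweak Z
    rw [hZ.1] at h1
    omega
  refine ⟨hle, hits_eq_one_iff_nonempty.1 hZ.2.1, hits_eq_one_iff_nonempty.1 hZ.2.2, ?_,
    fun X hX => ?_, fun X hX => ?_⟩
  · have h1 := c1 Z
    have h2 := c2 Z
    rw [hZ.1] at h1 h2
    unfold Tight
    omega
  · have h1 := c1 X
    have h2 := c2 X
    have h3 := hmax X hX
    have h4 := hweak X
    rcases hbool X with h | ⟨h, -⟩ <;> rw [h] at h1 h2 <;> omega
  · have h1 := c1 X
    have h2 := c2 X
    rcases hbool X with h | ⟨h, -⟩ <;> rw [h] at h1 h2 <;> omega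

/-! ### Starting a merging step -/

/-- Appends the union of the slots `i` and `j` as a new slot and moves to it as many copies as their
weights allow. -/
def startMerge : Prog :=
  .seq
    (.ite (.le (.get 3 (.var 3) (.const 0)) (.get 3 (.var 4) (.const 0)))
      (.store 3 (.var 2) (.const 0) (.get 3 (.var 3) (.const 0)))
      (.store 3 (.var 2) (.const 0) (.get 3 (.var 4) (.const 0))))
    (.seq
      (.forLoop 7 0 (.store 2 (.var 2) (.var 7)
        (.add (.get 2 (.var 3) (.var 7)) (.get 2 (.var 4) (.var 7)))))
      (.seq (.store 3 (.var 3) (.const 0)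
          (.sub (.get 3 (.var 3) (.const 0)) (.get 3 (.var 2) (.const 0))))
        (.seq (.store 3 (.var 4) (.const 0)
            (.sub (.get 3 (.var 4) (.const 0)) (.get 3 (.var 2) (.const 0))))
          (.seq (.assign 2 (.add (.var 2) (.const 1))) (.assign 17 (.const 0))))))

lemma runs_startMerge {σ : Memory} (hn : σ.var 0 = n) {E : ℕ → Finset (Fin n)} {W : ℕ → ℕ}
    {N i j : ℕ} (hi : i < N) (hj : j < N) (hij : i ≠ j) (h3 : σ.var 3 = i) (h4 : σ.var 4 = j)
    (hs : HasSlots σ E W N) (hdisj : Disjoint (E i) (E j)) :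
    Runs O K startMerge σ (n * 19 + 60) 0 fun τ =>
      HasSlots τ (mergedE E i j N) (mergedW W i j N (min (W i) (W j))) (N + 1) ∧ τ.var 17 = 0 := by
  have h2 := hs.count
  have wi := hs.weight i hi
  have wj := hs.weight j hj
  have hiN : i ≠ N := hi.ne
  have hjN : j ≠ N := hj.ne
  refine Runs.seq (T₁ := 16) (Q₁ := 0)
    (Φ := fun τ => τ = σ.setCell 3 N 0 (min (W i) (W j) : ℕ)) ?_ ?_ (by simp) (by simp)
  · refine Runs.ite (fun hb => ?_) (fun hb => ?_) (by simp)
    · simp only [Test.Holds, Expr.eval, h3, h4, wi, wj, Nat.cast_le] at hb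
      exact Runs.store (by simp [h2, h3, wi, min_eq_left hb]) (by simp)
    · simp only [Test.Holds, Expr.eval, h3, h4, wi, wj, Nat.cast_le, not_le] at hb
      exact Runs.store (by simp [h2, h4, wj, min_eq_right hb.le]) (by simp)
  rintro _ rfl
  refine Runs.seq (Runs.forLoop (N := n) (T := 10) (Q := 0)
    (fun v τ => (∀ u : Fin n, (u : ℕ) < v → τ.arr 2 N (u : ℕ) = if u ∈ E i ∪ E j then 1 else 0) ∧
      ∀ a b, a ≠ (N : ℤ) → τ.arr 2 a b = σ.arr 2 a b)
    rfl rfl (by simpa using hn) (by simp) ?_).frame ?_ (by simp) (by simp)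
  · rintro v hv τ hf hτ ⟨hI, hI'⟩
    have e2 : τ.var 2 = N := (hf.1 2 rfl).trans h2
    have e3 : τ.var 3 = i := (hf.1 3 rfl).trans h3
    have e4 : τ.var 4 = j := (hf.1 4 rfl).trans h4
    refine Runs.store ?_ (by simp)
    refine ⟨fun u hu => ?_, fun a b ha => ?_⟩
    · simp only [Memory.setVar_arr, Memory.setCell_arr, Expr.eval, e2, e3, e4, hτ]
      by_cases huv : (u : ℕ) = v
      · have r1 := hs.row i hi u
        have r2 := hs.row j hj u
        have r3 : u ∈ E i → u ∉ E j := fun h => Finset.disjoint_left.1 hdisj h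
        rw [if_pos (by simp [huv]), hI' _ _ (by exact_mod_cast hiN),
          hI' _ _ (by exact_mod_cast hjN), ← huv, r1, r2]
        simp only [Finset.mem_union]
        split_ifs <;> simp_all
      · rw [if_neg (by omega)]
        exact hI u (by omega)
    · simp [e2, ha, hI']
  · rintro τ ⟨hf, hI, hI'⟩
    have e2 : τ.var 2 = N := (hf.1 2 rfl).trans h2
    have e3 : τ.var 3 = i := (hf.1 3 rfl).trans h3
    have e4 : τ.var 4 = j := (hf.1 4 rfl).trans h4
    have a3 : ∀ a b, τ.arr 3 a b = if a = (N : ℤ) ∧ b = 0 then ((min (W i) (W j) : ℕ) : ℤ)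
        else σ.arr 3 a b := by
      intro a b; rw [hf.2 3 rfl]; simp
    refine Runs.store_seq ?_ (by simp)
    refine Runs.store_seq ?_ (by simp)
    refine Runs.assign_seq ?_ (by simp)
    refine Runs.assign ?_ (by simp)
    refine ⟨⟨by simp [e2], fun x hx u => ?_, fun x hx => ?_⟩, by simp⟩
    · simp only [Memory.setVar_arr, Memory.setCell_arr, mergedE]
      by_cases hxN : x = N
      · subst hxN
        simpa using hI u u.isLt
      · have hxN' : (x : ℤ) ≠ N := by exact_mod_cast hxN
        simpa [Function.update_of_ne hxN, hI' _ _ hxN'] using hs.row x (by omega) u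
    · simp only [Memory.setVar_arr, Memory.setCell_arr, Memory.setCell_var, Expr.eval, e2, e3, e4,
        a3, mergedW, Nat.cast_inj]
      by_cases hxi : x = i
      · subst hxi
        simp [hij, hiN, wi]
      · by_cases hxj : x = j
        · subst hxj
          simp [hxi, hjN, hiN.symm, wj]
        · by_cases hxN : x = N
          · subst hxN
            simp [hxi, hxj]
          · simpa [hxi, hxj, hxN] using hs.weight x (by omega)

lemma HasSlots.setVar {σ : Memory} {E : ℕ → Finset (Fin n)} {W : ℕ → ℕ} {N : ℕ}
    (h : HasSlots σ E W N) {x : ℕ} (hx : x ≠ 2) (t : ℤ) : HasSlots (σ.setVar x t) E W N :=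
  ⟨by simpa [hx.symm] using h.count, h.row, h.weight⟩

/-! ### Finding the number of copies -/

/-- Lowers the number of merged copies until no set is violated that avoids some vertex. -/
def findCopies : Prog := .forLoop 5 0 (.seq queryVertex (.seq evalCoverage lowerCopies))

/-- The time for one vertex in `findCopies`, with `N + 1` slots. -/
def vertexTime (n N : ℕ) : ℕ :=
  (N + 1) * (n * 27 + 61) + 18 + ((N + 1) * (n * 23 + 28) + 9) + (n * 46 + 60)

/-- After the loop, the number `α` of merged copies keeps the weak cover. It is the smaller of the
two weights, or a tight set that meets both hyperedges contains the vertices in variables `13` and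
`14`. -/
lemma runs_findCopies (hO : IsMaxOracle p O) (hsymm : SymmetricSetFunction p) {σ : Memory}
    (hn : σ.var 0 = n) {E : ℕ → Finset (Fin n)} {W : ℕ → ℕ} {N i j : ℕ} (hi : i < N) (hj : j < N)
    (hij : i ≠ j) (h3 : σ.var 3 = i) (h4 : σ.var 4 = j) (hK : N + 1 ≤ K)
    (hweak : (ofSlots (slotsOf E W N)).WeaklyCovers p)
    (h6 : σ.RowIs 6 0 (∅ : Finset (Fin n))) (h7 : σ.RowIs 7 0 (∅ : Finset (Fin n)))
    (hs : HasSlots σ (mergedE E i j N) (mergedW W i j N (min (W i) (W j))) (N + 1))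
    (h17 : σ.var 17 = 0) :
    Runs O K findCopies σ (n * (vertexTime n N + 9) + 7) n fun τ =>
      τ.RowIs 7 0 (∅ : Finset (Fin n)) ∧ ∃ α, α ≤ W i ∧ α ≤ W j ∧
        HasSlots τ (mergedE E i j N) (mergedW W i j N α) (N + 1) ∧
        (ofSlots (mergeSlots (E i) (E j) (W i) (W j) α (otherSlots E W N i j))).WeaklyCovers p ∧
        ((τ.var 17 = 0 ∧ α = min (W i) (W j)) ∨ (τ.var 17 = 1 ∧ ∃ u ∈ E i, ∃ x ∈ E j, ∃ Z,
          u ∈ Z ∧ x ∈ Z ∧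
          (ofSlots (mergeSlots (E i) (E j) (W i) (W j) α (otherSlots E W N i j))).Tight p Z ∧
          τ.var 13 = (u : ℕ) ∧ τ.var 14 = (x : ℕ))) := by
  rw [slotsOf_eq_otherSlots hi hj hij] at hweak
  have hslots := slotsOf_merged (E := E) (W := W) hi hj hij
  set M : ℕ → WHypergraph (Fin n) := fun α =>
    ofSlots (mergeSlots (E i) (E j) (W i) (W j) α (otherSlots E W N i j)) with hM
  refine (Runs.forLoop (N := n) (T := vertexTime n N) (Q := 1)
    (fun t τ => τ.RowIs 7 0 (∅ : Finset (Fin n)) ∧ ∃ α, α ≤ W i ∧ α ≤ W j ∧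
        HasSlots τ (mergedE E i j N) (mergedW W i j N α) (N + 1) ∧
        (∀ X, (∃ v : Fin n, (v : ℕ) < t ∧ v ∉ X) → p X ≤ (M α).coverage X) ∧
        ((τ.var 17 = 0 ∧ α = min (W i) (W j)) ∨ (τ.var 17 = 1 ∧ ∃ u ∈ E i, ∃ x ∈ E j, ∃ Z,
          u ∈ Z ∧ x ∈ Z ∧ (M α).Tight p Z ∧ τ.var 13 = (u : ℕ) ∧ τ.var 14 = (x : ℕ))))
    rfl rfl hn ?_ ?_).mono le_rfl (by simp) ?_
  · exact ⟨h7, _, min_le_left _ _, min_le_right _ _, hs.setVar (by decide) _, by simp,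
      Or.inl ⟨by simpa using h17, rfl⟩⟩
  · rintro t ht τ hf hτ ⟨h7', α, hαi, hαj, hτs, hcov, hflag⟩
    have a6 : τ.RowIs 6 0 (∅ : Finset (Fin n)) := fun v => by rw [hf.2 6 rfl]; exact h6 v
    have e0 : τ.var 0 = n := (hf.1 0 rfl).trans hn
    have e3 : τ.var 3 = i := (hf.1 3 rfl).trans h3
    have e4 : τ.var 4 = j := (hf.1 4 rfl).trans h4
    have hV : (N + 1) * (n * 27 + 61) + 18 + ((N + 1) * (n * 23 + 28) + 9) + (n * 46 + 60) =
      vertexTime n N := rfl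
    refine Runs.seq (runs_queryVertex hO e0 (t := ⟨t, ht⟩) hτ hτs hK a6 h7').frame ?_ (by omega)
      le_rfl
    rintro ρ ⟨hf1, Z, htZ, hZ, hz, hmax, hρ7⟩
    have ρs := hτs.of_frame hf1 rfl rfl rfl
    refine Runs.seq (runs_evalCoverage ((hf1.1 0 rfl).trans e0) ρs hZ).frame ?_ (by omega) (by simp)
    rintro π ⟨hf2, hb⟩
    have πs := ρs.of_frame hf2 rfl rfl rfl
    have πZ : π.RowIs 8 0 Z := fun v => by rw [hf2.2 8 rfl]; exact hZ v
    have πz : π.var 10 = p Z := (hf2.1 10 rfl).trans hz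
    rw [hslots] at hb
    simp only [hslots] at hmax
    change π.var 11 = ((M α).coverage Z : ℤ) at hb
    have hlow : ∀ h : π.var 11 < π.var 10, _ := fun h =>
      lower_copies_of_max hweak hαi hαj hmax (β := (π.var 10 - π.var 11).toNat) (by omega) (by
        change p Z - ((M α).coverage Z : ℤ) = _
        omega)
    refine ((runs_lowerCopies ((hf2.1 0 rfl).trans ((hf1.1 0 rfl).trans e0)) hi hj hij hαi hαj
      ((hf2.1 3 rfl).trans ((hf1.1 3 rfl).trans e3)) ((hf2.1 4 rfl).trans ((hf1.1 4 rfl).trans e4))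
      πs πZ fun h => ?_).frame).mono (by omega) (by simp) ?_
    · obtain ⟨h1, h2, h3, -⟩ := hlow h
      exact ⟨by omega, h2, h3⟩
    · rintro κ ⟨hf3, hno, hyes⟩
      have κ7 : κ.RowIs 7 0 (∅ : Finset (Fin n)) := fun v => by
        rw [hf3.2 7 rfl, hf2.2 7 rfl]; exact hρ7 v
      refine ⟨κ7, ?_⟩
      rcases le_or_gt (π.var 10) (π.var 11) with h | h
      · rw [hno h]
        refine ⟨α, hαi, hαj, πs.setVar (by decide) _, ?_, ?_⟩
        · rintro X ⟨v, hv, hvX⟩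
          rcases Nat.lt_succ_iff_lt_or_eq.1 hv with hv | hv
          · exact hcov X ⟨v, hv, hvX⟩
          · have : v = ⟨t, ht⟩ := Fin.ext hv
            have h5 : _ ≤ _ := hmax X (this ▸ hvX)
            change p X - ((M α).coverage X : ℤ) ≤ p Z - ((M α).coverage Z : ℤ) at h5
            omega
        · have f17 : π.var 17 = τ.var 17 := (hf2.1 17 rfl).trans (hf1.1 17 rfl)
          have f13 : π.var 13 = τ.var 13 := (hf2.1 13 rfl).trans (hf1.1 13 rfl)
          have f14 : π.var 14 = τ.var 14 := (hf2.1 14 rfl).trans (hf1.1 14 rfl)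
          simpa [f17, f13, f14] using hflag
      · obtain ⟨κs, κ17, ⟨u, hu, huZ, κ13⟩, x, hx, hxZ, κ14⟩ := hyes h
        obtain ⟨hβ, -, -, htight, havoid, hmono⟩ := hlow h
        refine ⟨α - (π.var 10 - π.var 11).toNat, by omega, by omega, κs.setVar (by decide) _,
          ?_, ?_⟩
        · rintro X ⟨v, hv, hvX⟩
          rcases Nat.lt_succ_iff_lt_or_eq.1 hv with hv | hv
          · exact hmono X (hcov X ⟨v, hv, hvX⟩)
          · have : v = ⟨t, ht⟩ := Fin.ext hv
            exact havoid X (this ▸ hvX)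
        · exact Or.inr ⟨by simpa using κ17, u, hu, x, hx, Z, huZ, hxZ, htight, by simpa using κ13,
            by simpa using κ14⟩
  · rintro τ ⟨h7', α, hαi, hαj, hτs, hcov, hflag⟩
    refine ⟨h7', α, hαi, hαj, hτs, fun X => ?_, hflag⟩
    by_cases hX : ∃ v, v ∉ X
    · obtain ⟨v, hv⟩ := hX
      exact hcov X ⟨v, v.isLt, hv⟩
    · -- the whole vertex set is never violated, because `p V = p ∅ ≤ 0`
      have hXu : X = Finset.univ := by
        ext v; simp only [Finset.mem_univ, iff_true]; by_contra h; exact hX ⟨v, h⟩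
      have h1 := hweak ∅
      rw [coverage_empty_set] at h1
      have h2 := hsymm X
      rw [hXu, Finset.compl_univ] at h2
      rw [hXu, h2]
      exact h1.trans (by positivity)

/-! ### Deleting the slots that are used up -/

/-- Deletes the slots of weight zero after a merging step. -/
def cleanUp : Prog :=
  .ite (.eq (.get 3 (.sub (.var 2) (.const 1)) (.const 0)) (.const 0))
    (.assign 2 (.sub (.var 2) (.const 1)))
    (.seq (removeSlot 3) (removeSlot 4))

lemma liveSlots_slotsOf_move {E : ℕ → Finset (Fin n)} {W : ℕ → ℕ} {N a : ℕ} (ha : a ≤ N)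
    (hW : W a = 0) : liveSlots (slotsOf E W (N + 1)) =
      liveSlots (slotsOf (Function.update E a (E N)) (Function.update W a (W N)) N) := by
  rw [slotsOf_move ha, liveSlots_cons_of_eq_zero hW]

lemma liveSlots_slotsOf {E : ℕ → Finset (Fin n)} {W : ℕ → ℕ} {N : ℕ} (h : ∀ x < N, 0 < W x) :
    liveSlots (slotsOf E W N) = slotsOf E W N := by
  refine Multiset.filter_eq_self.2 fun x hx => ?_
  obtain ⟨y, hy, rfl⟩ := Multiset.mem_map.1 hx
  exact h y (Multiset.mem_range.1 hy)

/-- How the slots `E'` (of number `N'`) after a merging step of slots `i < j` are related to the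
slots `E` (of number `N`) before. -/
structure Rearranged (E : ℕ → Finset (Fin n)) (N i j : ℕ) (E' : ℕ → Finset (Fin n)) (N' : ℕ) :
    Prop where
  eq_of_lt : ∀ a < j, a ≠ i → E' a = E a
  subset : E i ⊆ E' i
  origin : ∀ b, i ≤ b → b < N' → (∃ c, i ≤ c ∧ c < N ∧ E' b = E c) ∨ E i ⊆ E' b

lemma runs_cleanUp {σ : Memory} (hn : σ.var 0 = n) {E : ℕ → Finset (Fin n)} {W : ℕ → ℕ}
    {N i j α : ℕ} (hij : i < j) (hj : j < N) (h3 : σ.var 3 = i) (h4 : σ.var 4 = j)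
    (hpos : ∀ x < N, 0 < W x)
    (hs : HasSlots σ (mergedE E i j N) (mergedW W i j N α) (N + 1)) :
    Runs O K cleanUp σ (n * 30 + 60) 0 fun τ =>
      (α = 0 → HasSlots τ E W N) ∧
      (0 < α → ∃ E' W' N', HasSlots τ E' W' N' ∧ Rearranged E N i j E' N' ∧
        slotsOf E' W' N' =
          liveSlots (mergeSlots (E i) (E j) (W i) (W j) α (otherSlots E W N i j))) := by
  have hi : i < N := hij.trans hj
  have h2 := hs.count
  have wN := hs.weight N (by omega)
  have hN1 : ((N + 1 : ℕ) : ℤ) - 1 = N := by push_cast; ring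
  have hWN : mergedW W i j N α N = α := by simp [mergedW, hi.ne', hj.ne']
  have hWi : mergedW W i j N α i = W i - α := by simp [mergedW]
  have hWj : mergedW W i j N α j = W j - α := by simp [mergedW, hij.ne']
  have hWx : ∀ x, x ≠ i → x ≠ j → x ≠ N → mergedW W i j N α x = W x := fun x h1 h2 h3 => by
    simp [mergedW, h1, h2, h3]
  have hEN : mergedE E i j N N = E i ∪ E j := by simp [mergedE]
  have hEx : ∀ x, x ≠ N → mergedE E i j N x = E x := fun x hx => by simp [mergedE, hx]
  rw [hWN] at wN
  refine Runs.ite (fun hb => ?_) (fun hb => ?_) (by simp)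
  · simp only [Test.Holds, Expr.eval, h2, hN1, wN, Nat.cast_eq_zero] at hb
    refine Runs.assign ?_ (by simp)
    refine ⟨fun _ => ⟨by simp [h2], fun x hx v => ?_, fun x hx => ?_⟩, fun h => by omega⟩
    · have := hs.row x (by omega) v
      rwa [hEx x hx.ne] at this
    · have := hs.weight x (by omega)
      have hW0 : mergedW W i j N α x = W x := by
        simp only [mergedW, hb, hx.ne, if_false, Nat.sub_zero]
        split_ifs <;> simp_all
      rwa [hW0] at this
  · simp only [Test.Holds, Expr.eval, h2, hN1, wN, Nat.cast_eq_zero] at hb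
    set E₁ := mergedE E i j N
    set W₁ := mergedW W i j N α
    have hlive : liveSlots (mergeSlots (E i) (E j) (W i) (W j) α (otherSlots E W N i j)) =
        liveSlots (slotsOf E₁ W₁ (N + 1)) := by
      rw [slotsOf_merged hi hj hij.ne]
    rw [hlive]
    refine Runs.seq (runs_removeSlot (by decide) (by decide) hn hs hi.le h3).frame ?_
      (by simp; omega) (by simp)
    rintro τ ⟨hf, hz, hnz⟩
    have e0 : τ.var 0 = n := (hf.1 0 rfl).trans hn
    have e4 : τ.var 4 = j := (hf.1 4 rfl).trans h4
    by_cases hi0 : W₁ i = 0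
    · -- slot `i` is used up, and the union is moved there
      obtain ⟨M, rfl⟩ : ∃ M, N = M + 1 := ⟨N - 1, by omega⟩
      refine (runs_removeSlot (by decide) (by decide) e0 (hz hi0) (by omega) e4).mono
        (by simp; omega) (by simp) ?_
      rintro ρ ⟨hz', hnz'⟩
      refine ⟨fun h => absurd h hb, fun hα => ?_⟩
      have hji : Function.update W₁ i (W₁ (M + 1)) j = W₁ j := Function.update_of_ne hij.ne' _ _
      rw [hji] at hz' hnz'
      by_cases hj0 : W₁ j = 0
      · refine ⟨_, _, _, hz' hj0, ⟨fun a ha hai => ?_, ?_, fun b hb1 hb2 => ?_⟩, ?_⟩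
        · rw [Function.update_of_ne ha.ne, Function.update_of_ne hai, hEx a (by omega)]
        · rw [Function.update_of_ne hij.ne, Function.update_self, hEN]
          exact Finset.subset_union_left
        · by_cases hbj : b = j
          · left
            refine ⟨M, by omega, by omega, ?_⟩
            rw [hbj, Function.update_self, Function.update_of_ne (by omega), hEx M (by omega)]
          · rw [Function.update_of_ne hbj]
            by_cases hbi : b = i
            · right
              rw [hbi, Function.update_self, hEN]
              exact Finset.subset_union_left
            · left
              exact ⟨b, hb1, by omega, by rw [Function.update_of_ne hbi, hEx b (by omega)]⟩
        · rw [liveSlots_slotsOf_move hi.le hi0,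
            liveSlots_slotsOf_move (show j ≤ M by omega) (by rw [hji]; exact hj0)]
          refine (liveSlots_slotsOf fun x hx => ?_).symm
          by_cases hxj : x = j
          · rw [hxj, Function.update_self, Function.update_of_ne (by omega),
              hWx M (by omega) (by omega) (by omega)]
            exact hpos M (by omega)
          · rw [Function.update_of_ne hxj]
            by_cases hxi : x = i
            · rw [hxi, Function.update_self, hWN]; omega
            · rw [Function.update_of_ne hxi, hWx x hxi hxj (by omega)]
              exact hpos x (by omega)
      · refine ⟨_, _, _, hnz' hj0, ⟨fun a ha hai => ?_, ?_, fun b hb1 hb2 => ?_⟩, ?_⟩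
        · rw [Function.update_of_ne hai, hEx a (by omega)]
        · rw [Function.update_self, hEN]
          exact Finset.subset_union_left
        · by_cases hbi : b = i
          · right
            rw [hbi, Function.update_self, hEN]
            exact Finset.subset_union_left
          · left
            exact ⟨b, hb1, by omega, by rw [Function.update_of_ne hbi, hEx b (by omega)]⟩
        · rw [liveSlots_slotsOf_move hi.le hi0]
          refine (liveSlots_slotsOf fun x hx => ?_).symm
          by_cases hxi : x = i
          · rw [hxi, Function.update_self, hWN]; omega
          · rw [Function.update_of_ne hxi]
            by_cases hxj : x = j
            · rw [hxj]; omega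
            · rw [hWx x hxi hxj (by omega)]
              exact hpos x (by omega)
    · refine (runs_removeSlot (by decide) (by decide) e0 (hnz hi0) (by omega) e4).mono
        (by simp; omega) (by simp) ?_
      rintro ρ ⟨hz', hnz'⟩
      refine ⟨fun h => absurd h hb, fun hα => ?_⟩
      by_cases hj0 : W₁ j = 0
      · -- slot `j` is used up, and the union is moved there
        refine ⟨_, _, _, hz' hj0, ⟨fun a ha hai => ?_, ?_, fun b hb1 hb2 => ?_⟩, ?_⟩
        · rw [Function.update_of_ne ha.ne, hEx a (by omega)]
        · rw [Function.update_of_ne hij.ne, hEx i (by omega)]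
        · by_cases hbj : b = j
          · right
            rw [hbj, Function.update_self, hEN]
            exact Finset.subset_union_left
          · left
            exact ⟨b, hb1, by omega, by rw [Function.update_of_ne hbj, hEx b (by omega)]⟩
        · rw [liveSlots_slotsOf_move hj.le hj0]
          refine (liveSlots_slotsOf fun x hx => ?_).symm
          by_cases hxj : x = j
          · rw [hxj, Function.update_self, hWN]; omega
          · rw [Function.update_of_ne hxj]
            by_cases hxi : x = i
            · rw [hxi]; omega
            · rw [hWx x hxi hxj (by omega)]
              exact hpos x (by omega)
      · refine ⟨_, _, _, hnz' hj0, ⟨fun a ha hai => ?_, ?_, fun b hb1 hb2 => ?_⟩, ?_⟩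
        · rw [hEx a (by omega)]
        · rw [hEx i (by omega)]
        · by_cases hbN : b = N
          · right
            rw [hbN, hEN]
            exact Finset.subset_union_left
          · left
            exact ⟨b, hb1, by omega, by rw [hEx b hbN]⟩
        · refine (liveSlots_slotsOf fun x hx => ?_).symm
          by_cases hxj : x = j
          · rw [hxj]; omega
          · by_cases hxi : x = i
            · rw [hxi]; omega
            · by_cases hxN : x = N
              · rw [hxN, hWN]; omega
              · rw [hWx x hxi hxj hxN]
                exact hpos x (by omega)

/-! ### A merging step -/

/-- Merges as many copies of the slots `i` and `j` as possible. If a tight set stops this, then the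
pair in variables `13` and `14` of a vertex of slot `i` and a vertex of slot `j` in a common tight
set is marked in array `9`. -/
def mergePair : Prog :=
  .seq startMerge (.seq findCopies (.seq
    (.ite (.eq (.var 17) (.const 1)) (.store 9 (.var 13) (.var 14) (.const 1)) .skip) cleanUp))

/-- The invariant of the main loop. The slots before slot `i` cannot be merged with any later slot,
and slot `i` cannot be merged with the slots between `i` and `j`. Vertices marked as a pair lie in a
common tight set. -/
structure Inv (H₀ : WHypergraph (Fin n)) (p : Finset (Fin n) → ℤ) (σ : Memory)
    (E : ℕ → Finset (Fin n)) (W : ℕ → ℕ) (N i j : ℕ) : Prop where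
  size : σ.var 0 = n
  slots : HasSlots σ E W N
  fst : σ.var 3 = i
  snd : σ.var 4 = j
  good : Good H₀ p (slotsOf E W N)
  zero6 : σ.RowIs 6 0 (∅ : Finset (Fin n))
  zero7 : σ.RowIs 7 0 (∅ : Finset (Fin n))
  mark : ∀ u v : Fin n, σ.arr 9 (u : ℕ) (v : ℕ) = 1 →
    ∃ Y, (ofSlots (slotsOf E W N)).Tight p Y ∧ u ∈ Y ∧ v ∈ Y
  lt : i < j
  stuck : ∀ a b, a < b → b < N → a < i ∨ (a = i ∧ b < j) →
    (ofSlots (slotsOf E W N)).Stuck p (E a) (E b)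

/-- The pairs of vertices that are not marked. -/
def unmarked (n : ℕ) (σ : Memory) : Finset (Fin n × Fin n) :=
  Finset.univ.filter fun uv => σ.arr 9 (uv.1 : ℕ) (uv.2 : ℕ) ≠ 1

/-- The time of `mergePair` with `N` slots. -/
def mergeTime (n N : ℕ) : ℕ := n * (vertexTime n N + 9) + n * 49 + 140

/-- Each call of `mergePair` lowers the potential or, if a tight set stops it, marks a new pair. In
the second case it is possible that no copies have been merged. -/
theorem runs_mergePair (hO : IsMaxOracle p O) (hsymm : SymmetricSetFunction p)
    (hskew : SkewSupermodular p) {H₀ : WHypergraph (Fin n)} {σ : Memory}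
    {E : ℕ → Finset (Fin n)} {W : ℕ → ℕ} {N i j : ℕ} (hI : Inv H₀ p σ E W N i j) (hj : j < N)
    (hK : N + 1 ≤ K) (hdisj : Disjoint (E i) (E j)) (hEi : (E i).Nonempty) (hEj : (E j).Nonempty)
    (hun : ∀ u ∈ E i, ∀ v ∈ E j, σ.arr 9 (u : ℕ) (v : ℕ) ≠ 1) :
    Runs O K mergePair σ (mergeTime n N) n fun τ => ∃ E' W' N', Inv H₀ p τ E' W' N' i j ∧
      potential p (slotsOf E' W' N') + (unmarked n τ).card <
        potential p (slotsOf E W N) + (unmarked n σ).card := by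
  have hij := hI.lt
  have hi : i < N := hij.trans hj
  have hWpos : ∀ x < N, 0 < W x := fun x hx =>
    hI.good.pos (E x, W x) (Multiset.mem_map.2 ⟨x, Multiset.mem_range.2 hx, rfl⟩)
  have hT : mergeTime n N = n * (vertexTime n N + 9) + n * 49 + 140 := rfl
  refine Runs.seq (runs_startMerge hI.size hi hj hij.ne hI.fst hI.snd hI.slots hdisj).frame ?_
    (by omega) (by simp)
  rintro τ ⟨hf1, τs, τ17⟩
  refine Runs.seq (runs_findCopies hO hsymm ((hf1.1 0 rfl).trans hI.size) hi hj hij.ne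
    ((hf1.1 3 rfl).trans hI.fst) ((hf1.1 4 rfl).trans hI.snd) hK hI.good.weak
    (fun v => by rw [hf1.2 6 rfl]; exact hI.zero6 v)
    (fun v => by rw [hf1.2 7 rfl]; exact hI.zero7 v) τs τ17).frame ?_ (by omega) (by simp)
  rintro ρ ⟨hf2, ρ7, α, hαi, hαj, ρs, hweak, hflag⟩
  set M := mergeSlots (E i) (E j) (W i) (W j) α (otherSlots E W N i j) with hM
  have hcov := coverage_mergeSlots (e := E i) (f := E j) (r := otherSlots E W N i j) hαi hαj
  rw [← slotsOf_eq_otherSlots hi hj hij.ne, ← hM] at hcov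
  have ρ9 : ρ.arr 9 = σ.arr 9 := (hf2.2 9 rfl).trans (hf1.2 9 rfl)
  -- the marks after this step
  refine Runs.seq (Runs.frame (T := 8) (Q := 0) (Φ := fun π =>
    HasSlots π (mergedE E i j N) (mergedW W i j N α) (N + 1) ∧
      (∀ u v : Fin n, π.arr 9 (u : ℕ) (v : ℕ) = 1 → σ.arr 9 (u : ℕ) (v : ℕ) = 1 ∨
        ∃ Y, (ofSlots M).Tight p Y ∧ u ∈ Y ∧ v ∈ Y) ∧
      (unmarked n π).card ≤ (unmarked n σ).card ∧
      (ρ.var 17 = 1 → (unmarked n π).card < (unmarked n σ).card)) ?_) ?_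
    (by omega) (by simp)
  · rcases hflag with ⟨h17, -⟩ | ⟨h17, u, hu, x, hx, Z, huZ, hxZ, hZ, h13, h14⟩
    · refine Runs.ite (fun hb => ?_) (fun hb => ?_) (by simp)
      · simp [h17] at hb
      · exact Runs.skip ⟨ρs, fun u v h => Or.inl (by rwa [ρ9] at h), by simp [unmarked, ρ9],
          fun h => by omega⟩ (by simp)
    · refine Runs.ite (fun hb => ?_) (fun hb => ?_) (by simp)
      · refine Runs.store ?_ (by simp)
        have hsub : unmarked n (ρ.setCell 9 (u : ℕ) (x : ℕ) 1) ⊂ unmarked n σ := by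
          refine (Finset.ssubset_iff_of_subset fun uv huv => ?_).2 ⟨(u, x), ?_, ?_⟩
          · simp only [unmarked, Finset.mem_filter, Finset.mem_univ, true_and, Memory.setCell_arr,
              ρ9] at huv ⊢
            split_ifs at huv with h
            · exact absurd rfl huv
            · exact huv
          · simpa [unmarked] using hun u hu x hx
          · simp [unmarked]
        simp only [Expr.eval, h13, h14]
        refine ⟨⟨ρs.count, ρs.row, ρs.weight⟩, fun a b h => ?_, Finset.card_le_card hsub.subset,
          fun _ => Finset.card_lt_card hsub⟩
        simp only [Memory.setCell_arr, ρ9] at h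
        split_ifs at h with hab
        · have ha : a = u := Fin.ext (by exact_mod_cast hab.2.1)
          have hb : b = x := Fin.ext (by exact_mod_cast hab.2.2)
          exact Or.inr ⟨Z, hZ, ha ▸ huZ, hb ▸ hxZ⟩
        · exact Or.inl h
      · simp [h17] at hb
  · rintro π ⟨hf3, πs, πmark, πcard, πlt⟩
    have e0 : π.var 0 = n := (hf3.1 0 rfl).trans ((hf2.1 0 rfl).trans ((hf1.1 0 rfl).trans hI.size))
    have e3 : π.var 3 = i := (hf3.1 3 rfl).trans ((hf2.1 3 rfl).trans ((hf1.1 3 rfl).trans hI.fst))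
    have e4 : π.var 4 = j := (hf3.1 4 rfl).trans ((hf2.1 4 rfl).trans ((hf1.1 4 rfl).trans hI.snd))
    have a6 : π.arr 6 = σ.arr 6 := (hf3.2 6 rfl).trans ((hf2.2 6 rfl).trans (hf1.2 6 rfl))
    have a7 : π.arr 7 = ρ.arr 7 := hf3.2 7 rfl
    refine (runs_cleanUp e0 hij hj e3 e4 hWpos πs).frame.mono (by omega) (by simp) ?_
    rintro κ ⟨hf4, κ0, κpos⟩
    have κ9 : κ.arr 9 = π.arr 9 := hf4.2 9 rfl
    have κun : unmarked n κ = unmarked n π := by simp [unmarked, κ9]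
    have κ6 : κ.RowIs 6 0 (∅ : Finset (Fin n)) := fun v => by
      rw [hf4.2 6 rfl, a6]; exact hI.zero6 v
    have κ7 : κ.RowIs 7 0 (∅ : Finset (Fin n)) := fun v => by rw [hf4.2 7 rfl, a7]; exact ρ7 v
    have k0 := (hf4.1 0 rfl).trans e0
    have k3 := (hf4.1 3 rfl).trans e3
    have k4 := (hf4.1 4 rfl).trans e4
    rw [κun]
    rcases Nat.eq_zero_or_pos α with h0 | h0
    · -- nothing has been merged, but a new pair is marked
      have h17 : ρ.var 17 = 1 := by
        rcases hflag with ⟨-, h⟩ | ⟨h, -⟩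
        · have := hWpos i hi
          have := hWpos j hj
          omega
        · exact h
      refine ⟨E, W, N, ⟨k0, κ0 h0, k3, k4, hI.good, κ6, κ7, fun u v h => ?_, hij, hI.stuck⟩,
        Nat.add_lt_add_left (πlt h17) _⟩
      rw [κ9] at h
      rcases πmark u v h with h | ⟨Y, hY, hu, hv⟩
      · exact hI.mark u v h
      · refine ⟨Y, ?_, hu, hv⟩
        have := hcov Y
        rw [h0, zero_mul, add_zero] at this
        unfold Tight at hY ⊢
        omega
    · obtain ⟨E', W', N', κs, hre, hsl⟩ := κpos h0
      have hg := hI.good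
      rw [slotsOf_eq_otherSlots hi hj hij.ne] at hg
      have hmax : α = W i ∨ α = W j ∨ ∃ Z, (ofSlots M).Tight p Z ∧ hits (E i) Z = 1 ∧
          hits (E j) Z = 1 := by
        rcases hflag with ⟨-, h⟩ | ⟨-, u, hu, x, hx, Z, huZ, hxZ, hZ, -⟩
        · omega
        · exact Or.inr (Or.inr ⟨Z, hZ, hits_eq_one_iff_nonempty.2 ⟨u, Finset.mem_inter.2 ⟨hu, huZ⟩⟩,
            hits_eq_one_iff_nonempty.2 ⟨x, Finset.mem_inter.2 ⟨hx, hxZ⟩⟩⟩)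
      obtain ⟨hg', hlt⟩ := hg.merge hskew hdisj hEi hEj h0 hαi hαj hweak hmax
      have hof : ofSlots (slotsOf E' W' N') = ofSlots M := by rw [hsl, ofSlots_liveSlots]
      have htight : ∀ Y, (ofSlots (slotsOf E W N)).Tight p Y →
          (ofSlots (slotsOf E' W' N')).Tight p Y := fun Y hY => by
        rw [hof]
        exact hY.mono hweak (by have := hcov Y; omega)
      refine ⟨E', W', N', ⟨k0, κs, k3, k4, hsl ▸ hg', κ6, κ7, fun u v h => ?_, hij, ?_⟩, ?_⟩
      · rw [κ9] at h
        rcases πmark u v h with h | ⟨Y, hY, hu, hv⟩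
        · obtain ⟨Y, hY, h⟩ := hI.mark u v h
          exact ⟨Y, htight Y hY, h⟩
        · exact ⟨Y, hof ▸ hY, hu, hv⟩
      · rintro a b hab hb (ha | ⟨rfl, hbj⟩)
        · have hEa := hre.eq_of_lt a (by omega) ha.ne
          by_cases hbi : b < i
          · have hEb := hre.eq_of_lt b (by omega) hbi.ne
            exact (hI.stuck a b hab (by omega) (Or.inl ha)).mono htight (Or.inl hEa) (Or.inl hEb)
          · rcases hre.origin b (by omega) hb with ⟨c, hc, hcN, hEb⟩ | hEb
            · exact (hI.stuck a c (by omega) hcN (Or.inl ha)).mono htight (Or.inl hEa) (Or.inl hEb)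
            · exact (hI.stuck a i ha hi (Or.inl ha)).mono htight (Or.inl hEa) (Or.inr ⟨hEi, hEb⟩)
        · have hEb := hre.eq_of_lt b hbj hab.ne'
          exact (hI.stuck a b hab (by omega) (Or.inr ⟨rfl, hbj⟩)).mono htight
            (Or.inr ⟨hEi, hre.subset⟩) (Or.inl hEb)
      · rw [hsl, slotsOf_eq_otherSlots hi hj hij.ne]
        exact Nat.add_lt_add_of_lt_of_le hlt πcard

/-! ### Testing a pair of slots -/

/-- Sets variable `15` to `0` if slot `i` or slot `j` is empty, to `2` if they intersect or contain
a marked pair, and to `1` otherwise. -/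
def checkPair : Prog :=
  .seq (.assign 15 (.const 0)) (.forLoop 7 0 (.forLoop 16 0
    (.ite (.and (.eq (.get 2 (.var 3) (.var 7)) (.const 1))
        (.eq (.get 2 (.var 4) (.var 16)) (.const 1)))
      (.ite (.eq (.var 7) (.var 16)) (.assign 15 (.const 2))
        (.ite (.eq (.get 9 (.var 7) (.var 16)) (.const 1)) (.assign 15 (.const 2))
          (.ite (.eq (.var 15) (.const 0)) (.assign 15 (.const 1)) .skip)))
      .skip)))

/-- The meaning of variable `15` in `checkPair` after the pairs of vertices in `D` have been tested:
`A` is the set of pairs in the product of the two slots, and `B` is the set of those that obstruct a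
merging step. -/
def Scanned (A B D : ℕ → ℕ → Prop) (r : ℤ) : Prop :=
  (r = 2 ∧ ∃ u v, A u v ∧ B u v) ∨
  (r = 1 ∧ (∃ u v, A u v) ∧ ∀ u v, D u v → A u v → ¬ B u v) ∨
  (r = 0 ∧ ∀ u v, D u v → ¬ A u v)

lemma Scanned.congr {A B D D' : ℕ → ℕ → Prop} {r : ℤ} (h : Scanned A B D r)
    (hD : ∀ u v, D' u v → A u v → D u v) : Scanned A B D' r := by
  rcases h with h | ⟨h, h', h''⟩ | ⟨h, h'⟩
  · exact Or.inl h
  · exact Or.inr (Or.inl ⟨h, h', fun u v hd ha => h'' u v (hD u v hd ha) ha⟩)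
  · exact Or.inr (Or.inr ⟨h, fun u v hd ha => h' u v (hD u v hd ha) ha⟩)

lemma runs_checkPair {σ : Memory} (hn : σ.var 0 = n) {E : ℕ → Finset (Fin n)} {W : ℕ → ℕ}
    {N i j : ℕ} (hi : i < N) (hj : j < N) (h3 : σ.var 3 = i) (h4 : σ.var 4 = j)
    (hs : HasSlots σ E W N) :
    Runs O K checkPair σ (n * (n * 37 + 16) + 9) 0 fun τ =>
      (τ.var 15 = 1 → (E i).Nonempty ∧ (E j).Nonempty ∧ Disjoint (E i) (E j) ∧
        ∀ u ∈ E i, ∀ v ∈ E j, σ.arr 9 (u : ℕ) (v : ℕ) ≠ 1) ∧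
      (τ.var 15 ≠ 1 → (E i).Nonempty → (E j).Nonempty → Disjoint (E i) (E j) →
        ∃ u ∈ E i, ∃ v ∈ E j, σ.arr 9 (u : ℕ) (v : ℕ) = 1) := by
  set A : ℕ → ℕ → Prop := fun u v => (∃ a ∈ E i, (a : ℕ) = u) ∧ ∃ b ∈ E j, (b : ℕ) = v with hA
  set B : ℕ → ℕ → Prop := fun u v => u = v ∨ σ.arr 9 u v = 1 with hB
  refine Runs.assign_seq ?_ (by simp)
  refine (Runs.forLoop (N := n) (T := n * 37 + 7) (Q := 0)
    (fun u τ => Scanned A B (fun a _ => a < u) (τ.var 15))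
    rfl rfl (by simpa using hn) (Or.inr (Or.inr ⟨by simp, by simp⟩)) ?_).mono (by simp) (by simp) ?_
  · rintro u hu τ hf hτ hS
    have e0 : τ.var 0 = n := (hf.1 0 rfl).trans (by simpa using hn)
    have e3 : τ.var 3 = i := (hf.1 3 rfl).trans (by simpa using h3)
    have e4 : τ.var 4 = j := (hf.1 4 rfl).trans (by simpa using h4)
    have a2 : τ.arr 2 = σ.arr 2 := hf.2 2 rfl
    have a9 : τ.arr 9 = σ.arr 9 := hf.2 9 rfl
    refine (Runs.forLoop (N := n) (T := 28) (Q := 0)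
      (fun v τ => Scanned A B (fun a b => a < u ∨ (a = u ∧ b < v)) (τ.var 15))
      rfl rfl e0 ?_ ?_).mono (by simp) (by simp) ?_
    · exact hS.congr (by simp +contextual)
    · rintro v hv ρ hf' hρ hS'
      have ρ3 : ρ.var 3 = i := (hf'.1 3 rfl).trans e3
      have ρ4 : ρ.var 4 = j := (hf'.1 4 rfl).trans e4
      have ρ7 : ρ.var 7 = u := (hf'.1 7 rfl).trans hτ
      have ρ2 : ρ.arr 2 = σ.arr 2 := (hf'.2 2 rfl).trans a2
      have ρ9 : ρ.arr 9 = σ.arr 9 := (hf'.2 9 rfl).trans a9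
      have r1 := hs.row i hi ⟨u, hu⟩
      have r2 := hs.row j hj ⟨v, hv⟩
      simp only at r1 r2
      have hAuv : (⟨u, hu⟩ : Fin n) ∈ E i ∧ (⟨v, hv⟩ : Fin n) ∈ E j ↔ A u v := by
        constructor
        · exact fun h => ⟨⟨_, h.1, rfl⟩, ⟨_, h.2, rfl⟩⟩
        · rintro ⟨⟨a, ha, rfl⟩, ⟨b, hb, rfl⟩⟩
          exact ⟨ha, hb⟩
      have hD : ∀ a b, (a < u ∨ a = u ∧ b < v + 1) →
          (a < u ∨ a = u ∧ b < v) ∨ (a = u ∧ b = v) := fun a b => by omega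
      refine Runs.ite (fun hb => ?_) (fun hb => ?_) (by simp)
      · have hin : A u v := by
          simp only [Test.Holds, Expr.eval, ρ3, ρ4, ρ7, hρ, ρ2, r1, r2] at hb
          rw [← hAuv]
          constructor <;> by_contra h <;> simp [h] at hb
        have h2 : B u v → Scanned A B (fun a b => a < u ∨ (a = u ∧ b < v + 1)) 2 :=
          fun h => Or.inl ⟨rfl, u, v, hin, h⟩
        refine Runs.ite (fun hb => ?_) (fun hne => ?_) (by simp)
        · simp only [Test.Holds, Expr.eval, ρ7, hρ, Nat.cast_inj] at hb
          exact Runs.assign (by simpa using h2 (Or.inl hb)) (by simp)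
        refine Runs.ite (fun hb => ?_) (fun hmk => ?_) (by simp)
        · simp only [Test.Holds, Expr.eval, ρ7, hρ, ρ9] at hb
          exact Runs.assign (by simpa using h2 (Or.inr hb)) (by simp)
        simp only [Test.Holds, Expr.eval, ρ7, hρ, ρ9, Nat.cast_inj] at hne hmk
        have hnB : ¬ B u v := by simp only [hB]; tauto
        refine Runs.ite (fun hb => ?_) (fun hb => ?_) (by simp)
        · simp only [Test.Holds, Expr.eval] at hb
          refine Runs.assign ?_ (by simp)
          simp only [Memory.setVar_var, Expr.eval, if_true]
          refine Or.inr (Or.inl ⟨by simp, ⟨u, v, hin⟩, fun a b hab hAab => ?_⟩)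
          rcases hD a b hab with h | ⟨rfl, rfl⟩
          · rcases hS' with ⟨h', -⟩ | ⟨h', -⟩ | ⟨-, h'⟩
            · omega
            · omega
            · exact absurd hAab (h' a b h)
          · exact hnB
        · simp only [Test.Holds, Expr.eval] at hb
          refine Runs.skip ?_ (by simp)
          simp only [Memory.setVar_var]
          rcases hS' with h | ⟨h, h', h''⟩ | ⟨h, h'⟩
          · exact Or.inl h
          · refine Or.inr (Or.inl ⟨h, h', fun a b hab hAab => ?_⟩)
            rcases hD a b hab with h | ⟨rfl, rfl⟩
            · exact h'' a b h hAab
            · exact hnB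
          · exact absurd h hb
      · have hout : ¬ A u v := by
          rw [← hAuv]
          rintro ⟨h1, h2⟩
          exact hb (by simp [ρ3, ρ4, ρ7, hρ, ρ2, r1, r2, h1, h2])
        refine Runs.skip ?_ (by simp)
        refine Scanned.congr (D := fun a b => a < u ∨ (a = u ∧ b < v)) (by simpa using hS')
          fun a b hab hAab => ?_
        rcases hD a b hab with h | ⟨rfl, rfl⟩
        · exact h
        · exact absurd hAab hout
    · intro ρ h
      refine Scanned.congr (D := fun a b => a < u ∨ (a = u ∧ b < n)) (by simpa using h)
        fun a b hab hAab => ?_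
      obtain ⟨-, b, -, rfl⟩ := hAab
      have := b.isLt
      omega
  · intro τ h
    have hAB : ∀ {u v}, A u v → u < n := by
      rintro u v ⟨⟨a, -, rfl⟩, -⟩; exact a.isLt
    rcases h with ⟨h, _, _, ⟨⟨u, hu, rfl⟩, v, hv, rfl⟩, huv⟩ |
      ⟨h, ⟨_, _, ⟨u, hu, -⟩, v, hv, -⟩, h'⟩ |
      ⟨h, h'⟩
    · refine ⟨fun h1 => by omega, fun _ _ _ hd => ⟨u, hu, v, hv, huv.resolve_left fun h' => ?_⟩⟩
      exact Finset.disjoint_left.1 hd hu (Fin.ext h' ▸ hv)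
    · refine ⟨fun _ => ⟨⟨u, hu⟩, ⟨v, hv⟩, Finset.disjoint_left.2 fun a ha hb => ?_,
        fun a ha b hb hm => ?_⟩, fun h1 => absurd h h1⟩
      · exact h' a a a.isLt ⟨⟨a, ha, rfl⟩, a, hb, rfl⟩ (Or.inl rfl)
      · exact h' a b a.isLt ⟨⟨a, ha, rfl⟩, b, hb, rfl⟩ (Or.inr hm)
    · refine ⟨fun h1 => by omega, fun _ ⟨u, hu⟩ ⟨v, hv⟩ _ => ?_⟩
      exact absurd ⟨⟨u, hu, rfl⟩, v, hv, rfl⟩ (h' u v u.isLt)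

/-! ### The main loop -/

/-- Tests the slots `i` and `j`; if they can be merged, then this is done, and otherwise the next
pair is taken. -/
def mainStep : Prog :=
  .ite (.le (.var 2) (.var 4))
    (.seq (.assign 3 (.add (.var 3) (.const 1))) (.assign 4 (.add (.var 3) (.const 1))))
    (.seq checkPair
      (.ite (.eq (.var 15) (.const 1)) mergePair (.assign 4 (.add (.var 4) (.const 1)))))

def mainLoop : Prog := .loop (.not (.le (.var 2) (.var 3))) mainStep

/-- The time for testing a pair of slots. -/
def scanTime (n : ℕ) : ℕ := n * (n * 37 + 16) + 40

lemma mergeTime_mono (n : ℕ) {N B : ℕ} (h : N ≤ B) : mergeTime n N ≤ mergeTime n B := by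
  unfold mergeTime vertexTime; gcongr

lemma Inv.of_checkPair {H₀ : WHypergraph (Fin n)} {σ τ : Memory} {E : ℕ → Finset (Fin n)}
    {W : ℕ → ℕ}
    {N i j : ℕ} (h : Inv H₀ p σ E W N i j) (hf : checkPair.Frame σ τ) : Inv H₀ p τ E W N i j where
  size := (hf.1 0 rfl).trans h.size
  slots := h.slots.of_frame hf rfl rfl rfl
  fst := (hf.1 3 rfl).trans h.fst
  snd := (hf.1 4 rfl).trans h.snd
  good := h.good
  zero6 v := by rw [hf.2 6 rfl]; exact h.zero6 v
  zero7 v := by rw [hf.2 7 rfl]; exact h.zero7 v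
  mark := by rw [hf.2 9 rfl]; exact h.mark
  lt := h.lt
  stuck := h.stuck

/-- The invariant of the main loop with the time `T` and the number `Q` of queries that suffice for
the remaining iterations; `B` is a bound on the number of slots. -/
def LoopInv (H₀ : WHypergraph (Fin n)) (p : Finset (Fin n) → ℤ) (B T Q : ℕ) (σ : Memory) : Prop :=
  ∃ E W N i j, Inv H₀ p σ E W N i j ∧
    scanTime n * ((B - i) * (B + 2) + (B + 1 - j)) + (mergeTime n B + scanTime n) *
      (potential p (slotsOf E W N) + (unmarked n σ).card) + 5 ≤ T ∧
    n * (potential p (slotsOf E W N) + (unmarked n σ).card) ≤ Q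

/-- The bound `B` on the number of slots gives the bound on the number of iterations: while no pair
is merged, the pair `(i, j)` increases lexicographically; and `D` bounds the number of calls of
`mergePair`. -/
theorem runs_mainLoop (hO : IsMaxOracle p O) (hsymm : SymmetricSetFunction p)
    (hskew : SkewSupermodular p) {H₀ : WHypergraph (Fin n)} {B : ℕ}
    (hB : H₀.edges.card + 2 * n ≤ B) (hK : B + 1 ≤ K) {σ : Memory} {E : ℕ → Finset (Fin n)}
    {W : ℕ → ℕ} {N : ℕ} (hI : Inv H₀ p σ E W N 0 1) {D : ℕ}
    (hD : potential p (slotsOf E W N) + (unmarked n σ).card ≤ D) :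
    Runs O K mainLoop σ
      (scanTime n * (B * (B + 2) + B) + (mergeTime n B + scanTime n) * D + 5) (n * D) fun τ =>
        ∃ E' W' N', τ.var 0 = n ∧ HasSlots τ E' W' N' ∧ N' ≤ B ∧ Good H₀ p (slotsOf E' W' N') ∧
          (ofSlots (slotsOf E' W' N')).StronglyCovers p := by
  refine Runs.loop (LoopInv H₀ p B) ?_ ?_ _ _ _ ?_
  · rintro T Q σ ⟨E, W, N, i, j, hI, hT, -⟩ hb
    refine ⟨⟨E, W, N, hI.size, hI.slots, ?_, hI.good, ?_⟩, by simp; omega⟩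
    · have := hI.good.card_edges_le hskew
      simp only [slotsOf, Multiset.card_map, Multiset.card_range, Fintype.card_fin] at this
      omega
    · simp only [Test.Holds, Expr.eval, hI.slots.count, hI.fst, not_not, Nat.cast_le] at hb
      refine stronglyCovers_of_stuck hsymm hskew hI.good.weak fun e he f hf hef => ?_
      obtain ⟨x, hx, rfl, -⟩ := mem_edges_ofSlots.1 he
      obtain ⟨y, hy, rfl, -⟩ := mem_edges_ofSlots.1 hf
      obtain ⟨a, ha, rfl⟩ := Multiset.mem_map.1 hx
      obtain ⟨b, hb', rfl⟩ := Multiset.mem_map.1 hy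
      rw [Multiset.mem_range] at ha hb'
      rcases lt_trichotomy a b with h | rfl | h
      · exact hI.stuck a b h hb' (Or.inl (by omega))
      · exact absurd rfl hef
      · exact (hI.stuck b a h ha (Or.inl (by omega))).symm
  · rintro T Q σ ⟨E, W, N, i, j, hI, hT, hQ⟩ hb
    simp only [Test.Holds, Expr.eval, hI.slots.count, hI.fst, Nat.cast_le, not_le] at hb
    have hNB : N ≤ B := by
      have := hI.good.card_edges_le hskew
      simp only [slotsOf, Multiset.card_map, Multiset.card_range, Fintype.card_fin] at this
      omega
    have hij := hI.lt
    set R := potential p (slotsOf E W N) + (unmarked n σ).card with hR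
    set S := scanTime n with hS
    have hSdef : S = n * (n * 37 + 16) + 40 := rfl
    set A := (B - i) * (B + 2) + (B + 1 - j) with hA
    -- the step from the pair `(i, j)` to a later pair `(i', j')`
    have hscan : ∀ (i' j' : ℕ) (τ : Memory), Inv H₀ p τ E W N i' j' → unmarked n τ = unmarked n σ →
        (B - i') * (B + 2) + (B + 1 - j') < A →
        LoopInv H₀ p B (T - S) Q τ := by
      intro i' j' τ hτ hun hlt
      refine ⟨E, W, N, i', j', hτ, ?_, by rw [hun]; exact hQ⟩
      rw [hun, ← hR, ← hS]
      have := Nat.mul_le_mul_left S hlt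
      rw [Nat.mul_succ] at this
      omega
    by_cases hjN : N ≤ j
    · have hlt : (B - (i + 1)) * (B + 2) + (B + 1 - (i + 2)) < A := by
        have h1 : B - i = (B - (i + 1)) + 1 := by omega
        rw [hA, h1, Nat.succ_mul]
        omega
      have := Nat.mul_le_mul_left S hlt
      rw [Nat.mul_succ] at this
      refine ⟨S - 5, 0, T - S, Q, by simp; omega, by omega, ?_⟩
      refine Runs.ite (fun _ => ?_) (fun hb => ?_) (by simp; omega)
      · refine Runs.assign_seq (Runs.assign (hscan (i + 1) (i + 2) _ ?_ ?_ hlt) (by simp; omega))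
          (by simp; omega)
        · refine ⟨by simpa using hI.size, (hI.slots.setVar (by decide) _).setVar (by decide) _,
            by simp [hI.fst], by simp [hI.fst]; ring, hI.good, hI.zero6, hI.zero7, hI.mark,
            by omega, ?_⟩
          rintro a b hab hbN (ha | ⟨rfl, hb⟩)
          · rcases Nat.lt_succ_iff_lt_or_eq.1 ha with h | rfl
            · exact hI.stuck a b hab hbN (Or.inl h)
            · exact hI.stuck a b hab hbN (Or.inr ⟨rfl, by omega⟩)
          · omega
        · rfl
      · simp only [Test.Holds, Expr.eval, hI.slots.count, hI.snd, Nat.cast_le] at hb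
        exact absurd hjN hb
    · have hlt : (B - i) * (B + 2) + (B + 1 - (j + 1)) < A := by omega
      have hτ' : checkPair.writesArr 9 = false := rfl
      by_cases hr : (E i).Nonempty ∧ (E j).Nonempty ∧ Disjoint (E i) (E j) ∧
          ∀ u ∈ E i, ∀ v ∈ E j, σ.arr 9 (u : ℕ) (v : ℕ) ≠ 1
      · obtain ⟨hEi, hEj, hdisj, hun⟩ := hr
        obtain ⟨u, hu⟩ := hEi
        obtain ⟨v, hv⟩ := hEj
        have hRpos : 0 < R := Nat.add_pos_right _ (Finset.card_pos.2
          ⟨(u, v), Finset.mem_filter.2 ⟨Finset.mem_univ _, hun u hu v hv⟩⟩)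
        have hTR := Nat.le_mul_of_pos_right (mergeTime n B + S) hRpos
        have hQR := Nat.le_mul_of_pos_right n hRpos
        have hM : mergeTime n N ≤ mergeTime n B := mergeTime_mono n hNB
        refine ⟨mergeTime n N + (S - 5), n, T - (mergeTime n B + S), Q - n, ?_, ?_, ?_⟩
        · rw [show (Test.not (Test.le (Expr.var 2) (Expr.var 3))).cost = 4 from rfl]
          omega
        · omega
        refine Runs.ite (fun hb => ?_) (fun _ => ?_) (by simp; omega)
        · simp only [Test.Holds, Expr.eval, hI.slots.count, hI.snd, Nat.cast_le] at hb
          exact absurd hb hjN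
        refine Runs.seq (runs_checkPair hI.size hb (by omega) hI.fst hI.snd hI.slots).frame ?_
          (by simp; omega) (by simp)
        rintro τ ⟨hf, -, hno⟩
        have τI := hI.of_checkPair hf
        have τun : unmarked n τ = unmarked n σ := by simp [unmarked, hf.2 9 hτ']
        refine Runs.ite (fun _ => ?_) (fun hb => ?_) (by simp; omega)
        · refine (runs_mergePair hO hsymm hskew τI (by omega) (by omega) hdisj ⟨u, hu⟩ ⟨v, hv⟩
            fun u hu v hv => by rw [hf.2 9 hτ']; exact hun u hu v hv).mono (by simp; omega)
            (by simp) ?_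
          rintro ρ ⟨E', W', N', hρ, hlt'⟩
          rw [τun, ← hR] at hlt'
          have h1 := Nat.mul_le_mul_left (mergeTime n B + S) hlt'
          have h2 := Nat.mul_le_mul_left n hlt'
          rw [Nat.mul_succ] at h1 h2
          refine ⟨E', W', N', i, j, hρ, ?_, ?_⟩
          · rw [← hS, ← hA]; omega
          · omega
        · obtain ⟨u, hu, v, hv, h⟩ := hno hb ⟨u, hu⟩ ⟨v, hv⟩ hdisj
          exact absurd h (hun u hu v hv)
      · have hlt2 := Nat.mul_le_mul_left S hlt
        rw [Nat.mul_succ] at hlt2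
        refine ⟨S - 5, 0, T - S, Q, by simp; omega, by omega, ?_⟩
        refine Runs.ite (fun hb => ?_) (fun _ => ?_) (by simp; omega)
        · simp only [Test.Holds, Expr.eval, hI.slots.count, hI.snd, Nat.cast_le] at hb
          exact absurd hb hjN
        refine Runs.seq (runs_checkPair hI.size hb (by omega) hI.fst hI.snd hI.slots).frame ?_
          (by simp; omega) (by simp)
        rintro τ ⟨hf, hyes, hno⟩
        have τI := hI.of_checkPair hf
        have τun : unmarked n τ = unmarked n σ := by simp [unmarked, hf.2 9 hτ']
        refine Runs.ite (fun hb => absurd (hyes hb) hr) (fun h15 => ?_) (by simp; omega)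
        refine Runs.assign (hscan i (j + 1) _ ?_ τun hlt) (by simp; omega)
        refine ⟨by simpa using τI.size, τI.slots.setVar (by decide) _, by simp [τI.fst],
          by simp [τI.snd], hI.good, τI.zero6, τI.zero7, τI.mark, by omega, ?_⟩
        rintro a b hab hbN (ha | ⟨rfl, hb⟩)
        · exact hI.stuck a b hab hbN (Or.inl ha)
        · rcases Nat.lt_succ_iff_lt_or_eq.1 ‹b < j + 1› with h | rfl
          · exact hI.stuck a b hab hbN (Or.inr ⟨rfl, h⟩)
          · intro hEa hEb hd
            obtain ⟨u, hu, v, hv, h⟩ := hno h15 hEa hEb hd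
            obtain ⟨Y, hY, huY, hvY⟩ := hI.mark u v h
            exact ⟨Y, hY, ⟨u, Finset.mem_inter.2 ⟨hu, huY⟩⟩, ⟨v, Finset.mem_inter.2 ⟨hv, hvY⟩⟩⟩
  · exact ⟨E, W, N, 0, 1, hI, by
      have := Nat.mul_le_mul_left (mergeTime n B + scanTime n) hD
      simp only [Nat.sub_zero, Nat.add_sub_cancel]; omega, Nat.mul_le_mul_left n hD⟩

/-! ### The algorithm -/

/-- Merges pairs of slots as long as this is possible and then outputs the hypergraph of the slots.
-/
def mergeProgram : Prog :=
  .seq copyInput (.seq (.assign 3 (.const 0)) (.seq (.assign 4 (.const 1))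
    (.seq mainLoop (.seq (.assign 5 (.var 0)) buildGraph))))

lemma potential_slots_le (p : Finset (Fin n) → ℤ) (H : WHypergraph (Fin n)) :
    potential p H.slots ≤ H.edges.card * (n + 1) + n * (2 * n) := by
  unfold potential
  rw [Fintype.card_fin]
  refine add_le_add ?_ (Nat.mul_le_mul_left _ (Nat.sub_le _ _))
  refine (Multiset.sum_le_card_nsmul _ (n + 1) fun x hx => ?_).trans (by simp [slots])
  obtain ⟨y, -, rfl⟩ := Multiset.mem_map.1 hx
  exact Nat.sub_le _ _

lemma exists_slotsOf_eq_slots {σ : Memory} {H : WHypergraph (Fin n)} (h : σ.Stores 1 0 1 H) :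
    ∃ E W, slotsOf E W H.edges.card = H.slots ∧ (∀ x < H.edges.card, σ.RowIs 0 x (E x)) ∧
      ∀ x < H.edges.card, σ.arr 1 x 0 = W x := by
  obtain ⟨e, -, he⟩ := h
  set E : ℕ → Finset (Fin n) := fun x => if h : x < H.edges.card then e ⟨x, h⟩ else ∅ with hE
  have hEx : ∀ x (h : x < H.edges.card), E x = e ⟨x, h⟩ := fun x h => dif_pos h
  refine ⟨E, fun x => H (E x), ?_, fun x hx => ?_, fun x hx => ?_⟩
  · have himg : (Finset.range H.edges.card).image E = H.edges := by
      ext f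
      rw [Finset.mem_image]
      constructor
      · rintro ⟨x, hx, rfl⟩
        rw [hEx x (Finset.mem_range.1 hx)]
        exact (e _).2
      · intro hf
        refine ⟨e.symm ⟨f, hf⟩, Finset.mem_range.2 (Fin.is_lt _), ?_⟩
        rw [hEx _ (Fin.is_lt _)]
        simp
    have hinj : Set.InjOn E (Finset.range H.edges.card) := by
      intro x hx y hy hxy
      rw [Finset.mem_coe, Finset.mem_range] at hx hy
      rw [hEx x hx, hEx y hy] at hxy
      simpa using e.injective (Subtype.ext hxy)
    have hval := Finset.image_val_of_injOn hinj
    rw [himg] at hval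
    rw [slots, hval, Multiset.map_map]
    rfl
  · rw [hEx x hx]; exact (he ⟨x, hx⟩).1
  · simp only [hEx x hx]; exact (he ⟨x, hx⟩).2

theorem runs_mergeProgram (hO : IsMaxOracle p O) (hsymm : SymmetricSetFunction p)
    (hskew : SkewSupermodular p) {H : WHypergraph (Fin n)} (hweak : H.WeaklyCovers p) {B D : ℕ}
    (hB : H.edges.card + 2 * n ≤ B) (hD : H.edges.card * (n + 1) + 3 * n ^ 2 ≤ D) {σ : Memory}
    (hσ : σ.IsInput H) :
    Runs O (B + 1) mergeProgram σ
      (scanTime n * (B * (B + 2) + B) + (mergeTime n B + scanTime n) * D + B * (n * 42 + 83) + 29)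
      (n * D) fun τ => ∃ Hs : WHypergraph (Fin n), τ.IsOutput Hs ∧ Hs.StronglyCovers p ∧
        H.ObtainedByMerging Hs ∧ Hs.edges.card ≤ H.edges.card + 2 * n := by
  obtain ⟨E, W, hEW, hE, hW⟩ := exists_slotsOf_eq_slots hσ.stores
  have hcount : σ.var 1 = (H.edges.card : ℤ) := by
    obtain ⟨e, he, -⟩ := hσ.stores
    exact he
  have hsplit : B * (n * 42 + 83) = B * (n * 15 + 22) + B * (n * 27 + 61) := by ring
  have hin : H.edges.card * (n * 15 + 22) ≤ B * (n * 15 + 22) :=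
    Nat.mul_le_mul_right _ (by omega)
  refine Runs.seq (runs_copyInput hσ.numVertices hcount hE hW).frame ?_ (by omega) (by simp)
  rintro τ ⟨hf, τs⟩
  have τzero : ∀ a, 4 ≤ a → τ.arr a = fun _ _ => 0 := fun a ha => by
    rw [hf.2 a (by simp [copyInput, Prog.forLoop, Prog.writesArr]; omega)]
    funext i j
    exact hσ.arr_zero a i j (by omega)
  refine Runs.assign_seq (Runs.assign_seq ?_ (by simp; omega)) (by simp; omega)
  refine Runs.seq (runs_mainLoop hO hsymm hskew (H₀ := H) hB le_rfl (E := E) (W := W)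
    (N := H.edges.card) (D := D)
    ⟨?_, (τs.setVar (by decide) _).setVar (by decide) _, ?_, ?_, ?_, ?_,
      ?_, ?_, Nat.zero_lt_one, ?_⟩ ?_) ?_ (by simp; omega) (by simp)
  · simp [hf.1 0 rfl, hσ.numVertices]
  · simp
  · simp
  · rw [hEW]; exact good_slots hweak
  · intro v; simp [τzero 6]
  · intro v; simp [τzero 7]
  · intro u v h; simp [τzero 9] at h
  · intro a b hab hb h; omega
  · rw [hEW]
    have h1 := potential_slots_le p H
    have h2 : (unmarked n ((τ.setVar 3 0).setVar 4 1)).card ≤ n * n := by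
      refine (Finset.card_le_univ _).trans (by simp)
    refine le_trans (add_le_add h1 h2) (le_trans (le_of_eq (by ring)) hD)
  · rintro ρ ⟨E', W', N', ρ0, ρs, hN', hg, hst⟩
    have hcard := hg.card_edges_le hskew
    rw [Fintype.card_fin] at hcard
    have hout : N' * (n * 27 + 61) ≤ B * (n * 27 + 61) := Nat.mul_le_mul_right _ hN'
    refine Runs.assign_seq ?_ (by simp; omega)
    refine (runs_buildGraph (by simpa using ρ0) (t := n) (by simp [ρ0])
      (ρs.setVar (by decide) _)).mono (by simp; omega) (by simp) ?_
    intro π hπ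
    simp only [addVertex_self] at hπ
    exact ⟨_, hπ, hst, hg.merged, (card_edges_ofSlots_le _).trans hcard⟩

lemma time_bound {n m X : ℕ} (hn : 0 < n) (hX : X = n + m) :
    scanTime n * (2 * X * (2 * X + 2) + 2 * X) + (mergeTime n (2 * X) + scanTime n) *
      (5 * (n * X)) + 2 * X * (n * 42 + 83) + 29 ≤ 10000 * (n ^ 3 * X ^ 2) := by
  have hX1 : 1 ≤ X := by omega
  have h1 : 1 ≤ n * X := Nat.mul_pos hn hX1
  have hnX : n ≤ n * X := Nat.le_mul_of_pos_right n hX1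
  have hXX : X ≤ n * X := Nat.le_mul_of_pos_left X hn
  have hnn : n ≤ n * n := Nat.le_mul_of_pos_right n hn
  have hs : scanTime n ≤ 93 * (n * n) := by
    unfold scanTime
    linarith [Nat.mul_pos hn hn]
  have hv : vertexTime n (2 * X) ≤ 600 * (n * X) := by
    unfold vertexTime
    linarith
  have hm : mergeTime n (2 * X) ≤ 800 * (n * (n * X)) := by
    unfold mergeTime
    have h3 := Nat.mul_le_mul_left n (Nat.add_le_add_right hv 9)
    have h4 : n ≤ n * (n * X) := Nat.le_mul_of_pos_right n h1
    linarith
  have hA : 2 * X * (2 * X + 2) + 2 * X ≤ 10 * (X * X) := by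
    linarith [Nat.le_mul_of_pos_right X hX1]
  have h5 := Nat.mul_le_mul hs hA
  have h6 : mergeTime n (2 * X) + scanTime n ≤ 893 * (n * (n * X)) := by
    have := Nat.mul_le_mul_left n hnX
    linarith
  have h7 := Nat.mul_le_mul_right (5 * (n * X)) h6
  have h8 : n * n * (X * X) ≤ n ^ 3 * X ^ 2 := by
    have := Nat.le_mul_of_pos_left (n * n * (X * X)) hn
    linarith [show n * (n * n * (X * X)) = n ^ 3 * X ^ 2 by ring]
  have h9 : n * X ≤ n * n * (X * X) := by
    have := Nat.mul_le_mul hnX hXX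
    have h10 := Nat.mul_le_mul h1 (le_refl (n * X))
    linarith [show n * X * (n * X) = n * n * (X * X) by ring]
  linarith [show 893 * (n * (n * X)) * (5 * (n * X)) = 4465 * (n ^ 3 * X ^ 2) by ring]

end RAM

theorem mainTheorem1 :
    ∃ C : ℕ,
      (∀ (V : Type*) [Fintype V] [DecidableEq V] (H : WHypergraph V) (p : Finset V → ℤ),
        SymmetricSetFunction p → SkewSupermodular p → H.WeaklyCovers p →
        ∃ Hs : WHypergraph V,
          Hs.StronglyCovers p ∧
          H.ObtainedByMerging Hs ∧
          Hs.edges.card ≤ H.edges.card + C * Fintype.card V) ∧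
      (∃ P : RAM.Prog,
        ∀ (n : ℕ), 0 < n → ∀ (H : WHypergraph (Fin n)) (p : Finset (Fin n) → ℤ),
          SymmetricSetFunction p → SkewSupermodular p → H.WeaklyCovers p →
          ∀ O : MaxQuery (Fin n) → Finset (Fin n) × ℤ, IsMaxOracle p O →
          ∀ σ : RAM.Memory, σ.IsInput H →
          ∃ (τ : RAM.Memory) (time : ℕ) (queries : List (MaxQuery (Fin n))),
            RAM.Exec O P σ τ time queries ∧
            time ≤ C * (n ^ 3 * (n + H.edges.card) ^ 2) ∧
            queries.length ≤ C * (n ^ 3 * (n + H.edges.card)) ∧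
            (∀ q ∈ queries, q.graph.edges.card ≤ C * (n + H.edges.card)) ∧
            ∃ Hs : WHypergraph (Fin n),
              τ.IsOutput Hs ∧
              Hs.StronglyCovers p ∧
              H.ObtainedByMerging Hs ∧
              Hs.edges.card ≤ H.edges.card + C * n) := by
  -- a crude constant for which the time bound holds with room to spare
  refine ⟨10000, fun V _ _ H p hsymm hskew hweak => ?_, RAM.mergeProgram,
    fun n hn H p hsymm hskew hweak O hO σ hσ => ?_⟩
  · obtain ⟨Hs, h1, h2, h3⟩ := WHypergraph.exists_merged_stronglyCovers hsymm hskew hweak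
    exact ⟨Hs, h1, h2, h3.trans (by omega)⟩
  · set X := n + H.edges.card with hX
    have hXpos : 1 ≤ X := by omega
    have hD : H.edges.card * (n + 1) + 3 * n ^ 2 ≤ 5 * (n * X) := by
      rw [hX]
      nlinarith [Nat.le_mul_of_pos_left H.edges.card hn]
    obtain ⟨τ, t, qs, hexec, ht, hq, hK, Hs, hout, h1, h2, h3⟩ :=
      RAM.runs_mergeProgram hO hsymm hskew hweak (B := 2 * X) (by omega) hD hσ
    refine ⟨τ, t, qs, hexec, ht.trans (RAM.time_bound hn hX), hq.trans ?_,
      fun q hq => (hK q hq).trans (by omega), Hs, hout, h1, h2, h3.trans (by omega)⟩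
    have := Nat.le_mul_of_pos_left (n * (n * X)) hn
    linarith [show n * (n * (n * X)) = n ^ 3 * X by ring]
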